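/- **Theorem.** An instance of the vertex-weighted grade-of-service Steiner tree problem (V-GSST) consists of a finite connected undirected graph $G=(V,E)$, a nonempty set $T\subseteq V$ of terminals with required grades $R(v)\in\{1,\dots,\ell\}$ for $v\in T$, and costs $c_i(v)$ of a facility of grade $i$ on $v$, with $0\le c_1(v)\le c_2(v)\le\dots\le c_\ell(v)$ for all $v\in V$. A solution is a subtree $G'$ of $G$ containing $T$, together with integer grades $y(v)\in\{1,\dots,\ell\}$ for $v\in V(G')$ (and $y(v)=0$ for $v\notin V(G')$), such that $y(v)\ge R(v)$ for all $v\in T$, and for all $u,v\in T$ every vertex $w$ on the $u$-$v$ path in $G'$ has $y(w)\ge\min(R(u),R(v))$. Its cost is $\sum_{v\in V(G')}c_{y(v)}(v)$, and $\mathrm{OPT}$ is the minimum cost of a solution. There is a polynomial-time $(2\ln|T|)$-approximation algorithm for V-GSST: a single algorithm that, on every instance, returns in polynomial time a solution, whose cost is at most $2\ln|T|\cdot\mathrm{OPT}$ whenever $|T|\ge 2$, and also when $|T|=1$ if the required facility on the only terminal $v$ is free, $c_{R(v)}(v)=0$. In particular the ratio does not depend on the number $\ell$ of grades. Polynomial time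 means both of the following, for the same program of a random access machine and the same polynomial. For rational costs, the running time under the logarithmic cost criterion (every operation is charged the number of binary digits of its operands and of its result) is polynomial in the length of the input, in which $G$ counts $|V|^2$ and the cost table counts the binary lengths of its $|V|\,\ell$ entries. For arbitrary real costs, where reals may only be added, subtracted, multiplied by natural numbers and compared, each at unit cost (beyond the binary digits of the natural numbers involved), the running time is polynomial in $|V|^2+|V|\,\ell$. -/

import Mathlib

noncomputable section

namespace VGSST

/-! ## The machine model

Structured programs for a random access machine with two kinds of memory cells: cells that hold
natural numbers (also used as addresses), and cells that hold numbers of a type `K`, which carry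
the costs.  The instructions on `K` are addition, subtraction, multiplication by a natural number
and comparison.  There are no products or quotients of elements of `K` and no rounding, and a
program contains no constants of `K`, so one program runs over every `K`. -/

/-- Expressions with natural-number values.  `cell a e` is cell `e` of the array with name `a`;
`sub` is truncated subtraction. -/
inductive NatExp where
  | const (k : ℕ)
  | cell (a : ℕ) (e : NatExp)
  | add (e f : NatExp)
  | sub (e f : NatExp)
  | mul (e f : NatExp)

/-- Expressions with values in `K`. -/
inductive NumExp where
  | cell (a : ℕ) (e : NatExp)
  | add (x y : NumExp)
  | sub (x y : NumExp)
  | smul (e : NatExp) (x : NumExp)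

/-- Tests in conditionals and loops. -/
inductive Test where
  | natLe (e f : NatExp)
  | numLe (x y : NumExp)
  | neg (s : Test)
  | conj (s t : Test)

/-- Programs. `setNat a e f` stores the value of `f` in cell `e` of the array `a`. -/
inductive Prog where
  | setNat (a : ℕ) (e f : NatExp)
  | setNum (a : ℕ) (e : NatExp) (x : NumExp)
  | seq (p q : Prog)
  | ite (s : Test) (p q : Prog)
  | loop (s : Test) (p : Prog)

/-- The memory: `nat a j` and `num a j` are the contents of cell `j` of the array with name `a`.
A program names finitely many arrays. -/
structure Mem (K : Type) where
  nat : ℕ → ℕ → ℕ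
  num : ℕ → ℕ → K

/-- Write a natural number into a cell. -/
def Mem.writeNat {K : Type} (m : Mem K) (a j k : ℕ) : Mem K where
  nat := Function.update m.nat a (Function.update (m.nat a) j k)
  num := m.num

/-- Write an element of `K` into a cell. -/
def Mem.writeNum {K : Type} (m : Mem K) (a j : ℕ) (x : K) : Mem K where
  nat := m.nat
  num := Function.update m.num a (Function.update (m.num a) j x)

/-- The value of a natural-number expression. -/
def NatExp.eval {K : Type} (m : Mem K) : NatExp → ℕ
  | .const k => k
  | .cell a e => m.nat a (e.eval m)
  | .add e f => e.eval m + f.eval m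
  | .sub e f => e.eval m - f.eval m
  | .mul e f => e.eval m * f.eval m

/-- The time to evaluate a natural-number expression (logarithmic cost): every subexpression is
charged `1` plus the number of binary digits of its value. -/
def NatExp.time {K : Type} (m : Mem K) : NatExp → ℕ
  | .const k => 1 + Nat.size k
  | .cell a e => 1 + Nat.size ((NatExp.cell a e).eval m) + e.time m
  | .add e f => 1 + Nat.size ((NatExp.add e f).eval m) + e.time m + f.time m
  | .sub e f => 1 + Nat.size ((NatExp.sub e f).eval m) + e.time m + f.time m
  | .mul e f => 1 + Nat.size ((NatExp.mul e f).eval m) + e.time m + f.time m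

/-- The value of a `K`-expression. -/
def NumExp.eval {K : Type} [AddCommGroup K] (m : Mem K) : NumExp → K
  | .cell a e => m.num a (e.eval m)
  | .add x y => x.eval m + y.eval m
  | .sub x y => x.eval m - y.eval m
  | .smul e x => e.eval m • x.eval m

/-- The time to evaluate a `K`-expression: every subexpression of type `K` is charged `1` plus the
size `sz` of its value. -/
def NumExp.time {K : Type} [AddCommGroup K] (sz : K → ℕ) (m : Mem K) : NumExp → ℕ
  | .cell a e => 1 + sz ((NumExp.cell a e).eval m) + e.time m
  | .add x y => 1 + sz ((NumExp.add x y).eval m) + x.time sz m + y.time sz m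
  | .sub x y => 1 + sz ((NumExp.sub x y).eval m) + x.time sz m + y.time sz m
  | .smul e x => 1 + sz ((NumExp.smul e x).eval m) + e.time m + x.time sz m

/-- The test succeeds. -/
def Test.Holds {K : Type} [AddCommGroup K] [LinearOrder K] (m : Mem K) : Test → Prop
  | .natLe e f => e.eval m ≤ f.eval m
  | .numLe x y => x.eval m ≤ y.eval m
  | .neg s => ¬ s.Holds m
  | .conj s t => s.Holds m ∧ t.Holds m

/-- The time to evaluate a test. -/
def Test.time {K : Type} [AddCommGroup K] (sz : K → ℕ) (m : Mem K) : Test → ℕ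
  | .natLe e f => 1 + e.time m + f.time m
  | .numLe x y => 1 + x.time sz m + y.time sz m
  | .neg s => 1 + s.time sz m
  | .conj s t => 1 + s.time sz m + t.time sz m

/-- `Exec sz p m t m'`: started in memory `m`, the program `p` halts after time `t` with
memory `m'`. -/
inductive Exec {K : Type} [AddCommGroup K] [LinearOrder K] (sz : K → ℕ) :
    Prog → Mem K → ℕ → Mem K → Prop where
  | setNat (a : ℕ) (e f : NatExp) (m : Mem K) :
      Exec sz (.setNat a e f) m (1 + e.time m + f.time m) (m.writeNat a (e.eval m) (f.eval m))
  | setNum (a : ℕ) (e : NatExp) (x : NumExp) (m : Mem K) :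
      Exec sz (.setNum a e x) m (1 + e.time m + x.time sz m) (m.writeNum a (e.eval m) (x.eval m))
  | seq {p q : Prog} {m₀ m₁ m₂ : Mem K} {s t : ℕ} :
      Exec sz p m₀ s m₁ → Exec sz q m₁ t m₂ → Exec sz (.seq p q) m₀ (s + t) m₂
  | iteTrue {b : Test} {p q : Prog} {m m' : Mem K} {t : ℕ} :
      b.Holds m → Exec sz p m t m' → Exec sz (.ite b p q) m (1 + b.time sz m + t) m'
  | iteFalse {b : Test} {p q : Prog} {m m' : Mem K} {t : ℕ} :
      ¬ b.Holds m → Exec sz q m t m' → Exec sz (.ite b p q) m (1 + b.time sz m + t) m'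
  | loopDone {b : Test} {p : Prog} {m : Mem K} :
      ¬ b.Holds m → Exec sz (.loop b p) m (1 + b.time sz m) m
  | loopStep {b : Test} {p : Prog} {m₀ m₁ m₂ : Mem K} {s t : ℕ} :
      b.Holds m₀ → Exec sz p m₀ s m₁ → Exec sz (.loop b p) m₁ t m₂ →
        Exec sz (.loop b p) m₀ (1 + b.time sz m₀ + s + t) m₂

/-- The number of binary digits of the numerator and the denominator of a rational number. -/
def bitSize (x : ℚ) : ℕ := Nat.size x.num.natAbs + Nat.size x.den

/-! ## The vertex-weighted grade-of-service Steiner tree problem -/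

/-- The data of an instance: a graph on the vertices `0, …, n - 1`, the number `ℓ` of grades, the
terminals `T`, the required grades `R` (only their values on `T` matter) and the costs `c i v` of a
facility of grade `i` on the vertex `v` (only the grades `1, …, ℓ` matter). -/
structure Instance (K : Type) where
  n : ℕ
  ℓ : ℕ
  G : SimpleGraph (Fin n)
  T : Finset (Fin n)
  R : Fin n → ℕ
  c : ℕ → Fin n → K

variable {K : Type}

/-- The standing assumptions on an instance: the graph is connected, there is a terminal, required
grades lie in `{1, …, ℓ}`, and `0 ≤ c 1 v ≤ c 2 v ≤ … ≤ c ℓ v` for every vertex `v`. -/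
structure Instance.Valid [Zero K] [LE K] (I : Instance K) : Prop where
  connected : I.G.Connected
  nonempty : I.T.Nonempty
  grade : ∀ v ∈ I.T, 1 ≤ I.R v ∧ I.R v ≤ I.ℓ
  nonneg : ∀ v, 0 ≤ I.c 1 v
  mono : ∀ v i j, 1 ≤ i → i ≤ j → j ≤ I.ℓ → I.c i v ≤ I.c j v

/-- `H` with the assigned grades `y` is a solution: `H` is a subtree of the graph that contains the
terminals, its vertices (and no others) carry facilities, of grades between `1` and `ℓ`, every
terminal has at least its required grade, and the path in `H` between two terminals `u` and `v`
uses only vertices of grade at least `min (R u) (R v)`. -/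
structure Instance.Feasible (I : Instance K) (H : I.G.Subgraph) (y : Fin I.n → ℕ) : Prop where
  tree : H.coe.IsTree
  terminals : ∀ v ∈ I.T, v ∈ H.verts
  grade : ∀ v ∈ H.verts, 1 ≤ y v ∧ y v ≤ I.ℓ
  none : ∀ v, v ∉ H.verts → y v = 0
  required : ∀ v ∈ I.T, I.R v ≤ y v
  path : ∀ u ∈ I.T, ∀ v ∈ I.T, ∀ p : H.spanningCoe.Walk u v, p.IsPath →
    ∀ w ∈ p.support, min (I.R u) (I.R v) ≤ y w

open Classical in
/-- The cost of a solution: the sum of the costs of the facilities on the vertices of `H`. -/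
def Instance.cost [AddCommMonoid K] (I : Instance K) (H : I.G.Subgraph) (y : Fin I.n → ℕ) : K :=
  ∑ v ∈ Finset.univ.filter (fun v => v ∈ H.verts), I.c (y v) v

/-- `opt` is the minimum cost of a solution. -/
def Instance.IsOpt [AddCommMonoid K] [LE K] (I : Instance K) (opt : K) : Prop :=
  IsLeast {x : K | ∃ (H : I.G.Subgraph) (y : Fin I.n → ℕ), I.Feasible H y ∧ x = I.cost H y} opt

/-! ## Input, output and polynomial-time approximation -/

open Classical in
/-- The memory that holds the instance: `n` and `ℓ` in cells `0` and `1` of the first array, the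
adjacency matrix in the second, the required grades (`0` for a vertex that is not a terminal) in
the third, and `c i v` in cell `v * ℓ + (i - 1)` of the first array of numbers.  All other cells
hold `0`. -/
def Instance.input [Zero K] (I : Instance K) : Mem K where
  nat a j :=
    if a = 0 then (if j = 0 then I.n else if j = 1 then I.ℓ else 0)
    else if a = 1 then
      (if ∃ u v : Fin I.n, I.G.Adj u v ∧ j = (u : ℕ) * I.n + (v : ℕ) then 1 else 0)
    else if a = 2 then (if h : j < I.n then (if ⟨j, h⟩ ∈ I.T then I.R ⟨j, h⟩ else 0) else 0)
    else 0
  num a j :=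
    if a = 0 then (if h : j / I.ℓ < I.n then I.c (j % I.ℓ + 1) ⟨j / I.ℓ, h⟩ else 0) else 0

open Classical in
/-- The memory holds the solution `H`, `y`: the assigned grades are in the fourth array of natural
numbers and the adjacency matrix of `H` is in the fifth. -/
def Instance.Output (I : Instance K) (m : Mem K) (H : I.G.Subgraph) (y : Fin I.n → ℕ) : Prop :=
  (∀ v : Fin I.n, m.nat 3 v = y v) ∧
    ∀ u v : Fin I.n, m.nat 4 ((u : ℕ) * I.n + (v : ℕ)) = if H.Adj u v then 1 else 0

/-- The length of the input: the entries of the adjacency matrix, and the entries of the table of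
costs with their sizes. -/
def Instance.length (I : Instance K) (sz : K → ℕ) : ℕ :=
  I.n * I.n + ∑ v : Fin I.n, ∑ i ∈ Finset.Icc 1 I.ℓ, (1 + sz (I.c i v))

/-- On every instance with costs in `K`, the program `p` halts within the time `q` (length of the
input) and returns a solution, of cost at most `2 * log |T|` times the minimum.  The ratio
`2 * log |T|` is `0` for a single terminal, so in this case the bound on the cost is claimed only
if the required facility on the terminal is free.  `val` maps `K` to the real numbers. -/
def ApproximatesInTime [AddCommGroup K] [LinearOrder K] (p : Prog) (q : Polynomial ℕ)
    (sz : K → ℕ) (val : K → ℝ) : Prop :=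
  ∀ I : Instance K, I.Valid →
    ∃ (t : ℕ) (m : Mem K) (H : I.G.Subgraph) (y : Fin I.n → ℕ) (opt : K),
      Exec sz p I.input t m ∧ t ≤ q.eval (I.length sz) ∧
      I.Output m H y ∧ I.Feasible H y ∧ I.IsOpt opt ∧
      ((2 ≤ I.T.card ∨ ∀ v ∈ I.T, I.c (I.R v) v = 0) →
        val (I.cost H y) ≤ 2 * Real.log (I.T.card : ℝ) * val opt)

end VGSST

end

set_option linter.unusedSectionVars false

noncomputable section

namespace VGSST

/-! Pay for the required facility on every terminal in advance. The cost of a solution `y` is then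
this fixed prepaid amount plus its reduced cost W, the sum of the surcharges `extra (y v) v`. Only W
is treated by a greedy algorithm in the manner of Klein and Ravi. It keeps a set A of active
terminals, at first all of T, such that every terminal t is connected, through vertices of grade at
least that of t, to an active terminal of at least the grade of t. While A has two elements, the
algorithm buys a spider: a center v, a leg to a terminal r₁ at grade g ≤ `need r₁`, and s legs to
other active terminals of grade at most g, each leg at the grade of its own terminal. These s
terminals become inactive.

The main point is that, for every solution, some spider costs at most (2s / |A|) W. Root the
solution tree at an active terminal of highest grade; all ancestors of a terminal then have at least
its grade. A lowest vertex with two descendants in A is the center of a spider with disjoint legs,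
and averaging over such spiders gives one with a set C of feet and cost at most (|C| / |A|) W
(`exists_spider`). The foot of highest grade stays active and the |C| - 1 ≥ |C| / 2 others are
removed, hence the factor 2. The leg to the highest foot is only needed at the second highest grade,
which the solution guarantees there. For given v, r₁ and g the best feet are the nearest ones, so
they can be described by the farthest foot r₃ (`exists_threshold`), and the search is polynomial
once shortest paths for every grade are known.

As s / a ≤ ln a - ln (a - s), the payments telescope to 2 ln |T| · W (`run_mergeStep`). The prepaid
amount is covered because 2 ln 2 > 1, or because it vanishes. In the end a tree is grown from the
last active terminal, treating the grades in descending order. Grades do not increase away from the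
root, and a path between two terminals lies in the union of their paths to the root
(`Growing.exists_feasible`).

For the running time, the algorithm is a for-program whose loops are bounded by n or ℓ + 1. Stored
natural numbers come from product-free expressions, so each assignment lengthens numbers by a
bounded number of bits and everything stays polynomial (`Stmt.exec_compile`). A `Gauge` covers both
cost models; for rationals it works over a common denominator. -/

/-! ## For-programs -/

/-- Programs whose only loops are bounded by `n` or `ℓ + 1`; the loop variable of level `d` is
read as cell `d` of the array `9`. -/
inductive Stmt where
  | skip
  | setNat (a : ℕ) (e f : NatExp)
  | setNum (a : ℕ) (e : NatExp) (x : NumExp)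
  | seq (p q : Stmt)
  | ite (s : Test) (p q : Stmt)
  | for_ (d : ℕ) (vertices : Bool) (p : Stmt)

/-- The memory in which the loop variables have the values `env`. -/
def scope {K : Type} (env : ℕ → ℕ) (m : Mem K) : Mem K where
  nat := Function.update m.nat 9 env
  num := m.num

/-- The bound of a loop. -/
def dim {K : Type} (vertices : Bool) (m : Mem K) : ℕ :=
  if vertices then m.nat 0 0 else m.nat 0 1 + 1

open Classical in
/-- The effect of a for-program. -/
def Stmt.run {K : Type} [AddCommGroup K] [LinearOrder K] :
    Stmt → (ℕ → ℕ) → Mem K → Mem K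
  | .skip, _, m => m
  | .setNat a e f, env, m => m.writeNat a (e.eval (scope env m)) (f.eval (scope env m))
  | .setNum a e x, env, m => m.writeNum a (e.eval (scope env m)) (x.eval (scope env m))
  | .seq p q, env, m => q.run env (p.run env m)
  | .ite s p q, env, m => if s.Holds (scope env m) then p.run env m else q.run env m
  | .for_ d b p, env, m =>
      Nat.rec m (fun k m' => p.run (Function.update env d k) m') (dim b m)

/-- The bound of a loop as an expression. -/
def dimExp (vertices : Bool) : NatExp :=
  if vertices then .cell 0 (.const 0) else .add (.cell 0 (.const 1)) (.const 1)

/-- Translation of for-programs into machine programs. -/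
def Stmt.compile : Stmt → Prog
  | .skip => .setNat 9 (.const 0) (.cell 9 (.const 0))
  | .setNat a e f => .setNat a e f
  | .setNum a e x => .setNum a e x
  | .seq p q => .seq p.compile q.compile
  | .ite s p q => .ite s p.compile q.compile
  | .for_ d b p =>
      .seq (.setNat 9 (.const d) (.const 0))
        (.loop (.natLe (.add (.cell 9 (.const d)) (.const 1)) (dimExp b))
          (.seq p.compile
            (.setNat 9 (.const d) (.add (.cell 9 (.const d)) (.const 1)))))

/-- The address of a loop variable of level below `d`. -/
def NatExp.isVar (d : ℕ) : NatExp → Bool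
  | .const i => decide (i < d)
  | _ => false

/-- Only loop variables of level below `d` occur. -/
def NatExp.scoped (d : ℕ) : NatExp → Bool
  | .const _ => true
  | .cell a e => if a = 9 then e.isVar d else e.scoped d
  | .add e f => e.scoped d && f.scoped d
  | .sub e f => e.scoped d && f.scoped d
  | .mul e f => e.scoped d && f.scoped d

def NumExp.scoped (d : ℕ) : NumExp → Bool
  | .cell _ e => e.scoped d
  | .add x y => x.scoped d && y.scoped d
  | .sub x y => x.scoped d && y.scoped d
  | .smul e x => e.scoped d && x.scoped d

def Test.scoped (d : ℕ) : Test → Bool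
  | .natLe e f => e.scoped d && f.scoped d
  | .numLe x y => x.scoped d && y.scoped d
  | .neg s => s.scoped d
  | .conj s t => s.scoped d && t.scoped d

/-- Expressions without products. -/
def NatExp.linear : NatExp → Bool
  | .const _ => true
  | .cell _ _ => true
  | .add e f => e.linear && f.linear
  | .sub e _ => e.linear
  | .mul _ _ => false

/-- Loop variables are used lexically, the dimensions and the loop variables are not assigned to,
and the natural numbers that are stored come from linear expressions. -/
def Stmt.ok (d : ℕ) : Stmt → Bool
  | .skip => true
  | .setNat a e f => decide (a ≠ 0) && decide (a ≠ 9) && e.scoped d && f.scoped d && f.linear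
  | .setNum _ e x => e.scoped d && x.scoped d
  | .seq p q => p.ok d && q.ok d
  | .ite s p q => s.scoped d && p.ok d && q.ok d
  | .for_ d' _ p => decide (d' = d) && p.ok (d + 1)

/-- The array `a` of natural numbers is not assigned to. -/
def Stmt.keepsNat (a : ℕ) : Stmt → Bool
  | .skip => true
  | .setNat a' _ _ => decide (a' ≠ a)
  | .setNum _ _ _ => true
  | .seq p q => p.keepsNat a && q.keepsNat a
  | .ite _ p q => p.keepsNat a && q.keepsNat a
  | .for_ _ _ p => p.keepsNat a

/-- The array `a` of elements of `K` is not assigned to. -/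
def Stmt.keepsNum (a : ℕ) : Stmt → Bool
  | .skip => true
  | .setNat _ _ _ => true
  | .setNum a' _ _ => decide (a' ≠ a)
  | .seq p q => p.keepsNum a && q.keepsNum a
  | .ite _ p q => p.keepsNum a && q.keepsNum a
  | .for_ _ _ p => p.keepsNum a

/-! ### Frame rules: arrays that are never assigned to. -/

section Frame

variable {K : Type} [AddCommGroup K] [LinearOrder K]

theorem Stmt.run_nat {a : ℕ} {s : Stmt} (h : s.keepsNat a = true) (env : ℕ → ℕ) (m : Mem K) :
    (s.run env m).nat a = m.nat a := by
  induction s generalizing env m with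
  | skip => rfl
  | setNat a' e f =>
    simp only [Stmt.keepsNat, decide_eq_true_eq] at h
    simp [Stmt.run, Mem.writeNat, Function.update_of_ne (Ne.symm h)]
  | setNum a' e x => rfl
  | seq p q hp hq =>
    simp only [Stmt.keepsNat, Bool.and_eq_true] at h
    simp [Stmt.run, hq h.2, hp h.1]
  | ite t p q hp hq =>
    simp only [Stmt.keepsNat, Bool.and_eq_true] at h
    simp only [Stmt.run]
    split_ifs
    · exact hp h.1 _ _
    · exact hq h.2 _ _
  | for_ d b p hp =>
    simp only [Stmt.run]
    induction dim b m with
    | zero => rfl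
    | succ k ih => simpa [hp h] using ih

theorem Stmt.run_num {a : ℕ} {s : Stmt} (h : s.keepsNum a = true) (env : ℕ → ℕ) (m : Mem K) :
    (s.run env m).num a = m.num a := by
  induction s generalizing env m with
  | skip => rfl
  | setNum a' e f =>
    simp only [Stmt.keepsNum, decide_eq_true_eq] at h
    simp [Stmt.run, Mem.writeNum, Function.update_of_ne (Ne.symm h)]
  | setNat a' e x => rfl
  | seq p q hp hq =>
    simp only [Stmt.keepsNum, Bool.and_eq_true] at h
    simp [Stmt.run, hq h.2, hp h.1]
  | ite t p q hp hq =>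
    simp only [Stmt.keepsNum, Bool.and_eq_true] at h
    simp only [Stmt.run]
    split_ifs
    · exact hp h.1 _ _
    · exact hq h.2 _ _
  | for_ d b p hp =>
    simp only [Stmt.run]
    induction dim b m with
    | zero => rfl
    | succ k ih => simpa [hp h] using ih

theorem Stmt.ok_keepsNat_zero {d : ℕ} {s : Stmt} (h : s.ok d = true) : s.keepsNat 0 = true := by
  induction s generalizing d with
  | skip => rfl
  | setNat a e f => simp_all [Stmt.ok, Stmt.keepsNat]
  | setNum a e x => rfl
  | seq p q hp hq =>
    simp only [Stmt.ok, Bool.and_eq_true] at h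
    simp [Stmt.keepsNat, hp h.1, hq h.2]
  | ite t p q hp hq =>
    simp only [Stmt.ok, Bool.and_eq_true] at h
    simp [Stmt.keepsNat, hp h.1.2, hq h.2]
  | for_ d' b p hp =>
    simp only [Stmt.ok, Bool.and_eq_true] at h
    exact hp h.2

end Frame

/-! ## Running times of for-programs -/

/-- A family of sets of elements of `K`: `W c` contains what can be computed from the input with
`c` bits more, and the elements of `W c` have size at most `Λ + c`. -/
structure Gauge {K : Type} [AddCommGroup K] (sz : K → ℕ) (Λ : ℕ) where
  W : ℕ → Set K
  mono : ∀ {c c'}, c ≤ c' → W c ⊆ W c'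
  add : ∀ {c x y}, x ∈ W c → y ∈ W c → x + y ∈ W (c + 1)
  sub : ∀ {c x y}, x ∈ W c → y ∈ W c → x - y ∈ W (c + 1)
  smul : ∀ {b c k x}, k ≤ 2 ^ b → x ∈ W c → k • x ∈ W (c + b)
  size : ∀ {c x}, x ∈ W c → sz x ≤ Λ + c

/-- If all stored naturals are at most `2 ^ b`, the value is at most `2 ^ (width * (b + 1))`. Sums
are charged like products: the exponents are positive, and then `2 ^ x + 2 ^ y ≤ 2 ^ (x + y)`. -/
def NatExp.width : NatExp → ℕ
  | .const k => k + 1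
  | .cell _ _ => 1
  | .add e f => e.width + f.width
  | .sub e _ => e.width
  | .mul e f => e.width + f.width

/-- The additive counterpart of `width`: the value of a linear expression is at most `2 ^ (b +
linWidth)`. The `0` for products is a placeholder, since a linear expression can contain a product
only inside an address or a subtrahend. -/
def NatExp.linWidth : NatExp → ℕ
  | .const k => k
  | .cell _ _ => 0
  | .add e f => e.linWidth + f.linWidth + 1
  | .sub e _ => e.linWidth
  | .mul _ _ => 0

/-- Evaluation time in units of `b + 1`. -/
def NatExp.work : NatExp → ℕ
  | .const k => k + 3
  | .cell _ e => 3 + e.work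
  | .add e f => 2 + (e.width + f.width) + e.work + f.work
  | .sub e f => 2 + e.width + e.work + f.work
  | .mul e f => 2 + (e.width + f.width) + e.work + f.work

/-- Evaluation raises the index of the gauge by at most `width * (b + 1)`; the `+ 1` pays for the
carry bit of a sum. -/
def NumExp.width : NumExp → ℕ
  | .cell _ _ => 0
  | .add x y => x.width + y.width + 1
  | .sub x y => x.width + y.width + 1
  | .smul e x => e.width + x.width

def NumExp.work : NumExp → ℕ
  | .cell _ e => 1 + e.work
  | .add x y => x.width + y.width + 2 + x.work + y.work
  | .sub x y => x.width + y.width + 2 + x.work + y.work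
  | .smul e x => e.width + x.width + 1 + e.work + x.work

def Test.work : Test → ℕ
  | .natLe e f => 1 + e.work + f.work
  | .numLe x y => 1 + x.work + y.work
  | .neg s => 1 + s.work
  | .conj s t => 1 + s.work + t.work

/-- All natural numbers in the memory have at most `b` bits, and all other numbers lie in `W c`. -/
def Bounded {K : Type} [AddCommGroup K] {sz : K → ℕ} {Λ : ℕ} (g : Gauge sz Λ) (b c : ℕ)
    (m : Mem K) : Prop :=
  (∀ a j, m.nat a j ≤ 2 ^ b) ∧ ∀ a j, m.num a j ∈ g.W c

/-! ### Bounds on the values and evaluation times of expressions. -/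

section Time

variable {K : Type} {b c : ℕ} {m : Mem K}

theorem NatExp.one_le_width (e : NatExp) : 1 ≤ e.width := by
  induction e with
  | const k => simp [NatExp.width]
  | cell a e => simp [NatExp.width]
  | add e f he hf => simp only [NatExp.width]; omega
  | sub e f he hf => simpa [NatExp.width] using he
  | mul e f he hf => simp only [NatExp.width]; omega

theorem two_pow_add_le {a b : ℕ} (ha : 1 ≤ a) (hb : 1 ≤ b) : 2 ^ a + 2 ^ b ≤ 2 ^ (a + b) := by
  have h1 : 2 ≤ 2 ^ a := by simpa using Nat.pow_le_pow_right (n := 2) (by norm_num) ha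
  have h2 : 2 ≤ 2 ^ b := by simpa using Nat.pow_le_pow_right (n := 2) (by norm_num) hb
  rw [pow_add]; nlinarith

theorem NatExp.eval_le (h : ∀ a j, m.nat a j ≤ 2 ^ b) (e : NatExp) :
    e.eval m ≤ 2 ^ (e.width * (b + 1)) := by
  induction e with
  | const k =>
    simp only [NatExp.eval, NatExp.width]
    calc k ≤ 2 ^ k := Nat.lt_two_pow_self.le
      _ ≤ _ := Nat.pow_le_pow_right (by norm_num) (by nlinarith)
  | cell a e => 
    simp only [NatExp.eval, NatExp.width]
    exact (h _ _).trans (Nat.pow_le_pow_right (by norm_num) (by omega))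
  | add e f he hf =>
    have h1 := e.one_le_width
    have h2 := f.one_le_width
    simp only [NatExp.eval, NatExp.width, add_mul]
    exact (Nat.add_le_add he hf).trans (two_pow_add_le (by nlinarith) (by nlinarith))
  | sub e f he hf => exact (Nat.sub_le _ _).trans he
  | mul e f he hf =>
    simp only [NatExp.eval, NatExp.width, add_mul, pow_add]
    exact Nat.mul_le_mul he hf

/-- The reason for storing only linear expressions: repeated squaring would double the bit length in
every pass of a loop, whereas here a constant is added. -/
theorem NatExp.eval_le_of_linear (h : ∀ a j, m.nat a j ≤ 2 ^ b) {e : NatExp}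
    (he : e.linear = true) : e.eval m ≤ 2 ^ (b + e.linWidth) := by
  induction e with
  | const k =>
    simp only [NatExp.eval, NatExp.linWidth]
    calc k ≤ 2 ^ k := Nat.lt_two_pow_self.le
      _ ≤ _ := Nat.pow_le_pow_right (by norm_num) (by omega)
  | cell a e => exact h _ _
  | add e f ihe ihf =>
    simp only [NatExp.linear, Bool.and_eq_true] at he
    have h1 : 2 ^ (b + e.linWidth) ≤ 2 ^ (b + (e.linWidth + f.linWidth)) :=
      Nat.pow_le_pow_right (by norm_num) (by omega)
    have h2 : 2 ^ (b + f.linWidth) ≤ 2 ^ (b + (e.linWidth + f.linWidth)) :=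
      Nat.pow_le_pow_right (by norm_num) (by omega)
    have h3 := ihe he.1
    have h4 := ihf he.2
    simp only [NatExp.eval, NatExp.linWidth, ← add_assoc b, pow_succ] at *
    omega
  | sub e f ihe ihf => exact (Nat.sub_le _ _).trans (ihe he)
  | mul e f ihe ihf => simp [NatExp.linear] at he

theorem NatExp.size_eval_le (h : ∀ a j, m.nat a j ≤ 2 ^ b) (e : NatExp) :
    Nat.size (e.eval m) ≤ (e.width + 1) * (b + 1) := by
  rw [Nat.size_le]
  refine (e.eval_le h).trans_lt (Nat.pow_lt_pow_right (by norm_num) (by nlinarith))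

theorem NatExp.time_le (h : ∀ a j, m.nat a j ≤ 2 ^ b) (e : NatExp) :
    e.time m ≤ e.work * (b + 1) := by
  induction e with
  | const k =>
    have := (NatExp.const k).size_eval_le h
    simp only [NatExp.eval, NatExp.width, NatExp.time, NatExp.work] at *
    nlinarith
  | cell a e ih =>
    have := (NatExp.cell a e).size_eval_le h
    simp only [NatExp.width, NatExp.time, NatExp.work] at *
    nlinarith
  | add e f ihe ihf =>
    have := (NatExp.add e f).size_eval_le h
    simp only [NatExp.width, NatExp.time, NatExp.work] at *
    nlinarith
  | sub e f ihe ihf =>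
    have := (NatExp.sub e f).size_eval_le h
    simp only [NatExp.width, NatExp.time, NatExp.work] at *
    nlinarith
  | mul e f ihe ihf =>
    have := (NatExp.mul e f).size_eval_le h
    simp only [NatExp.width, NatExp.time, NatExp.work] at *
    nlinarith

variable [AddCommGroup K] {sz : K → ℕ} {Λ : ℕ} {g : Gauge sz Λ}

theorem NumExp.eval_mem (h : Bounded g b c m) (x : NumExp) :
    x.eval m ∈ g.W (c + x.width * (b + 1)) := by
  induction x with
  | cell a e => simpa [NumExp.width, NumExp.eval] using h.2 _ _
  | add x y hx hy =>
    refine g.mono ?_ (g.add (g.mono (c' := c + (x.width + y.width) * (b + 1)) ?_ hx)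
      (g.mono (c' := c + (x.width + y.width) * (b + 1)) ?_ hy)) <;>
    · try simp only [NumExp.width]
      nlinarith
  | sub x y hx hy =>
    refine g.mono ?_ (g.sub (g.mono (c' := c + (x.width + y.width) * (b + 1)) ?_ hx)
      (g.mono (c' := c + (x.width + y.width) * (b + 1)) ?_ hy)) <;>
    · try simp only [NumExp.width]
      nlinarith
  | smul e x hx =>
    refine g.mono ?_ (g.smul (e.eval_le h.1) hx)
    simp only [NumExp.width]; nlinarith

theorem NumExp.time_le (h : Bounded g b c m) (x : NumExp) :
    x.time sz m ≤ x.work * (Λ + c + b + 1) := by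
  induction x with
  | cell a e =>
    have := g.size ((NumExp.cell a e).eval_mem h)
    have := e.time_le h.1
    simp only [NumExp.width, NumExp.time, NumExp.work] at *
    nlinarith [Nat.zero_le (e.work * (Λ + c))]
  | add x y hx hy =>
    have := g.size ((NumExp.add x y).eval_mem h)
    simp only [NumExp.width, NumExp.time, NumExp.work] at *
    nlinarith [Nat.zero_le ((x.width + y.width + 1) * (Λ + c))]
  | sub x y hx hy =>
    have := g.size ((NumExp.sub x y).eval_mem h)
    simp only [NumExp.width, NumExp.time, NumExp.work] at *
    nlinarith [Nat.zero_le ((x.width + y.width + 1) * (Λ + c))]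
  | smul e x hx =>
    have := g.size ((NumExp.smul e x).eval_mem h)
    have := e.time_le h.1
    simp only [NumExp.width, NumExp.time, NumExp.work] at *
    nlinarith [Nat.zero_le ((e.width + x.width + e.work) * (Λ + c))]

theorem Test.time_le (h : Bounded g b c m) (s : Test) :
    s.time sz m ≤ s.work * (Λ + c + b + 1) := by
  induction s with
  | natLe e f =>
    have h1 := e.time_le h.1
    have h2 := f.time_le h.1
    simp only [Test.time, Test.work]
    nlinarith [Nat.zero_le ((e.work + f.work) * (Λ + c))]
  | numLe x y =>
    have h1 := x.time_le h
    have h2 := y.time_le h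
    simp only [Test.time, Test.work]
    nlinarith
  | neg s ih => simp only [Test.time, Test.work]; nlinarith
  | conj s t hs ht => simp only [Test.time, Test.work]; nlinarith

end Time

/-! ### Loop variables: environment versus machine memory. -/

section Scope

variable {K : Type} {d : ℕ} {env : ℕ → ℕ} {m M : Mem K}

/-- The memory `M` of the machine represents the memory `m` and the loop variables `env`. -/
structure Represents (d : ℕ) (env : ℕ → ℕ) (m M : Mem K) : Prop where
  num : M.num = m.num
  nat : ∀ a, a ≠ 9 → M.nat a = m.nat a
  var : ∀ j < d, M.nat 9 j = env j

/-- Being `scoped` forces every read of array `9` to have a constant address below `d`, where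
machine and environment agree. Stale counters of finished inner loops are never seen. -/
theorem NatExp.eval_scope (h : Represents d env m M) {e : NatExp} (he : e.scoped d = true) :
    e.eval M = e.eval (scope env m) := by
  induction e with
  | const k => rfl
  | cell a e ih =>
    by_cases ha : a = 9
    · subst ha
      rw [NatExp.scoped, if_pos rfl] at he
      cases e <;> simp [NatExp.isVar] at he
      simp [NatExp.eval, scope, h.var _ he]
    · rw [NatExp.scoped, if_neg ha] at he
      simp [NatExp.eval, scope, Function.update_of_ne ha, h.nat a ha, ih he]
  | add e f ihe ihf =>
    simp only [NatExp.scoped, Bool.and_eq_true] at he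
    simp [NatExp.eval, ihe he.1, ihf he.2]
  | sub e f ihe ihf =>
    simp only [NatExp.scoped, Bool.and_eq_true] at he
    simp [NatExp.eval, ihe he.1, ihf he.2]
  | mul e f ihe ihf =>
    simp only [NatExp.scoped, Bool.and_eq_true] at he
    simp [NatExp.eval, ihe he.1, ihf he.2]

variable [AddCommGroup K]

theorem NumExp.eval_scope (h : Represents d env m M) {x : NumExp} (hx : x.scoped d = true) :
    x.eval M = x.eval (scope env m) := by
  induction x with
  | cell a e =>
    simp [NumExp.eval, NatExp.eval_scope h hx, h.num, scope]
  | add x y ihx ihy =>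
    simp only [NumExp.scoped, Bool.and_eq_true] at hx
    simp [NumExp.eval, ihx hx.1, ihy hx.2]
  | sub x y ihx ihy =>
    simp only [NumExp.scoped, Bool.and_eq_true] at hx
    simp [NumExp.eval, ihx hx.1, ihy hx.2]
  | smul e x ihx =>
    simp only [NumExp.scoped, Bool.and_eq_true] at hx
    simp [NumExp.eval, NatExp.eval_scope h hx.1, ihx hx.2]

theorem Test.holds_scope [LinearOrder K] (h : Represents d env m M) {s : Test}
    (hs : s.scoped d = true) : s.Holds M ↔ s.Holds (scope env m) := by
  induction s with
  | natLe e f =>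
    simp only [Test.scoped, Bool.and_eq_true] at hs
    simp [Test.Holds, NatExp.eval_scope h hs.1, NatExp.eval_scope h hs.2]
  | numLe x y =>
    simp only [Test.scoped, Bool.and_eq_true] at hs
    simp [Test.Holds, NumExp.eval_scope h hs.1, NumExp.eval_scope h hs.2]
  | neg s ih => simp [Test.Holds, ih hs]
  | conj s t ihs iht =>
    simp only [Test.scoped, Bool.and_eq_true] at hs
    simp [Test.Holds, ihs hs.1, iht hs.2]

end Scope

/-! ### Simulation of for-programs by the machine, with time and size bounds. -/

/-- A bound, as a polynomial in a bound for the loops, of the number of bits by which a for-program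
lets the stored numbers grow, and of its running time in units of the time for a single bit. -/
def Stmt.growth : Stmt → Polynomial ℕ
  | .skip => 10
  | .setNat _ e f => .C (1 + e.work + f.work + f.linWidth)
  | .setNum _ e x => .C (1 + e.work + x.work + x.width)
  | .seq p q => p.growth + q.growth
  | .ite s p q => .C (1 + s.work) + p.growth + q.growth
  | .for_ d b p =>
      .C (1 + (NatExp.const d).work + (NatExp.const 0).work) +
      .C (1 + (Test.natLe (.add (.cell 9 (.const d)) (.const 1)) (dimExp b)).work) +
      .X * (.C (1 + (Test.natLe (.add (.cell 9 (.const d)) (.const 1)) (dimExp b)).work) +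
        p.growth + .C (1 + (NatExp.const d).work +
          (NatExp.add (.cell 9 (.const d)) (.const 1)).work +
          (NatExp.add (.cell 9 (.const d)) (.const 1)).linWidth))

section

variable {K : Type} [AddCommGroup K] {sz : K → ℕ} {Λ : ℕ} {g : Gauge sz Λ} {b c : ℕ} {M : Mem K}

theorem Bounded.mono {b' c' : ℕ} (h : Bounded g b c M) (hb : b ≤ b') (hc : c ≤ c') :
    Bounded g b' c' M :=
  ⟨fun a j => (h.1 a j).trans (Nat.pow_le_pow_right (by norm_num) hb),
    fun a j => g.mono hc (h.2 a j)⟩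

/-- The second index need not grow here; it is weakened, with an arbitrary `B`, to have the same
form as in `Bounded.writeNum`. -/
theorem Bounded.writeNat (h : Bounded g b c M) {k B : ℕ} (a : ℕ) (e f : NatExp)
    (hf : f.linear = true) (hk : f.linWidth ≤ k) :
    Bounded g (b + k) (c + k * (B + 1)) (M.writeNat a (e.eval M) (f.eval M)) := by
  refine ⟨fun a' j => ?_, fun a' j => g.mono (Nat.le_add_right _ _) (h.2 a' j)⟩
  have h1 : f.eval M ≤ 2 ^ (b + k) :=
    (NatExp.eval_le_of_linear h.1 hf).trans (Nat.pow_le_pow_right (by norm_num) (by omega))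
  have h2 : M.nat a' j ≤ 2 ^ (b + k) :=
    (h.1 _ _).trans (Nat.pow_le_pow_right (by norm_num) (by omega))
  simp only [Mem.writeNat, Function.update_apply]
  split_ifs with ha
  · subst ha
    simp only [Function.update_apply]
    split_ifs
    · exact h1
    · exact h2
  · exact h2

theorem Bounded.writeNum (h : Bounded g b c M) {k B : ℕ} (a : ℕ) (e : NatExp) (x : NumExp)
    (hk : x.width ≤ k) (hB : b ≤ B) :
    Bounded g (b + k) (c + k * (B + 1)) (M.writeNum a (e.eval M) (x.eval M)) := by
  refine ⟨fun a' j => (h.1 _ _).trans (Nat.pow_le_pow_right (by norm_num) (by omega)),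
    fun a' j => ?_⟩
  have h1 : x.eval M ∈ g.W (c + k * (B + 1)) :=
    g.mono (Nat.add_le_add_left (Nat.mul_le_mul hk (by omega)) _) (NumExp.eval_mem h x)
  have h2 : M.num a' j ∈ g.W (c + k * (B + 1)) := g.mono (Nat.le_add_right _ _) (h.2 a' j)
  simp only [Mem.writeNum, Function.update_apply]
  split_ifs with ha
  · subst ha
    simp only [Function.update_apply]
    split_ifs
    · exact h1
    · exact h2
  · exact h2

end

section

variable {K : Type} {d : ℕ} {env : ℕ → ℕ} {m M : Mem K}

theorem Represents.writeNat (h : Represents d env m M) {a : ℕ} (ha : a ≠ 9) (j k : ℕ) :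
    Represents d env (m.writeNat a j k) (M.writeNat a j k) := by
  refine ⟨h.num, fun a' ha' => ?_, fun i hi => ?_⟩
  · simp only [Mem.writeNat, Function.update_apply, h.nat a ha, h.nat a' ha']
  · simp only [Mem.writeNat, Function.update_of_ne ha.symm, h.var i hi]

theorem Represents.writeNum (h : Represents d env m M) (a j : ℕ) (x : K) :
    Represents d env (m.writeNum a j x) (M.writeNum a j x) := by
  refine ⟨?_, h.nat, h.var⟩
  simp only [Mem.writeNum, h.num]

theorem Represents.writeVar (h : Represents d env m M) (k : ℕ) :
    Represents (d + 1) (Function.update env d k) m (M.writeNat 9 d k) := by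
  refine ⟨h.num, fun a' ha' => ?_, fun i hi => ?_⟩
  · simp only [Mem.writeNat, Function.update_of_ne ha', h.nat a' ha']
  · simp only [Mem.writeNat, Function.update_self, Function.update_apply]
    split_ifs with hd
    · rfl
    · exact h.var i (by omega)

theorem Represents.of_update {k : ℕ} (h : Represents (d + 1) (Function.update env d k) m M) :
    Represents d env m M :=
  ⟨h.num, h.nat, fun j hj => by
    rw [h.var j (by omega), Function.update_of_ne (by omega)]⟩

theorem eval_dimExp (h : Represents d env m M) (v : Bool) : (dimExp v).eval M = dim v m := by
  cases v <;> simp [dimExp, dim, NatExp.eval, h.nat 0]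

end

/-- Induction on the program. `B` and `C` are budgets fixed in advance for the final sizes, so that
all times can be measured in the single unit `Λ + C + B + 1`. The one polynomial `growth` then
bounds the number of these units, the new bits of the naturals and, in multiples of `B + 1`, those
of the elements of `K`. Array `0` is never written, so the machine, which evaluates the bound of a
loop in every pass, always finds the same value. -/
theorem Stmt.exec_compile {K : Type} [AddCommGroup K] [LinearOrder K] {sz : K → ℕ} {Λ : ℕ}
    (g : Gauge sz Λ) {X B C : ℕ} (s : Stmt) :
    ∀ (d : ℕ) (env : ℕ → ℕ) (m M : Mem K) (b c : ℕ), s.ok d = true → Represents d env m M →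
      Bounded g b c M → m.nat 0 0 ≤ X → m.nat 0 1 + 1 ≤ X → b + s.growth.eval X ≤ B →
      c + s.growth.eval X * (B + 1) ≤ C →
      ∃ t M', Exec sz s.compile M t M' ∧ Represents d env (s.run env m) M' ∧
        Bounded g (b + s.growth.eval X) (c + s.growth.eval X * (B + 1)) M' ∧
        t ≤ s.growth.eval X * (Λ + C + B + 1) := by
  induction s with
  | skip =>
    intro d env m M b c hok hr hM h0 h1 hB hC
    -- `10 = 1 + 3 + 6`: the dummy assignment, with the `work` of its address and of its value.
    have hE : (Stmt.skip.growth.eval X) = 10 := by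
      simp [Stmt.growth]
    rw [hE] at hB hC ⊢
    refine ⟨_, _, Exec.setNat _ _ _ _, ?_, hM.writeNat (k := 10) 9 _ _ rfl (by decide), ?_⟩
    · have : M.writeNat 9 (NatExp.eval M (.const 0)) (NatExp.eval M (.cell 9 (.const 0))) = M := by
        simp [Mem.writeNat, NatExp.eval]
      rw [this]; exact hr
    · have h1 := (NatExp.const 0).time_le hM.1
      have h2 := (NatExp.cell 9 (.const 0)).time_le hM.1
      simp only [NatExp.work] at h1 h2
      nlinarith
  | setNat a e f =>
    intro d env m M b c hok hr hM h0 h1 hB hC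
    simp only [Stmt.ok, Bool.and_eq_true, decide_eq_true_eq] at hok
    obtain ⟨⟨⟨⟨ha0, ha9⟩, he⟩, hf⟩, hl⟩ := hok
    simp only [Stmt.growth, Polynomial.eval_C] at hB hC ⊢
    refine ⟨_, _, Exec.setNat _ _ _ _, ?_, hM.writeNat a _ _ hl (by omega), ?_⟩
    · simp only [Stmt.run, NatExp.eval_scope hr he, NatExp.eval_scope hr hf]
      exact hr.writeNat ha9 _ _
    · have h1 := e.time_le hM.1
      have h2 := f.time_le hM.1
      have h3 : e.work * (b + 1) ≤ e.work * (Λ + C + B + 1) := Nat.mul_le_mul_left _ (by omega)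
      have h4 : f.work * (b + 1) ≤ f.work * (Λ + C + B + 1) := Nat.mul_le_mul_left _ (by omega)
      simp only [add_mul] at *
      omega
  | setNum a e x =>
    intro d env m M b c hok hr hM h0 h1 hB hC
    simp only [Stmt.ok, Bool.and_eq_true] at hok
    simp only [Stmt.growth, Polynomial.eval_C] at hB hC ⊢
    refine ⟨_, _, Exec.setNum _ _ _ _, ?_, hM.writeNum a _ _ (by omega) (by omega), ?_⟩
    · simp only [Stmt.run, NatExp.eval_scope hr hok.1, NumExp.eval_scope hr hok.2]
      exact hr.writeNum _ _ _
    · have h1 := e.time_le hM.1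
      have h2 := x.time_le hM
      have hc : c ≤ C := le_trans (Nat.le_add_right _ _) hC
      have h3 : e.work * (b + 1) ≤ e.work * (Λ + C + B + 1) := Nat.mul_le_mul_left _ (by omega)
      have h4 : x.work * (Λ + c + b + 1) ≤ x.work * (Λ + C + B + 1) :=
        Nat.mul_le_mul_left _ (by omega)
      simp only [add_mul] at *
      omega
  | seq p q hp hq =>
    intro d env m M b c hok hr hM h0 h1 hB hC
    simp only [Stmt.ok, Bool.and_eq_true] at hok
    simp only [Stmt.growth, Polynomial.eval_add, add_mul] at hB hC ⊢
    obtain ⟨t₁, M₁, e₁, r₁, b₁, l₁⟩ := hp d env m M b c hok.1 hr hM h0 h1 (by omega) (by omega)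
    have hk := Stmt.run_nat (Stmt.ok_keepsNat_zero hok.1) env m
    obtain ⟨t₂, M₂, e₂, r₂, b₂, l₂⟩ := hq d env _ M₁ _ _ hok.2 r₁ b₁ (by rwa [hk])
      (by rwa [hk]) (by omega) (by omega)
    exact ⟨_, M₂, e₁.seq e₂, r₂, b₂.mono (by omega) (by omega), by omega⟩
  | ite s p q hp hq =>
    intro d env m M b c hok hr hM h0 h1 hB hC
    simp only [Stmt.ok, Bool.and_eq_true] at hok
    simp only [Stmt.growth, Polynomial.eval_add, Polynomial.eval_C] at hB hC ⊢
    rw [add_mul, add_mul] at hC ⊢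
    have ht := s.time_le hM
    have hc : c ≤ C := le_trans (Nat.le_add_right _ _) hC
    have ht' : s.work * (Λ + c + b + 1) ≤ s.work * (Λ + C + B + 1) :=
      Nat.mul_le_mul_left _ (by omega)
    have hu : 1 * (Λ + C + B + 1) + s.work * (Λ + C + B + 1) = (1 + s.work) * (Λ + C + B + 1) := by
      ring
    rw [Stmt.run]
    split_ifs with hs
    · obtain ⟨t₁, M₁, e₁, r₁, b₁, l₁⟩ := hp d env m M b c hok.1.2 hr hM h0 h1 (by omega) (by omega)
      refine ⟨_, M₁, e₁.iteTrue ((Test.holds_scope hr hok.1.1).2 hs), r₁,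
        b₁.mono (by omega) (by omega), ?_⟩
      simp only [add_mul _ _ (Λ + C + B + 1)]
      omega
    · obtain ⟨t₁, M₁, e₁, r₁, b₁, l₁⟩ := hq d env m M b c hok.2 hr hM h0 h1 (by omega) (by omega)
      refine ⟨_, M₁, e₁.iteFalse (mt (Test.holds_scope hr hok.1.1).1 hs), r₁,
        b₁.mono (by omega) (by omega), ?_⟩
      simp only [add_mul _ _ (Λ + C + B + 1)]
      omega
  | for_ d' v p hp =>
    intro d env m M b c hok hr hM h0 h1 hB hC
    simp only [Stmt.ok, Bool.and_eq_true, decide_eq_true_eq] at hok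
    obtain ⟨rfl, hok⟩ := hok
    simp only [Stmt.growth, Polynomial.eval_add, Polynomial.eval_C, Polynomial.eval_mul,
      Polynomial.eval_X] at hB hC ⊢
    set G := p.growth.eval X with hG
    set β := Test.natLe (.add (.cell 9 (.const d')) (.const 1)) (dimExp v) with hβ
    set κ := 1 + (NatExp.const d').work + (NatExp.const 0).work with hκ
    set ι := 1 + (NatExp.const d').work + (NatExp.add (.cell 9 (.const d')) (.const 1)).work +
      (NatExp.add (.cell 9 (.const d')) (.const 1)).linWidth with hι
    set U := 1 + β.work + G + ι with hU
    set P := Λ + C + B + 1 with hP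
    set S : ℕ → Mem K := fun k =>
      Nat.rec m (fun k m' => p.run (Function.update env d' k) m') k with hS
    have hS0 : ∀ k, (S k).nat 0 = m.nat 0 := by
      intro k
      induction k with
      | zero => rfl
      | succ k ih => rw [← ih]; exact Stmt.run_nat (Stmt.ok_keepsNat_zero hok) _ _
    have hdim : ∀ k, dim v (S k) = dim v m := fun k => by simp [dim, hS0 k]
    have hdX : dim v m ≤ X := by
      simp only [dim]; split_ifs <;> omega
    -- Induction on the number `r` of passes that are left, as the machine loop unfolds from the
    -- front; `S k` is the memory after `k` passes, and every pass uses up a share `U` of the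
    -- budget.
    have hbody : ∀ r k M b c, k + r = dim v m →
        Represents (d' + 1) (Function.update env d' k) (S k) M → Bounded g b c M →
        b + r * U ≤ B → c + r * U * (B + 1) ≤ C →
        ∃ t M', Exec sz (.loop β (.seq p.compile (.setNat 9 (.const d')
            (.add (.cell 9 (.const d')) (.const 1))))) M t M' ∧
          Represents d' env (S (dim v m)) M' ∧
          Bounded g (b + r * U) (c + r * U * (B + 1)) M' ∧ t ≤ (1 + β.work + r * U) * P := by
      intro r
      induction r with
      | zero =>
        intro k M b c hk hr hM hB hC
        simp only [zero_mul, add_zero] at hk hB hC ⊢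
        subst hk
        refine ⟨_, M, Exec.loopDone ?_, hr.of_update, hM, ?_⟩
        · simp only [hβ, Test.Holds, NatExp.eval, eval_dimExp hr, hdim]
          rw [hr.var d' (by omega), Function.update_self]
          omega
        · have ht := β.time_le hM
          have : β.work * (Λ + c + b + 1) ≤ β.work * P := Nat.mul_le_mul_left _ (by omega)
          rw [add_mul]; omega
      | succ r ih =>
        intro k M b c hk hr hM hB hC
        have hUr : (r + 1) * U = r * U + (1 + β.work + G + ι) := by rw [← hU]; ring
        have hUr' : (r + 1) * U * (B + 1) =
            r * U * (B + 1) + ((1 + β.work) * (B + 1) + G * (B + 1) + ι * (B + 1)) := by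
          rw [hUr]; ring
        rw [hUr'] at hC
        rw [hUr] at hB
        obtain ⟨t₁, M₁, e₁, r₁, b₁, l₁⟩ := hp (d' + 1) _ (S k) M b c hok hr hM
          (by rwa [hS0]) (by rwa [hS0]) (by omega) (by omega)
        have hv : M₁.nat 9 d' = k := by rw [r₁.var d' (by omega), Function.update_self]
        have r₂ := r₁.of_update.writeVar (k + 1)
        have b₂ := b₁.writeNat (k := ι) (B := B) 9 (.const d')
          (.add (.cell 9 (.const d')) (.const 1)) rfl (by omega)
        have hw : M₁.writeNat 9 (NatExp.eval M₁ (.const d'))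
            (NatExp.eval M₁ (.add (.cell 9 (.const d')) (.const 1))) =
            M₁.writeNat 9 d' (k + 1) := by simp [NatExp.eval, hv]
        rw [hw] at b₂
        obtain ⟨t₃, M₃, e₃, r₃, b₃, l₃⟩ := ih (k + 1) _ _ _ (by omega) r₂ b₂ (by omega) (by omega)
        have e₂ := Exec.setNat (sz := sz) 9 (.const d') (.add (.cell 9 (.const d')) (.const 1)) M₁
        rw [hw] at e₂
        refine ⟨_, M₃, Exec.loopStep ?_ (e₁.seq e₂) e₃, r₃,
          b₃.mono (by rw [hUr]; omega) (by rw [hUr']; omega), ?_⟩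
        · simp only [hβ, Test.Holds, NatExp.eval, eval_dimExp hr, hdim]
          rw [hr.var d' (by omega), Function.update_self]
          omega
        · have ht := β.time_le hM
          have h2 : β.work * (Λ + c + b + 1) ≤ β.work * P := Nat.mul_le_mul_left _ (by omega)
          have h3 := (NatExp.const d').time_le b₁.1
          have h4 := (NatExp.add (.cell 9 (.const d')) (.const 1)).time_le b₁.1
          have h5 : ((NatExp.const d').work + (NatExp.add (.cell 9 (.const d')) (.const 1)).work) *
              (b + G + 1) ≤ ((NatExp.const d').work +
                (NatExp.add (.cell 9 (.const d')) (.const 1)).work) * P :=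
            Nat.mul_le_mul_left _ (by omega)
          have h6 : 1 * P + ((NatExp.const d').work +
              (NatExp.add (.cell 9 (.const d')) (.const 1)).work) * P ≤ ι * P := by
            rw [← add_mul]; exact Nat.mul_le_mul_right _ (by omega)
          have h7 : (1 + β.work + (r + 1) * U) * P =
              (1 + β.work + r * U) * P + (1 * P + β.work * P + G * P + ι * P) := by
            rw [hUr]; ring
          rw [add_mul] at h5
          rw [h7]
          omega
    have b₀ := hM.writeNat (k := κ) (B := B) 9 (.const d') (.const 0) rfl (by simp [NatExp.linWidth])
    have e₀ := Exec.setNat (sz := sz) 9 (.const d') (.const 0) M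
    have r₀ := hr.writeVar 0
    have hXU : dim v m * U ≤ X * U := Nat.mul_le_mul_right _ hdX
    have hXU' : dim v m * U * (B + 1) ≤ X * U * (B + 1) := Nat.mul_le_mul_right _ hXU
    have hsum : (κ + (1 + β.work) + X * U) * (B + 1) =
        κ * (B + 1) + (1 + β.work) * (B + 1) + X * U * (B + 1) := by ring
    rw [hsum] at hC ⊢
    obtain ⟨t₁, M₁, e₁, r₁, b₁, l₁⟩ := hbody (dim v m) 0 _ _ _ (by omega) r₀ b₀
      (by omega) (by omega)
    refine ⟨_, M₁, e₀.seq e₁, r₁, b₁.mono (by omega) (by omega), ?_⟩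
    have h3 := (NatExp.const d').time_le hM.1
    have h4 := (NatExp.const 0).time_le hM.1
    have h5 : ((NatExp.const d').work + (NatExp.const 0).work) * (b + 1) ≤
        ((NatExp.const d').work + (NatExp.const 0).work) * P := Nat.mul_le_mul_left _ (by omega)
    have h6 : 1 * P + ((NatExp.const d').work + (NatExp.const 0).work) * P ≤ κ * P := by
      rw [← add_mul]; exact Nat.mul_le_mul_right _ (by omega)
    have h7 : (1 + β.work + dim v m * U) * P ≤ (1 + β.work + X * U) * P :=
      Nat.mul_le_mul_right _ (by omega)
    have h8 : (κ + (1 + β.work) + X * U) * P = κ * P + (1 + β.work + X * U) * P := by ring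
    rw [add_mul] at h5
    rw [h8]
    omega

/-! ## Sizes of rational numbers -/

theorem size_mul_le (a b : ℕ) : Nat.size (a * b) ≤ Nat.size a + Nat.size b := by
  rw [Nat.size_le, pow_add]
  have h1 := Nat.lt_size_self a
  have h2 := Nat.lt_size_self b
  exact Nat.mul_lt_mul'' h1 h2

/-- The empty product has size `1`, hence the assumption that `s` is nonempty. -/
theorem size_prod_le {ι : Type*} (s : Finset ι) (f : ι → ℕ) (hs : s.Nonempty) :
    Nat.size (∏ i ∈ s, f i) ≤ ∑ i ∈ s, Nat.size (f i) := by
  induction hs using Finset.Nonempty.cons_induction with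
  | singleton a => simp
  | cons a s ha hs ih =>
    rw [Finset.prod_cons, Finset.sum_cons, Nat.size_le, pow_add]
    exact Nat.mul_lt_mul'' (Nat.lt_size_self _)
      ((Nat.lt_size_self _).trans_le (Nat.pow_le_pow_right (by norm_num) ih))

theorem size_succ_le (a : ℕ) : Nat.size (a + 1) ≤ Nat.size a + 1 := by
  rw [Nat.size_le, pow_succ]
  have := Nat.lt_size_self a
  have := Nat.one_le_two_pow (n := a.size)
  omega

/-- Cancelling in the fraction z / D only makes it smaller: by coprimality the reduced denominator
divides `D`, and the numerator shrinks by the same factor. -/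
theorem bitSize_le {x : ℚ} {D P : ℕ} (hD : 0 < D) {z : ℤ} (hx : x * D = z) (hz : z.natAbs ≤ P) :
    bitSize x ≤ Nat.size P + Nat.size D := by
  have h1 : x.num * D = z * x.den := by
    have h2 : (x.num : ℚ) = x * x.den := (Rat.mul_den_eq_num x).symm
    have h3 : ((x.num * D : ℤ) : ℚ) = ((z * x.den : ℤ) : ℚ) := by
      push_cast
      rw [h2, ← hx]; ring
    exact_mod_cast h3
  have h4 : x.num.natAbs * D = z.natAbs * x.den := by
    have := congrArg Int.natAbs h1
    simpa [Int.natAbs_mul] using this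
  have h5 : x.den ∣ D := by
    refine (Nat.Coprime.symm x.reduced).dvd_of_dvd_mul_left ?_
    exact ⟨z.natAbs, by rw [h4, mul_comm]⟩
  have h6 : x.den ≤ D := Nat.le_of_dvd hD h5
  have h7 : x.num.natAbs ≤ P := by
    refine le_trans ?_ hz
    have : x.num.natAbs * D ≤ z.natAbs * D := by
      rw [h4]; exact Nat.mul_le_mul_left _ h6
    exact Nat.le_of_mul_le_mul_right this hD
  exact Nat.add_le_add (Nat.size_le_size h7) (Nat.size_le_size h6)

/-- Rational numbers whose denominator divides `D`, with a bounded numerator over `D`. -/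
def ratGauge (D P Λ : ℕ) (hD : 0 < D) (h : Nat.size P + Nat.size D ≤ Λ) : Gauge bitSize Λ where
  W c := {x | ∃ z : ℤ, x * D = z ∧ z.natAbs ≤ P * 2 ^ c}
  mono := by
    rintro c c' hc x ⟨z, hx, hz⟩
    exact ⟨z, hx, hz.trans (Nat.mul_le_mul_left _ (Nat.pow_le_pow_right (by norm_num) hc))⟩
  add := by
    rintro c x y ⟨z, hx, hz⟩ ⟨w, hy, hw⟩
    refine ⟨z + w, by push_cast; rw [add_mul, hx, hy], ?_⟩
    have := Int.natAbs_add_le z w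
    rw [pow_succ, ← mul_assoc]; omega
  sub := by
    rintro c x y ⟨z, hx, hz⟩ ⟨w, hy, hw⟩
    refine ⟨z - w, by push_cast; rw [sub_mul, hx, hy], ?_⟩
    have := Int.natAbs_sub_le z w
    rw [pow_succ, ← mul_assoc]; omega
  smul := by
    rintro b c k x hk ⟨z, hx, hz⟩
    refine ⟨k * z, by push_cast; rw [nsmul_eq_mul, mul_assoc, hx], ?_⟩
    rw [Int.natAbs_mul, Int.natAbs_natCast, pow_add, ← mul_assoc, mul_comm]
    exact Nat.mul_le_mul hz hk
  size := by
    rintro c x ⟨z, hx, hz⟩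
    have h1 := bitSize_le hD hx hz
    have h2 : Nat.size (P * 2 ^ c) ≤ Nat.size P + c := by
      rw [Nat.size_le, pow_add]
      exact Nat.mul_lt_mul_of_pos_right (Nat.lt_size_self P) (by positivity)
    omega

/-- If all sizes are equal to `1`, there is nothing to bound. -/
def unitGauge (K : Type) [AddCommGroup K] (Λ : ℕ) (h : 1 ≤ Λ) :
    Gauge (fun _ : K => 1) Λ where
  W _ := Set.univ
  mono _ := subset_rfl
  add _ _ := trivial
  sub _ _ := trivial
  smul _ _ := trivial
  size _ := by omega

theorem Instance.Valid.n_pos {K : Type} [Zero K] [LE K] {I : Instance K} (h : I.Valid) :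
    0 < I.n := by
  obtain ⟨v, -⟩ := h.nonempty
  exact v.pos

theorem Instance.Valid.ℓ_pos {K : Type} [Zero K] [LE K] {I : Instance K} (h : I.Valid) :
    0 < I.ℓ := by
  obtain ⟨v, hv⟩ := h.nonempty
  have := h.grade v hv
  omega

/-- The product `D` of all denominators is a common denominator with no more digits than the input,
and addition over a fixed denominator does not enlarge it. A cost with `D = den * e` has numerator
`num * e`, of absolute value at most `N * D`. Since `D` is counted once in this bound and once as
denominator, twice the length of the input is needed. -/
theorem exists_ratGauge (I : Instance ℚ) (hI : I.Valid) :
    ∃ g : Gauge bitSize (2 * I.length bitSize), (0 : ℚ) ∈ g.W 0 ∧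
      ∀ v, ∀ i ∈ Finset.Icc 1 I.ℓ, I.c i v ∈ g.W 0 := by
  set s : Finset (Fin I.n × ℕ) := Finset.univ ×ˢ Finset.Icc 1 I.ℓ with hs
  have hne : s.Nonempty := by
    have := hI.n_pos
    have := hI.ℓ_pos
    exact ⟨(⟨0, hI.n_pos⟩, 1), by simp [hs]; omega⟩
  set D : ℕ := ∏ p ∈ s, (I.c p.2 p.1).den with hD
  set N : ℕ := ∏ p ∈ s, ((I.c p.2 p.1).num.natAbs + 1) with hN
  have hDpos : 0 < D := Finset.prod_pos fun p _ => (I.c p.2 p.1).den_pos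
  have hsizeD : Nat.size D ≤ ∑ p ∈ s, Nat.size (I.c p.2 p.1).den := size_prod_le s _ hne
  have hsizeN : Nat.size N ≤ ∑ p ∈ s, (Nat.size (I.c p.2 p.1).num.natAbs + 1) :=
    (size_prod_le s _ hne).trans (Finset.sum_le_sum fun p _ => size_succ_le _)
  have hsum : ∑ p ∈ s, (Nat.size (I.c p.2 p.1).num.natAbs + 1) +
      ∑ p ∈ s, Nat.size (I.c p.2 p.1).den ≤ I.length bitSize := by
    rw [← Finset.sum_add_distrib, Instance.length, hs, Finset.sum_product]
    refine le_trans (Finset.sum_le_sum fun v _ => Finset.sum_le_sum fun i _ => ?_)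
      (Nat.le_add_left _ _)
    simp only [bitSize]; omega
  have hsizeP : Nat.size (N * D) ≤ Nat.size N + Nat.size D := size_mul_le _ _
  refine ⟨ratGauge D (N * D) _ hDpos (by omega), ⟨0, by simp, by simp⟩, fun v i hi => ?_⟩
  have hmem : (v, i) ∈ s := by simpa [hs] using hi
  obtain ⟨e, he⟩ : (I.c i v).den ∣ D := Finset.dvd_prod_of_mem (fun p => (I.c p.2 p.1).den) hmem
  have hle : (I.c i v).num.natAbs + 1 ≤ N :=
    Nat.le_of_dvd (Finset.prod_pos fun p _ => Nat.succ_pos _)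
      (Finset.dvd_prod_of_mem (fun p => (I.c p.2 p.1).num.natAbs + 1) hmem)
  refine ⟨(I.c i v).num * e, ?_, ?_⟩
  · rw [he]; push_cast; rw [← mul_assoc, Rat.mul_den_eq_num]
  · rw [Int.natAbs_mul, Int.natAbs_natCast, pow_zero, mul_one]
    exact Nat.mul_le_mul (by omega) (Nat.le_of_dvd hDpos ⟨_, by rw [mul_comm]; exact he⟩)

/-! ## Polynomial-time approximation by for-programs -/

/-- The bound on the running time in terms of the length of the input. -/
def Stmt.timeBound (s : Stmt) : Polynomial ℕ :=
  (s.growth * (2 * .X + s.growth * (.X + s.growth + 1) + (.X + s.growth) + 1)).comp (.X + 1)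

theorem Instance.n_le_length {K : Type} (I : Instance K) (sz : K → ℕ) : I.n ≤ I.length sz :=
  (Nat.le_mul_self _).trans (Nat.le_add_right _ _)

theorem Instance.ℓ_le_length {K : Type} (I : Instance K) (sz : K → ℕ) (h : 0 < I.n) :
    I.ℓ ≤ I.length sz := by
  have h1 : ∀ v, I.ℓ ≤ ∑ i ∈ Finset.Icc 1 I.ℓ, (1 + sz (I.c i v)) := fun v => by
    calc I.ℓ = ∑ i ∈ Finset.Icc 1 I.ℓ, 1 := by simp
      _ ≤ _ := Finset.sum_le_sum fun i _ => by omega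
  calc I.ℓ ≤ ∑ i ∈ Finset.Icc 1 I.ℓ, (1 + sz (I.c i ⟨0, h⟩)) := h1 _
    _ ≤ ∑ v : Fin I.n, ∑ i ∈ Finset.Icc 1 I.ℓ, (1 + sz (I.c i v)) :=
      Finset.single_le_sum (f := fun v => ∑ i ∈ Finset.Icc 1 I.ℓ, (1 + sz (I.c i v)))
        (fun _ _ => Nat.zero_le _) (Finset.mem_univ _)
    _ ≤ _ := Nat.le_add_left _ _

/-- Separates correctness, a statement about `Stmt.run` only, from running time. With `L` the length
of the input, the naturals in the input are at most `2 ^ (L + 1)`, the costs lie in `W 0`, and `X =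
L + 1` bounds both `n` and `ℓ + 1`; `timeBound` dominates what `Stmt.exec_compile` gives for these
values. -/
theorem approximates_of_run {K : Type} [AddCommGroup K] [LinearOrder K] (s : Stmt)
    (hs : s.ok 0 = true) (sz : K → ℕ) (val : K → ℝ)
    (hg : ∀ I : Instance K, I.Valid → ∃ g : Gauge sz (2 * I.length sz), (0 : K) ∈ g.W 0 ∧
      ∀ v, ∀ i ∈ Finset.Icc 1 I.ℓ, I.c i v ∈ g.W 0)
    (hrun : ∀ I : Instance K, I.Valid → ∃ (H : I.G.Subgraph) (y : Fin I.n → ℕ) (opt : K),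
      I.Output (s.run (fun _ => 0) I.input) H y ∧ I.Feasible H y ∧ I.IsOpt opt ∧
      ((2 ≤ I.T.card ∨ ∀ v ∈ I.T, I.c (I.R v) v = 0) →
        val (I.cost H y) ≤ 2 * Real.log (I.T.card : ℝ) * val opt)) :
    ApproximatesInTime s.compile s.timeBound sz val := by
  intro I hI
  specialize hg I hI
  set L := I.length sz with hL
  obtain ⟨g, hg0, hgc⟩ := hg
  obtain ⟨H, y, opt, hO, hF, hopt, hc⟩ := hrun I hI
  have hn := I.n_le_length sz
  have hℓ := I.ℓ_le_length sz hI.n_pos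
  have hpow : ∀ k, k ≤ L → k ≤ 2 ^ (L + 1) := fun k hk =>
    (Nat.lt_two_pow_self (n := L + 1)).le.trans' (by omega)
  have hb : Bounded g (L + 1) 0 I.input := by
    refine ⟨fun a j => ?_, fun a j => ?_⟩
    · simp only [Instance.input]
      split_ifs with h1 h2 h3 h4 h5 h6 h7 h8
      · exact hpow _ hn
      · exact hpow _ hℓ
      · exact Nat.zero_le _
      · exact Nat.one_le_two_pow
      · exact Nat.zero_le _
      · exact hpow _ ((hI.grade _ h8).2.trans hℓ)
      all_goals exact Nat.zero_le _
    · simp only [Instance.input]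
      split_ifs with h1 h2
      · refine hgc _ _ ?_
        rw [Finset.mem_Icc]
        have := Nat.mod_lt j hI.ℓ_pos
        omega
      · exact hg0
      · exact hg0
  obtain ⟨t, M, hE, hr, -, ht⟩ := s.exec_compile g 0 (fun _ => 0) I.input I.input (L + 1) 0 hs
    ⟨rfl, fun _ _ => rfl, fun _ h => absurd h (by omega)⟩ hb (X := L + 1)
    (by simp [Instance.input]; omega) (by simp [Instance.input]; omega) le_rfl le_rfl
  refine ⟨t, M, H, y, opt, hE, ht.trans ?_, ?_, hF, hopt, hc⟩
  · simp only [Stmt.timeBound, Polynomial.eval_comp, Polynomial.eval_add, Polynomial.eval_mul,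
      Polynomial.eval_X, Polynomial.eval_one, Polynomial.eval_ofNat]
    refine Nat.mul_le_mul_left _ ?_
    omega
  · exact ⟨fun v => by rw [hr.nat 3 (by norm_num)]; exact hO.1 v,
      fun u v => by rw [hr.nat 4 (by norm_num)]; exact hO.2 u v⟩

/-! ## Spiders in rooted trees -/

section Spider

variable {V : Type*}

/-- `w` is an ancestor of `v` for the parent function `par`. -/
def Anc (par : V → V) (w v : V) : Prop := ∃ k, par^[k] v = w

variable {par : V → V} {δ : V → ℕ}

theorem Anc.refl (v : V) : Anc par v v := ⟨0, rfl⟩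

theorem Anc.trans {u v w : V} (h : Anc par u v) (h' : Anc par v w) : Anc par u w := by
  obtain ⟨k, rfl⟩ := h
  obtain ⟨l, rfl⟩ := h'
  exact ⟨k + l, Function.iterate_add_apply _ _ _ _⟩

theorem Anc.parent (v : V) : Anc par (par v) v := ⟨1, rfl⟩

theorem Anc.eq_or_parent {w v : V} (h : Anc par w v) : w = v ∨ Anc par w (par v) := by
  obtain ⟨k, rfl⟩ := h
  cases k with
  | zero => exact Or.inl rfl
  | succ k => exact Or.inr ⟨k, (Function.iterate_succ_apply _ _ _).symm⟩

theorem Anc.eq_or_lt (hpar : ∀ v, par v = v ∨ δ (par v) < δ v) {w v : V} (h : Anc par w v) :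
    w = v ∨ δ w < δ v := by
  obtain ⟨k, rfl⟩ := h
  induction k with
  | zero => exact Or.inl rfl
  | succ k ih =>
    rw [Function.iterate_succ_apply']
    rcases hpar (par^[k] v) with h | h
    · rwa [h]
    · rcases ih with ih | ih
      · rw [ih] at h ⊢; exact Or.inr h
      · exact Or.inr (h.trans ih)

variable [Fintype V]

open Classical in
/-- The vertices between `v` and a descendant `t`, or between `v` and the root, without `v`. -/
def leg (par : V → V) (v t : V) : Finset V :=
  if Anc par v t then Finset.univ.filter (fun w => Anc par w t ∧ Anc par v w ∧ w ≠ v)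
  else Finset.univ.filter (fun w => Anc par w v ∧ w ≠ v)

theorem mem_leg_of_anc {v t w : V} (h : Anc par v t) :
    w ∈ leg par v t ↔ Anc par w t ∧ Anc par v w ∧ w ≠ v := by
  simp [leg, h]

theorem mem_leg_of_not_anc {v t w : V} (h : ¬ Anc par v t) :
    w ∈ leg par v t ↔ Anc par w v ∧ w ≠ v := by
  simp [leg, h]

open Classical in
/-- The ancestors of the elements of `B`. -/
def ancestors (par : V → V) (B : Finset V) : Finset V :=
  Finset.univ.filter (fun w => ∃ t ∈ B, Anc par w t)

open Classical in
/-- A lowest vertex with two descendants in `B`, with its descendants in `B`, is the center of a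
spider that is disjoint from the paths between the root and the other elements of `B`. -/
theorem exists_lowest_spider {K : Type*} [Field K] [LinearOrder K] [IsStrictOrderedRing K]
    (hpar : ∀ v, par v = v ∨ δ (par v) < δ v) (W : V → K) {root : V} {B : Finset V}
    (hB : ∀ t ∈ B, Anc par root t) (hcard : 2 ≤ B.card) :
    ∃ v, ∃ s : Finset V, 2 ≤ (B.filter (Anc par v)).card ∧
      (∀ w ∈ s, Anc par v w ∧ ∃ t ∈ B, Anc par w t) ∧
      W v + ∑ t ∈ B.filter (Anc par v), ∑ w ∈ leg par v t, W w = ∑ w ∈ s, W w := by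
  have hne : (Finset.univ.filter (fun v => 2 ≤ (B.filter (Anc par v)).card)).Nonempty := by
    refine ⟨root, ?_⟩
    rw [Finset.mem_filter, Finset.filter_true_of_mem hB]
    exact ⟨Finset.mem_univ _, hcard⟩
  obtain ⟨v, hv, hmax⟩ := Finset.exists_max_image _ δ hne
  simp only [Finset.mem_filter, Finset.mem_univ, true_and] at hv hmax
  have hleg : ∀ t ∈ B.filter (Anc par v), ∀ w ∈ leg par v t,
      Anc par w t ∧ Anc par v w ∧ w ≠ v := by
    intro t ht w hw
    exact (mem_leg_of_anc (Finset.mem_filter.1 ht).2).1 hw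
  -- A vertex on two legs would have two descendants in `B` and lie strictly below `v`, against the
  -- choice of `v`.
  have hdisj : Set.PairwiseDisjoint (B.filter (Anc par v) : Set V) (leg par v) := by
    intro t ht t' ht' htt
    rw [Function.onFun, Finset.disjoint_left]
    intro w hw hw'
    obtain ⟨h1, h2, h3⟩ := hleg t ht w hw
    obtain ⟨h1', -, -⟩ := hleg t' ht' w hw'
    have h4 : δ v < δ w := (h2.eq_or_lt hpar).resolve_left (Ne.symm h3)
    have h5 : 2 ≤ (B.filter (Anc par w)).card := by
      refine Finset.one_lt_card.2 ⟨t, ?_, t', ?_, htt⟩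
      · exact Finset.mem_filter.2 ⟨(Finset.mem_filter.1 ht).1, h1⟩
      · exact Finset.mem_filter.2 ⟨(Finset.mem_filter.1 ht').1, h1'⟩
    exact absurd (hmax w h5) (by omega)
  refine ⟨v, insert v ((B.filter (Anc par v)).biUnion (leg par v)), hv, ?_, ?_⟩
  · intro w hw
    rcases Finset.mem_insert.1 hw with rfl | hw
    · obtain ⟨t, ht⟩ := Finset.card_pos.1 (lt_of_lt_of_le (by norm_num) hv)
      exact ⟨Anc.refl _, t, (Finset.mem_filter.1 ht).1, (Finset.mem_filter.1 ht).2⟩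
    · obtain ⟨t, ht, hw⟩ := Finset.mem_biUnion.1 hw
      obtain ⟨h1, h2, -⟩ := hleg t ht w hw
      exact ⟨h2, t, (Finset.mem_filter.1 ht).1, h1⟩
  · rw [Finset.sum_insert, Finset.sum_biUnion hdisj]
    intro hmem
    obtain ⟨t, ht, hw⟩ := Finset.mem_biUnion.1 hmem
    exact (hleg t ht v hw).2.2 rfl

open Classical in
/-- A tree contains a spider whose weight per leg is at most the weight of the tree divided by the
number of terminals. -/
theorem exists_spider {K : Type*} [Field K] [LinearOrder K] [IsStrictOrderedRing K]
    (hpar : ∀ v, par v = v ∨ δ (par v) < δ v) (W : V → K) (hW : ∀ v, 0 ≤ W v) (root : V)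
    (N : ℕ) : ∀ B : Finset V, B.card = N → root ∈ B → (∀ t ∈ B, Anc par root t) → 2 ≤ B.card →
    ∃ v, ∃ C ⊆ B, 2 ≤ C.card ∧ (∀ t ∈ C, Anc par v t ∨ t = root) ∧
      (B.card : K) * (W v + ∑ t ∈ C, ∑ w ∈ leg par v t, W w) ≤
        C.card * ∑ w ∈ ancestors par B, W w := by
  induction N using Nat.strong_induction_on with
  | _ N ih =>
  intro B hN hroot hB hcard
  obtain ⟨v, s, hC, hs, hsum⟩ := exists_lowest_spider hpar W hB hcard
  set C := B.filter (Anc par v) with hCdef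
  set B' := B.filter (fun t => ¬ Anc par v t) with hB'def
  have hcards : C.card + B'.card = B.card := Finset.card_filter_add_card_filter_not _
  have hsB : s ⊆ ancestors par B := fun w hw => by
    simpa [ancestors] using (hs w hw).2
  have hsumB : ∑ w ∈ s, W w ≤ ∑ w ∈ ancestors par B, W w :=
    Finset.sum_le_sum_of_subset_of_nonneg hsB fun w _ _ => hW w
  have hWB : 0 ≤ ∑ w ∈ ancestors par B, W w := Finset.sum_nonneg fun w _ => hW w
  have hCB : C ⊆ B := Finset.filter_subset _ _
  -- If at most one terminal is not below `v`, it is the root. The spider, extended if necessary by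
  -- the path from `v` up to the root, then has all of `B` as feet, and its total weight is at most
  -- that of the tree.
  rcases Nat.lt_or_ge B'.card 2 with hlt | hge
  · rcases Nat.eq_zero_or_pos B'.card with h0 | h0
    · refine ⟨v, C, hCB, hC, fun t ht => Or.inl (Finset.mem_filter.1 ht).2, ?_⟩
      rw [hsum, show B.card = C.card by omega]
      exact mul_le_mul_of_nonneg_left hsumB (Nat.cast_nonneg _)
    · have hroot' : ¬ Anc par v root := by
        intro h
        obtain ⟨t', ht'⟩ := Finset.card_pos.1 h0
        exact (Finset.mem_filter.1 ht').2 (h.trans (hB t' (Finset.mem_filter.1 ht').1))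
      have hB' : B' = {root} := by
        have hmem : root ∈ B' := Finset.mem_filter.2 ⟨hroot, hroot'⟩
        refine (Finset.eq_of_subset_of_card_le (Finset.singleton_subset_iff.2 hmem) ?_).symm
        rw [Finset.card_singleton]; omega
      refine ⟨v, B, subset_rfl, hcard, fun t ht => ?_, ?_⟩
      · by_cases h : Anc par v t
        · exact Or.inl h
        · exact Or.inr (Finset.mem_singleton.1 (hB' ▸ Finset.mem_filter.2 ⟨ht, h⟩))
      · refine mul_le_mul_of_nonneg_left ?_ (Nat.cast_nonneg _)
        rw [← Finset.sum_filter_add_sum_filter_not B (Anc par v), ← hCdef, ← hB'def, hB',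
          Finset.sum_singleton, ← add_assoc, hsum]
        have hdisj : Disjoint s (leg par v root) := by
          rw [Finset.disjoint_left]
          intro w hw hw'
          rw [mem_leg_of_not_anc hroot'] at hw'
          have h1 := ((hs w hw).1).eq_or_lt hpar
          have h2 := hw'.1.eq_or_lt hpar
          rcases h1 with h1 | h1
          · exact hw'.2 h1.symm
          · rcases h2 with h2 | h2
            · exact hw'.2 h2
            · omega
        rw [← Finset.sum_union hdisj]
        refine Finset.sum_le_sum_of_subset_of_nonneg (Finset.union_subset hsB ?_)
          fun w _ _ => hW w
        intro w hw
        rw [mem_leg_of_not_anc hroot'] at hw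
        obtain ⟨t, ht⟩ := Finset.card_pos.1 (lt_of_lt_of_le (by norm_num) hC)
        simp only [ancestors, Finset.mem_filter, Finset.mem_univ, true_and]
        exact ⟨t, hCB ht, hw.1.trans (Finset.mem_filter.1 ht).2⟩
  · have hB'B : B' ⊆ B := Finset.filter_subset _ _
    have hroot' : root ∈ B' := by
      refine Finset.mem_filter.2 ⟨hroot, fun h => ?_⟩
      obtain ⟨t', ht'⟩ := Finset.card_pos.1 (lt_of_lt_of_le (by norm_num) hge)
      exact (Finset.mem_filter.1 ht').2 (h.trans (hB t' (Finset.mem_filter.1 ht').1))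
    have hltN : B'.card < N := by
      rw [← hN, ← hcards]; omega
    obtain ⟨v₁, C₁, hC₁, hcard₁, hanc₁, hle₁⟩ := ih B'.card hltN B' rfl hroot'
      (fun t ht => hB t (hB'B ht)) hge
    have hdisj : Disjoint s (ancestors par B') := by
      rw [Finset.disjoint_left]
      intro w hw hw'
      simp only [ancestors, Finset.mem_filter, Finset.mem_univ, true_and] at hw'
      obtain ⟨t, ht, hwt⟩ := hw'
      exact (Finset.mem_filter.1 ht).2 ((hs w hw).1.trans hwt)
    have hsub : s ∪ ancestors par B' ⊆ ancestors par B := by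
      refine Finset.union_subset hsB fun w hw => ?_
      simp only [ancestors, Finset.mem_filter, Finset.mem_univ, true_and] at hw ⊢
      obtain ⟨t, ht, hwt⟩ := hw
      exact ⟨t, hB'B ht, hwt⟩
    have htot : ∑ w ∈ s, W w + ∑ w ∈ ancestors par B', W w ≤ ∑ w ∈ ancestors par B, W w := by
      rw [← Finset.sum_union hdisj]
      exact Finset.sum_le_sum_of_subset_of_nonneg hsub fun w _ _ => hW w
    -- Either this spider costs at most its share |C| / |B| of the tree, or the disjoint rest of the
    -- tree costs less than the share of `B'`. In the second case the spider that induction finds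
    -- for `B'` is good enough for `B`.
    by_cases hgood : (B.card : K) * ∑ w ∈ s, W w ≤ C.card * ∑ w ∈ ancestors par B, W w
    · exact ⟨v, C, hCB, hC, fun t ht => Or.inl (Finset.mem_filter.1 ht).2, by rwa [hsum]⟩
    · refine ⟨v₁, C₁, hC₁.trans hB'B, hcard₁, hanc₁, ?_⟩
      push Not at hgood
      have hcK : (C.card : K) + B'.card = B.card := by exact_mod_cast hcards
      have hb : (0 : K) < B'.card := by exact_mod_cast (by omega : 0 < B'.card)
      have hbB : (0 : K) ≤ B.card := Nat.cast_nonneg _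
      have hc1 : (0 : K) ≤ C₁.card := Nat.cast_nonneg _
      set x := W v₁ + ∑ t ∈ C₁, ∑ w ∈ leg par v₁ t, W w
      set a := ∑ w ∈ s, W w
      set b := ∑ w ∈ ancestors par B', W w
      set z := ∑ w ∈ ancestors par B, W w
      have h1 : (B.card : K) * b ≤ B'.card * z := by
        have := mul_le_mul_of_nonneg_left htot hbB
        rw [← hcK] at this hgood ⊢
        nlinarith
      refine le_of_mul_le_mul_left ?_ hb
      calc (B'.card : K) * (B.card * x) = B.card * (B'.card * x) := by ring
        _ ≤ B.card * (C₁.card * b) := mul_le_mul_of_nonneg_left hle₁ hbB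
        _ = C₁.card * (B.card * b) := by ring
        _ ≤ C₁.card * (B'.card * z) := mul_le_mul_of_nonneg_left h1 hc1
        _ = B'.card * (C₁.card * z) := by ring

end Spider

/-! ## Parents in a connected graph -/

section Parent

variable {V : Type*}

/-- A parent function for the component of `root`: the vertices on a shortest path to the root are
the ancestors of its start. -/
theorem exists_parent (G : SimpleGraph V) (root : V) :
    ∃ par : V → V, (∀ v, par v = v ∨ G.dist (par v) root < G.dist v root) ∧
      (∀ v, par v ≠ v → G.Adj v (par v)) ∧
      ∀ v, G.Reachable v root → ∃ p : G.Walk v root, p.IsPath ∧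
        (∀ w, Anc par w v → w ∈ p.support) ∧ Anc par root v := by
  classical
  -- The parent is the second vertex of a shortest walk to the root; the root and the vertices
  -- outside its component are their own parents.
  have hex : ∀ v, ∃ u, (u = v ∨ (G.Adj v u ∧ G.dist u root < G.dist v root)) ∧
      (G.Reachable v root → v ≠ root → u ≠ v) := by
    intro v
    by_cases h : G.Reachable v root ∧ v ≠ root
    · obtain ⟨p, hp⟩ := h.1.exists_walk_length_eq_dist
      cases p with
      | nil => exact absurd rfl h.2
      | @cons _ u _ huv q =>
        refine ⟨u, Or.inr ⟨huv, ?_⟩, fun _ _ => huv.ne'⟩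
        have := SimpleGraph.dist_le q
        rw [SimpleGraph.Walk.length_cons] at hp
        omega
    · exact ⟨v, Or.inl rfl, fun h1 h2 => absurd ⟨h1, h2⟩ h⟩
  choose par h1 h2 using hex
  have hpar : ∀ v, par v = v ∨ G.dist (par v) root < G.dist v root :=
    fun v => (h1 v).imp_right And.right
  have hadj : ∀ v, par v ≠ v → G.Adj v (par v) := fun v hv => ((h1 v).resolve_left hv).1
  refine ⟨par, hpar, hadj, ?_⟩
  have key : ∀ N v, G.dist v root = N → G.Reachable v root → ∃ p : G.Walk v root, p.IsPath ∧
        (∀ w, w ∈ p.support ↔ Anc par w v) := by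
    intro N
    induction N using Nat.strong_induction_on with
    | _ N ih =>
    intro v hN hv
    by_cases hr : v = root
    · subst hr
      have hself : par v = v := by
        rcases hpar v with h | h
        · exact h
        · simp at h
      refine ⟨.nil, SimpleGraph.Walk.IsPath.nil, fun w => ?_⟩
      simp only [SimpleGraph.Walk.support_nil, List.mem_singleton]
      constructor
      · rintro rfl; exact Anc.refl _
      · rintro ⟨k, rfl⟩
        exact Function.iterate_fixed hself k
    · have hne := h2 v hv hr
      have ha := hadj v hne
      have hlt := (hpar v).resolve_left hne
      obtain ⟨p, hp, hsupp⟩ := ih _ (hN ▸ hlt) (par v) rfl (ha.symm.reachable.trans hv)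
      refine ⟨.cons ha p, ?_, fun w => ?_⟩
      · rw [SimpleGraph.Walk.cons_isPath_iff]
        refine ⟨hp, fun hmem => ?_⟩
        rcases ((hsupp v).1 hmem).eq_or_lt (δ := fun v => G.dist v root) hpar with h | h
        · exact hne h.symm
        · omega
      · rw [SimpleGraph.Walk.support_cons, List.mem_cons, hsupp]
        constructor
        · rintro (rfl | h)
          · exact Anc.refl _
          · exact h.trans (Anc.parent v)
        · exact Anc.eq_or_parent
  intro v hv
  obtain ⟨p, hp, hs⟩ := key _ v rfl hv
  exact ⟨p, hp, fun w => (hs w).2, (hs root).1 p.end_mem_support⟩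

/-- The path from a vertex up to an ancestor. -/
theorem Anc.exists_walk {G : SimpleGraph V} {par : V → V} (hadj : ∀ v, par v ≠ v → G.Adj v (par v))
    {v t : V} (h : Anc par v t) :
    ∃ p : G.Walk t v, ∀ w ∈ p.support, Anc par w t ∧ Anc par v w := by
  obtain ⟨k, hk⟩ := h
  induction k generalizing t with
  | zero =>
    obtain rfl : t = v := hk
    refine ⟨.nil, fun w hw => ?_⟩
    rw [SimpleGraph.Walk.support_nil, List.mem_singleton] at hw
    subst hw
    exact ⟨Anc.refl _, Anc.refl _⟩
  | succ k ih =>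
    obtain ⟨p, hp⟩ := ih (t := par t) hk
    by_cases ht : par t = t
    · exact ih (t := t) (by rwa [Function.iterate_succ_apply, ht] at hk)
    · refine ⟨.cons (hadj t ht) p, fun w hw => ?_⟩
      rw [SimpleGraph.Walk.support_cons, List.mem_cons] at hw
      rcases hw with rfl | hw
      · exact ⟨Anc.refl _, k + 1, hk⟩
      · exact ⟨(hp w hw).1.trans (Anc.parent t), (hp w hw).2⟩

end Parent

/-! ## Reduced costs -/

section Reduced

variable {K : Type} (I : Instance K)

open Classical in
/-- The grade that is required at a vertex: `0` if the vertex is not a terminal. -/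
def Instance.need (v : Fin I.n) : ℕ := if v ∈ I.T then I.R v else 0

/-- The cost of a facility, where grade `0` means that there is no facility. -/
def Instance.price [Zero K] (i : ℕ) (v : Fin I.n) : K := if i = 0 then 0 else I.c i v

/-- What a facility of grade `i` costs in addition to the required facility. -/
def Instance.extra [AddCommGroup K] (i : ℕ) (v : Fin I.n) : K :=
  I.price (max i (I.need v)) v - I.price (I.need v) v

variable {I}

theorem Instance.need_of_mem {v : Fin I.n} (h : v ∈ I.T) : I.need v = I.R v := if_pos h

theorem Instance.need_of_notMem {v : Fin I.n} (h : v ∉ I.T) : I.need v = 0 := if_neg h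

theorem Instance.Valid.one_le_need_iff [Zero K] [LE K] (hI : I.Valid) {v : Fin I.n} :
    1 ≤ I.need v ↔ v ∈ I.T := by
  by_cases h : v ∈ I.T
  · simp [I.need_of_mem h, h, (hI.grade v h).1]
  · simp [I.need_of_notMem h, h]

theorem Instance.Valid.need_le [Zero K] [LE K] (hI : I.Valid) (v : Fin I.n) : I.need v ≤ I.ℓ := by
  by_cases h : v ∈ I.T
  · rw [I.need_of_mem h]; exact (hI.grade v h).2
  · simp [I.need_of_notMem h]

variable [Field K] [LinearOrder K] [IsStrictOrderedRing K]

theorem Instance.Valid.price_mono (hI : I.Valid) (v : Fin I.n) {i j : ℕ} (hij : i ≤ j)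
    (hj : j ≤ I.ℓ) : I.price i v ≤ I.price j v := by
  rcases Nat.eq_zero_or_pos i with rfl | hi
  · rcases Nat.eq_zero_or_pos j with rfl | hj'
    · exact le_rfl
    · rw [Instance.price, if_pos rfl, Instance.price, if_neg hj'.ne']
      exact (hI.nonneg v).trans (hI.mono v 1 j le_rfl hj' hj)
  · rw [Instance.price, if_neg hi.ne', Instance.price, if_neg (hi.trans_le hij).ne']
    exact hI.mono v i j hi hij hj

theorem Instance.Valid.price_nonneg (hI : I.Valid) (v : Fin I.n) {i : ℕ} (hi : i ≤ I.ℓ) :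
    0 ≤ I.price i v := by
  simpa [Instance.price] using hI.price_mono v (Nat.zero_le i) hi

theorem Instance.Valid.extra_mono (hI : I.Valid) (v : Fin I.n) {i j : ℕ} (hij : i ≤ j)
    (hj : j ≤ I.ℓ) : I.extra i v ≤ I.extra j v :=
  sub_le_sub_right (hI.price_mono v (max_le_max_right _ hij) (max_le hj (hI.need_le v))) _

theorem Instance.Valid.extra_nonneg (hI : I.Valid) (v : Fin I.n) {i : ℕ} (hi : i ≤ I.ℓ) :
    0 ≤ I.extra i v :=
  sub_nonneg.2 (hI.price_mono v (le_max_right _ _) (max_le hi (hI.need_le v)))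

/-- Raising the grade of a facility costs at most the reduced cost of the new grade. -/
theorem Instance.Valid.price_raise (hI : I.Valid) (v : Fin I.n) {y g : ℕ} (hy : I.need v ≤ y)
    (hg : g ≤ I.ℓ) : I.price (max y g) v ≤ I.price y v + I.extra g v := by
  rcases le_total g y with h | h
  · rw [max_eq_left h]
    have := hI.extra_nonneg v hg
    linarith
  · rw [max_eq_right h, Instance.extra, max_eq_left (hy.trans h)]
    have := hI.price_mono v hy (h.trans hg)
    linarith

theorem Instance.price_eq_add_extra {v : Fin I.n} {y : ℕ} (hy : I.need v ≤ y) :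
    I.price y v = I.price (I.need v) v + I.extra y v := by
  rw [Instance.extra, max_eq_left hy]; ring

/-! ## Solutions -/

theorem Instance.Feasible.le_grade {H : I.G.Subgraph} {y : Fin I.n → ℕ} (h : I.Feasible H y)
    (v : Fin I.n) : y v ≤ I.ℓ := by
  by_cases hv : v ∈ H.verts
  · exact (h.grade v hv).2
  · simp [h.none v hv]

theorem Instance.Feasible.need_le {H : I.G.Subgraph} {y : Fin I.n → ℕ} (h : I.Feasible H y)
    (v : Fin I.n) : I.need v ≤ y v := by
  by_cases hv : v ∈ I.T
  · rw [I.need_of_mem hv]; exact h.required v hv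
  · simp [I.need_of_notMem hv]

theorem Instance.Feasible.cost_eq {H : I.G.Subgraph} {y : Fin I.n → ℕ} (h : I.Feasible H y) :
    I.cost H y = ∑ v, I.price (y v) v := by
  classical
  rw [Instance.cost, Finset.sum_filter]
  refine Finset.sum_congr rfl fun v _ => ?_
  split_ifs with hv
  · rw [Instance.price, if_neg (by have := (h.grade v hv).1; omega)]
  · rw [Instance.price, if_pos (h.none v hv)]

/-- The first sum is the same for all solutions, so the greedy algorithm competes with the second
sum only. -/
theorem Instance.Feasible.cost_eq_add {H : I.G.Subgraph} {y : Fin I.n → ℕ} (h : I.Feasible H y) :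
    I.cost H y = ∑ v, I.price (I.need v) v + ∑ v, I.extra (y v) v := by
  rw [h.cost_eq, ← Finset.sum_add_distrib]
  exact Finset.sum_congr rfl fun v _ => I.price_eq_add_extra (h.need_le v)

/-- There are finitely many subgraphs, and grades are at most `ℓ`, so the minimum is taken over a
finite set. -/
theorem Instance.Feasible.exists_isOpt {H : I.G.Subgraph} {y : Fin I.n → ℕ}
    (h : I.Feasible H y) : ∃ opt, I.IsOpt opt := by
  have hfin : {x : K | ∃ (H : I.G.Subgraph) (y : Fin I.n → ℕ),
      I.Feasible H y ∧ x = I.cost H y}.Finite := by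
    have h1 : (Set.univ ×ˢ Set.Iic (fun _ => I.ℓ) : Set (I.G.Subgraph × (Fin I.n → ℕ))).Finite :=
      Set.finite_univ.prod (Set.finite_Iic _)
    refine (h1.image fun p => I.cost p.1 p.2).subset ?_
    rintro x ⟨H, y, hF, rfl⟩
    exact ⟨(H, y), ⟨trivial, fun v => hF.le_grade v⟩, rfl⟩
  obtain ⟨x, hx⟩ := hfin.exists_minimal ⟨_, H, y, h, rfl⟩
  exact ⟨x, hx.prop, fun z hz => by
    rcases le_total x z with h' | h'
    · exact h'
    · exact hx.le_of_le hz h'⟩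

/-- In a solution, the ancestors of the terminals in a set `A`, for a root of maximal grade in `A`,
have at least the grades of these terminals. -/
theorem Instance.Feasible.exists_parent {H : I.G.Subgraph} {y : Fin I.n → ℕ}
    (h : I.Feasible H y) {A : Finset (Fin I.n)} (hA : A ⊆ I.T) {root : Fin I.n} (hroot : root ∈ A)
    (hmax : ∀ t ∈ A, I.need t ≤ I.need root) :
    ∃ (par : Fin I.n → Fin I.n) (δ : Fin I.n → ℕ), (∀ v, par v = v ∨ δ (par v) < δ v) ∧
      (∀ v, par v ≠ v → I.G.Adj v (par v)) ∧
      (∀ t ∈ A, Anc par root t) ∧ ∀ t ∈ A, ∀ w, Anc par w t → I.need t ≤ y w := by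
  obtain ⟨par, h1, h2, h3⟩ := VGSST.exists_parent H.spanningCoe root
  have hreach : ∀ t ∈ A, H.spanningCoe.Reachable t root := by
    intro t ht
    let f : H.coe →g H.spanningCoe := ⟨Subtype.val, fun hab => hab⟩
    have := (h.tree.connected.preconnected ⟨t, h.terminals t (hA ht)⟩
      ⟨root, h.terminals root (hA hroot)⟩).map f
    exact this
  refine ⟨par, fun v => H.spanningCoe.dist v root, h1, fun v hv => H.spanningCoe_le (h2 v hv), fun t ht => ?_, fun t ht w hw => ?_⟩
  · exact (h3 t (hreach t ht)).choose_spec.2.2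
  · obtain ⟨p, hp, hs, -⟩ := h3 t (hreach t ht)
    have h4 := h.path t (hA ht) root (hA hroot) p hp w (hs w hw)
    rwa [← I.need_of_mem (hA ht), ← I.need_of_mem (hA hroot), min_eq_left (hmax t ht)] at h4

/-! ## Generalized spiders -/

open Classical in
/-- The terminals, other than `r₁`, of the spider with center `v` of grade `g`, given distances `d`
of vertices to terminals: those of grade at most `g` that are not farther from `v` than `r₃`. -/
def Instance.legs (I : Instance K) (A : Finset (Fin I.n)) (d : ℕ → Fin I.n → Fin I.n → K)
    (v r₁ : Fin I.n) (g : ℕ) (r₃ : Fin I.n) : Finset (Fin I.n) :=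
  A.filter fun r => r ≠ r₁ ∧ I.need r ≤ g ∧ d (I.need r) r v ≤ d (I.need r₃) r₃ v

/-- The cost of a spider. -/
def Instance.spiderCost (I : Instance K) (A : Finset (Fin I.n)) (d : ℕ → Fin I.n → Fin I.n → K)
    (v r₁ : Fin I.n) (g : ℕ) (r₃ : Fin I.n) : K :=
  d g r₁ v + I.extra g v + ∑ r ∈ I.legs A d v r₁ g r₃, d (I.need r) r v

/-- The terminal `r₁` has at least grade `g`, and `r₃` is another one, of grade at most `g`. -/
def Instance.IsSpider (I : Instance K) (A : Finset (Fin I.n)) (r₁ : Fin I.n) (g : ℕ)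
    (r₃ : Fin I.n) : Prop :=
  r₁ ∈ A ∧ r₃ ∈ A ∧ r₃ ≠ r₁ ∧ I.need r₃ ≤ g ∧ g ≤ I.need r₁

/-- So a spider has at least one leg, and costs per leg can be compared by cross-multiplication. -/
theorem Instance.IsSpider.mem_legs {A : Finset (Fin I.n)} {d : ℕ → Fin I.n → Fin I.n → K}
    {v r₁ r₃ : Fin I.n} {g : ℕ} (h : I.IsSpider A r₁ g r₃) : r₃ ∈ I.legs A d v r₁ g r₃ := by
  classical
  exact Finset.mem_filter.2 ⟨h.2.1, h.2.2.1, h.2.2.2.1, le_rfl⟩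

/-- Cutting off the legs that are longer than the cost per leg, and adding those that are shorter,
does not increase the cost per leg. -/
theorem exists_threshold {V : Type*} {E C : Finset V} (hCE : C ⊆ E) (hC : C.Nonempty) (f : V → K)
    {b : K} (hb : 0 ≤ b) : ∃ r₃ ∈ E,
      (C.card : K) * (b + ∑ r ∈ E.filter (fun r => f r ≤ f r₃), f r) ≤
        (E.filter (fun r => f r ≤ f r₃)).card * (b + ∑ r ∈ C, f r) := by
  have hcard : (0 : K) < C.card := by exact_mod_cast hC.card_pos
  set ρ := (b + ∑ r ∈ C, f r) / C.card with hρ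
  have hρ' : C.card * ρ = b + ∑ r ∈ C, f r := by rw [hρ]; field_simp
  -- If all lengths exceeded the cost per leg `ρ`, those in `C` alone would sum to more than |C| ρ,
  -- the total cost including `b ≥ 0`.
  have hne : (E.filter (fun r => f r ≤ ρ)).Nonempty := by
    by_contra hcon
    rw [Finset.not_nonempty_iff_eq_empty, Finset.filter_eq_empty_iff] at hcon
    have h1 : ∑ r ∈ C, ρ < ∑ r ∈ C, f r :=
      Finset.sum_lt_sum_of_nonempty hC fun r hr => not_le.1 (hcon (hCE hr))
    rw [Finset.sum_const, nsmul_eq_mul] at h1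
    linarith
  obtain ⟨r₃, hr₃, hmax⟩ := Finset.exists_max_image _ f hne
  rw [Finset.mem_filter] at hr₃
  have hS : E.filter (fun r => f r ≤ f r₃) = E.filter (fun r => f r ≤ ρ) := by
    ext r
    simp only [Finset.mem_filter]
    exact ⟨fun h => ⟨h.1, h.2.trans hr₃.2⟩, fun h => ⟨h.1, hmax r (Finset.mem_filter.2 h)⟩⟩
  refine ⟨r₃, hr₃.1, ?_⟩
  rw [hS]
  classical
  -- Among all subsets of `E`, the one that collects the nonpositive terms minimizes the sum of `f r
  -- - ρ`.
  have h1 : ∑ r ∈ E.filter (fun r => f r ≤ ρ), (f r - ρ) ≤ ∑ r ∈ C, (f r - ρ) := by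
    have h2 : ∑ r ∈ E.filter (fun r => f r ≤ ρ), (f r - ρ) = ∑ r ∈ E, min (f r - ρ) 0 := by
      rw [Finset.sum_filter]
      refine Finset.sum_congr rfl fun r _ => ?_
      split_ifs with h
      · rw [min_eq_left (by linarith)]
      · rw [min_eq_right (by linarith [not_le.1 h])]
    rw [h2, ← Finset.sum_sdiff hCE]
    have h3 : ∑ r ∈ E \ C, min (f r - ρ) 0 ≤ 0 := Finset.sum_nonpos fun r _ => min_le_right _ _
    have h4 : ∑ r ∈ C, min (f r - ρ) 0 ≤ ∑ r ∈ C, (f r - ρ) :=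
      Finset.sum_le_sum fun r _ => min_le_left _ _
    linarith
  simp only [Finset.sum_sub_distrib, Finset.sum_const, nsmul_eq_mul] at h1
  rw [← hρ']
  have h5 : b + ∑ r ∈ E.filter (fun r => f r ≤ ρ), f r ≤
      (E.filter (fun r => f r ≤ ρ)).card * ρ := by linarith
  calc _ ≤ (C.card : K) * ((E.filter (fun r => f r ≤ ρ)).card * ρ) :=
        mul_le_mul_of_nonneg_left h5 hcard.le
    _ = _ := by ring

/-- The distances `d g r v` are nonnegative and at most the reduced costs, for grade `g`, of the
walks from `v` to `r` without `v`. -/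
structure Instance.IsDist (I : Instance K) (d : ℕ → Fin I.n → Fin I.n → K) : Prop where
  nonneg : ∀ g ≤ I.ℓ, ∀ r v, 0 ≤ d g r v
  le : ∀ g ≤ I.ℓ, ∀ r v, ∀ p : I.G.Walk v r, ∀ U : Finset (Fin I.n),
    (∀ w ∈ p.support, w ≠ v → w ∈ U) → d g r v ≤ ∑ w ∈ U, I.extra g w

/-- For every solution there is a spider whose cost per leg is at most `2 / |A|` times the reduced
cost of the solution. -/
theorem Instance.Feasible.exists_isSpider (hI : I.Valid) {H : I.G.Subgraph} {y : Fin I.n → ℕ}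
    (hF : I.Feasible H y) {A : Finset (Fin I.n)} (hA : A ⊆ I.T) (hcard : 2 ≤ A.card)
    {d : ℕ → Fin I.n → Fin I.n → K} (hd : I.IsDist d) :
    ∃ v r₁ g r₃, I.IsSpider A r₁ g r₃ ∧ (A.card : K) * I.spiderCost A d v r₁ g r₃ ≤
      2 * (I.legs A d v r₁ g r₃).card * ∑ v, I.extra (y v) v := by
  classical
  obtain ⟨root, hroot, hmax⟩ := Finset.exists_max_image A I.need
    (Finset.card_pos.1 (by omega))
  obtain ⟨par, δ, hpar, hadj, hanc, hy⟩ := hF.exists_parent hA hroot hmax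
  have hW : ∀ w, 0 ≤ I.extra (y w) w := fun w => hI.extra_nonneg w (hF.le_grade w)
  obtain ⟨v, C, hCA, hC2, hCv, hle⟩ :=
    exists_spider hpar (fun w => I.extra (y w) w) hW root _ A rfl hroot hanc hcard
  -- On a leg going down to `t`, all vertices are ancestors of `t`. On a leg going up to the root,
  -- they are ancestors of every other foot `t'`, so the grade of `t'` is guaranteed there.
  have hgrade : ∀ t ∈ C, ∀ t' ∈ C, t ≠ t' → ∀ w, (w = v ∨ w ∈ leg par v t) →
      min (I.need t) (I.need t') ≤ y w := by
    intro t ht t' ht' hne w hw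
    by_cases h : Anc par v t
    · refine (min_le_left _ _).trans (hy t (hCA ht) w ?_)
      rcases hw with rfl | hw
      · exact h
      · exact ((mem_leg_of_anc h).1 hw).1
    · have h1 := (hCv t ht).resolve_left h
      have h2 : Anc par v t' := (hCv t' ht').resolve_right (fun h3 => hne (h1.trans h3.symm))
      refine (min_le_right _ _).trans (hy t' (hCA ht') w ?_)
      rcases hw with rfl | hw
      · exact h2
      · exact ((mem_leg_of_not_anc h).1 hw).1.trans h2
  have hdist : ∀ t ∈ C, ∀ g ≤ I.ℓ, (∀ w ∈ leg par v t, g ≤ y w) →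
      d g t v ≤ ∑ w ∈ leg par v t, I.extra (y w) w := by
    intro t ht g hg hgy
    have h1 : d g t v ≤ ∑ w ∈ leg par v t, I.extra g w := by
      by_cases h : Anc par v t
      · obtain ⟨p, hp⟩ := h.exists_walk hadj
        refine hd.le g hg t v p.reverse _ fun w hw hwv => ?_
        rw [SimpleGraph.Walk.support_reverse, List.mem_reverse] at hw
        exact (mem_leg_of_anc h).2 ⟨(hp w hw).1, (hp w hw).2, hwv⟩
      · have h1 := (hCv t ht).resolve_left h
        -- Both `v` and the root are ancestors of another foot `t'`, hence comparable, and `v` is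
        -- not an ancestor of the root.
        have hrv : Anc par root v := by
          obtain ⟨t', ht', hne⟩ : ∃ t' ∈ C, t' ≠ t := Finset.exists_mem_ne (by omega) t
          have h2 : Anc par v t' := (hCv t' ht').resolve_right (fun h3 => hne (h3.trans h1.symm))
          obtain ⟨k, hk⟩ := h2
          obtain ⟨l, hl⟩ := hanc t' (hCA ht')
          rcases le_total k l with hkl | hkl
          · refine ⟨l - k, ?_⟩
            rw [← hk, ← Function.iterate_add_apply, Nat.sub_add_cancel hkl, hl]
          · exfalso
            have h4 : Anc par v root := ⟨k - l, by
              rw [← hl, ← Function.iterate_add_apply, Nat.sub_add_cancel hkl, hk]⟩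
            exact h (h1 ▸ h4)
        subst h1
        obtain ⟨p, hp⟩ := hrv.exists_walk hadj
        refine hd.le g hg t v p _ fun w hw hwv => ?_
        exact (mem_leg_of_not_anc h).2 ⟨(hp w hw).1, hwv⟩
    exact h1.trans (Finset.sum_le_sum fun w hw => hI.extra_mono w (hgy w hw) (hF.le_grade w))
  -- `r₁` and `r₂` are feet of highest and second highest grade. On the leg to `r₁` and at the
  -- center only the grade `g` of `r₂` can be relied on, and connecting the other feet to `r₁`
  -- requires no more.
  obtain ⟨r₁, hr₁, hmax₁⟩ := Finset.exists_max_image C I.need (Finset.card_pos.1 (by omega))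
  have hC'card : (C.erase r₁).card + 1 = C.card := Finset.card_erase_add_one hr₁
  obtain ⟨r₂, hr₂, hmax₂⟩ := Finset.exists_max_image (C.erase r₁) I.need
    (Finset.card_pos.1 (by omega))
  have hr₂' := Finset.mem_erase.1 hr₂
  set g := I.need r₂ with hg
  have hg₁ : g ≤ I.need r₁ := hmax₁ r₂ hr₂'.2
  have hgℓ : g ≤ I.ℓ := hI.need_le r₂
  have hbase : 0 ≤ d g r₁ v + I.extra g v :=
    add_nonneg (hd.nonneg g hgℓ _ _) (hI.extra_nonneg v hgℓ)
  -- The search cannot try all sets of feet, so `C.erase r₁` is exchanged for a set of nearest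
  -- terminals among all that are eligible.
  set E := A.filter (fun r => r ≠ r₁ ∧ I.need r ≤ g) with hE
  have hCE : C.erase r₁ ⊆ E := fun r hr => by
    have := Finset.mem_erase.1 hr
    exact Finset.mem_filter.2 ⟨hCA this.2, this.1, hmax₂ r hr⟩
  obtain ⟨r₃, hr₃, hth⟩ := exists_threshold hCE ⟨r₂, hr₂⟩ (fun r => d (I.need r) r v) hbase
  have hr₃' := Finset.mem_filter.1 hr₃
  have hlegs : E.filter (fun r => d (I.need r) r v ≤ d (I.need r₃) r₃ v) =
      I.legs A d v r₁ g r₃ := by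
    ext r
    simp only [hE, Instance.legs, Finset.mem_filter]
    tauto
  rw [hlegs] at hth
  refine ⟨v, r₁, g, r₃, ⟨(hCA hr₁), hr₃'.1, hr₃'.2.1, hr₃'.2.2, hg₁⟩, ?_⟩
  have hcost : d g r₁ v + I.extra g v + ∑ r ∈ C.erase r₁, d (I.need r) r v ≤
      I.extra (y v) v + ∑ t ∈ C, ∑ w ∈ leg par v t, I.extra (y w) w := by
    have h1 : I.extra g v ≤ I.extra (y v) v := by
      refine hI.extra_mono v ?_ (hF.le_grade v)
      have := hgrade r₂ hr₂'.2 r₁ hr₁ hr₂'.1 v (Or.inl rfl)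
      rwa [min_eq_left hg₁] at this
    have h2 : d g r₁ v ≤ ∑ w ∈ leg par v r₁, I.extra (y w) w := by
      refine hdist r₁ hr₁ g hgℓ fun w hw => ?_
      have := hgrade r₁ hr₁ r₂ hr₂'.2 hr₂'.1.symm w (Or.inr hw)
      rwa [min_eq_right hg₁] at this
    have h3 : ∑ r ∈ C.erase r₁, d (I.need r) r v ≤
        ∑ t ∈ C.erase r₁, ∑ w ∈ leg par v t, I.extra (y w) w := by
      refine Finset.sum_le_sum fun r hr => ?_
      have hr' := Finset.mem_erase.1 hr
      refine hdist r hr'.2 _ (hI.need_le r) fun w hw => ?_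
      have := hgrade r hr'.2 r₁ hr₁ hr'.1 w (Or.inr hw)
      rwa [min_eq_left (hmax₁ r hr'.2)] at this
    rw [← Finset.add_sum_erase C _ hr₁]
    linarith
  set Wt := ∑ v, I.extra (y v) v with hWt
  have hWt0 : 0 ≤ Wt := Finset.sum_nonneg fun w _ => hW w
  have hanc' : ∑ w ∈ ancestors par A, I.extra (y w) w ≤ Wt :=
    Finset.sum_le_sum_of_subset_of_nonneg (Finset.subset_univ _) fun w _ _ => hW w
  set s := (I.legs A d v r₁ g r₃).card with hs
  have hc0 : (0 : K) < (C.erase r₁).card := by exact_mod_cast Finset.card_pos.2 ⟨r₂, hr₂⟩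
  -- The origin of the factor 2: `r₁` stays active and is not counted as a leg, and |C| ≤ 2 (|C| -
  -- 1) for |C| ≥ 2.
  have hc2 : (C.card : K) ≤ 2 * (C.erase r₁).card := by
    have : C.card ≤ 2 * (C.erase r₁).card := by omega
    exact_mod_cast this
  have hA0 : (0 : K) ≤ A.card := Nat.cast_nonneg _
  have hs0 : (0 : K) ≤ s := Nat.cast_nonneg _
  refine le_of_mul_le_mul_left ?_ hc0
  set x := d g r₁ v + I.extra g v + ∑ r ∈ C.erase r₁, d (I.need r) r v
  have hx : (A.card : K) * x ≤ 2 * (C.erase r₁).card * Wt :=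
    calc (A.card : K) * x ≤ C.card * ∑ w ∈ ancestors par A, I.extra (y w) w :=
          (mul_le_mul_of_nonneg_left hcost hA0).trans hle
      _ ≤ C.card * Wt := mul_le_mul_of_nonneg_left hanc' (Nat.cast_nonneg _)
      _ ≤ 2 * (C.erase r₁).card * Wt := mul_le_mul_of_nonneg_right hc2 hWt0
  calc ((C.erase r₁).card : K) * (A.card * I.spiderCost A d v r₁ g r₃)
      = A.card * ((C.erase r₁).card * I.spiderCost A d v r₁ g r₃) := by ring
    _ ≤ A.card * (s * x) := mul_le_mul_of_nonneg_left hth hA0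
    _ = s * (A.card * x) := by ring
    _ ≤ s * (2 * (C.erase r₁).card * Wt) := mul_le_mul_of_nonneg_left hx hs0
    _ = _ := by ring

end Reduced

/-- Removing `s` out of `a` terminals changes the logarithm of their number by at least `s / a`. -/
theorem div_le_log_sub_log {a s : ℕ} (h : s < a) :
    (s : ℝ) / a ≤ Real.log a - Real.log ((a - s : ℕ) : ℝ) := by
  have ha : (0 : ℝ) < a := by exact_mod_cast (by omega : 0 < a)
  have hs : (0 : ℝ) < ((a - s : ℕ) : ℝ) := by exact_mod_cast (by omega : 0 < a - s)
  have h1 := Real.log_le_sub_one_of_pos (div_pos hs ha)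
  rw [Real.log_div hs.ne' ha.ne', Nat.cast_sub h.le] at h1
  rw [Nat.cast_sub h.le]
  have h2 : ((a : ℝ) - s) / a - 1 = -(s / a) := by field_simp; ring
  linarith

/-! ## Reasoning about for-programs -/

section Rules

variable {K : Type} [AddCommGroup K] [LinearOrder K]

theorem run_for_inv {d N : ℕ} {b : Bool} {p : Stmt} {env : ℕ → ℕ} {m : Mem K}
    (hN : dim b m = N) (P : ℕ → Mem K → Prop) (h0 : P 0 m)
    (hs : ∀ k < N, ∀ m', P k m' → P (k + 1) (p.run (Function.update env d k) m')) :
    P N ((Stmt.for_ d b p).run env m) := by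
  subst hN
  simp only [Stmt.run]
  have key : ∀ k ≤ dim b m, P k (Nat.rec m (fun k m' => p.run (Function.update env d k) m') k) := by
    intro k
    induction k with
    | zero => exact fun _ => h0
    | succ k ih => exact fun hk => hs k (by omega) _ (ih (by omega))
  exact key _ le_rfl

/-- Suited to nested loops that fill or improve tables: `J` is an invariant, `le` a preorder
expressing progress, and `Ψ k` is what pass `k` achieves. As `Ψ k` is monotone for `le`, later
passes cannot destroy it. -/
theorem run_for {d N : ℕ} {b : Bool} {p : Stmt} {env : ℕ → ℕ} {m : Mem K}
    (hN : dim b m = N) (J : Mem K → Prop) (le : Mem K → Mem K → Prop) (Ψ : ℕ → Mem K → Prop)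
    (hrefl : ∀ m, le m m) (htrans : ∀ m₁ m₂ m₃, le m₁ m₂ → le m₂ m₃ → le m₁ m₃)
    (hΨ : ∀ k m₁ m₂, le m₁ m₂ → Ψ k m₁ → Ψ k m₂) (h0 : J m)
    (hs : ∀ k < N, ∀ m', J m' → J (p.run (Function.update env d k) m') ∧
      le m' (p.run (Function.update env d k) m') ∧ Ψ k (p.run (Function.update env d k) m')) :
    J ((Stmt.for_ d b p).run env m) ∧ le m ((Stmt.for_ d b p).run env m) ∧
      ∀ k < N, Ψ k ((Stmt.for_ d b p).run env m) := by
  refine run_for_inv hN (fun k m' => J m' ∧ le m m' ∧ ∀ j < k, Ψ j m')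
    ⟨h0, hrefl m, fun j hj => absurd hj (by omega)⟩ ?_
  rintro k hk m' ⟨h1, h2, h3⟩
  obtain ⟨h4, h5, h6⟩ := hs k hk m' h1
  refine ⟨h4, htrans _ _ _ h2 h5, fun j hj => ?_⟩
  rcases Nat.lt_succ_iff_lt_or_eq.1 hj with hj | rfl
  · exact hΨ _ _ _ h5 (h3 j hj)
  · exact h6

@[simp] theorem scope_nat_of_ne {env : ℕ → ℕ} {m : Mem K} {a : ℕ} (h : a ≠ 9) :
    (scope env m).nat a = m.nat a := Function.update_of_ne h _ _

@[simp] theorem scope_nat_nine {env : ℕ → ℕ} {m : Mem K} : (scope env m).nat 9 = env := by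
  simp [scope]

@[simp] theorem scope_num {env : ℕ → ℕ} {m : Mem K} : (scope env m).num = m.num := rfl

@[simp] theorem writeNat_nat_self {m : Mem K} {a j k : ℕ} :
    (m.writeNat a j k).nat a = Function.update (m.nat a) j k := Function.update_self _ _ _

@[simp] theorem writeNat_nat_of_ne {m : Mem K} {a a' j k : ℕ} (h : a' ≠ a) :
    (m.writeNat a j k).nat a' = m.nat a' := Function.update_of_ne h _ _

@[simp] theorem writeNat_num {m : Mem K} {a j k : ℕ} : (m.writeNat a j k).num = m.num := rfl

@[simp] theorem writeNum_num_self {m : Mem K} {a j : ℕ} {x : K} :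
    (m.writeNum a j x).num a = Function.update (m.num a) j x := Function.update_self _ _ _

@[simp] theorem writeNum_num_of_ne {m : Mem K} {a a' j : ℕ} {x : K} (h : a' ≠ a) :
    (m.writeNum a j x).num a' = m.num a' := Function.update_of_ne h _ _

@[simp] theorem writeNum_nat {m : Mem K} {a j : ℕ} {x : K} : (m.writeNum a j x).nat = m.nat := rfl

end Rules

theorem mul_add_inj {n a b a' b' : ℕ} (hb : b < n) (hb' : b' < n) :
    a * n + b = a' * n + b' ↔ a = a' ∧ b = b' := by
  constructor
  · intro h
    have h1 : a = a' := by
      have := congrArg (· / n) h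
      simpa [Nat.add_div_of_dvd_right, Nat.div_eq_of_lt hb, Nat.div_eq_of_lt hb',
        Nat.mul_add_div, Nat.pos_of_ne_zero (by omega : n ≠ 0), mul_comm _ n] using this
    subst h1
    exact ⟨rfl, by omega⟩
  · rintro ⟨rfl, rfl⟩; rfl

/-! ## The memory during the computation -/

/-- The loop variable of level `i`. -/
def var (i : ℕ) : NatExp := .cell 9 (.const i)

/-- The address of the entry in row `e` and column `f` of a table with `n` columns. -/
def entry (e f : NatExp) : NatExp := .add (.mul e (.cell 0 (.const 0))) f

/-- The test for equality. -/
def eqTest (e f : NatExp) : Test := .conj (.natLe e f) (.natLe f e)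

section Memory

variable {K : Type} [Field K] [LinearOrder K] [IsStrictOrderedRing K] {I : Instance K}

/-- The address of the entry for the grade `g`, the target `r` and the start `v` in the tables of
distances. -/
def Instance.addr (I : Instance K) (g : ℕ) (r v : Fin I.n) : ℕ := (g * I.n + r) * I.n + v

theorem Instance.addr_inj {g g' : ℕ} {r r' v v' : Fin I.n} :
    I.addr g r v = I.addr g' r' v' ↔ g = g' ∧ r = r' ∧ v = v' := by
  rw [Instance.addr, Instance.addr, mul_add_inj v.2 v'.2, mul_add_inj r.2 r'.2, and_assoc,
    Fin.val_inj, Fin.val_inj]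

/-- The input has not been changed. -/
structure Instance.Intact (I : Instance K) (m : Mem K) : Prop where
  nat : ∀ a < 3, m.nat a = I.input.nat a
  num : m.num 0 = I.input.num 0

theorem Instance.Intact.run {m : Mem K} (h : I.Intact m) {s : Stmt}
    (hs : (s.keepsNat 0 && s.keepsNat 1 && s.keepsNat 2 && s.keepsNum 0) = true)
    (env : ℕ → ℕ) : I.Intact (s.run env m) := by
  simp only [Bool.and_eq_true] at hs
  refine ⟨fun a ha => ?_, ?_⟩
  · rw [← h.nat a ha]
    interval_cases a
    · exact Stmt.run_nat hs.1.1.1 env m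
    · exact Stmt.run_nat hs.1.1.2 env m
    · exact Stmt.run_nat hs.1.2 env m
  · rw [← h.num]
    exact Stmt.run_num hs.2 env m

variable {m : Mem K}

theorem Instance.Intact.n_eq (h : I.Intact m) : m.nat 0 0 = I.n := by
  rw [h.nat 0 (by norm_num)]; simp [Instance.input]

theorem Instance.Intact.ℓ_eq (h : I.Intact m) : m.nat 0 1 = I.ℓ := by
  rw [h.nat 0 (by norm_num)]; simp [Instance.input]

theorem Instance.Intact.dim_true (h : I.Intact m) : dim true m = I.n := by
  simp [dim, h.n_eq]

theorem Instance.Intact.dim_false (h : I.Intact m) : dim false m = I.ℓ + 1 := by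
  simp [dim, h.ℓ_eq]

theorem Instance.Intact.adj_iff (h : I.Intact m) (u v : Fin I.n) :
    1 ≤ m.nat 1 (u * I.n + v) ↔ I.G.Adj u v := by
  rw [h.nat 1 (by norm_num)]
  simp only [Instance.input, one_ne_zero, if_false, if_true]
  split_ifs with hex
  · obtain ⟨u', v', ha, he⟩ := hex
    rw [mul_add_inj v.2 v'.2, Fin.val_inj, Fin.val_inj] at he
    obtain ⟨rfl, rfl⟩ := he
    simp [ha]
  · exact ⟨fun h => absurd h (by norm_num), fun ha => absurd ⟨u, v, ha, rfl⟩ hex⟩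

theorem Instance.Intact.need_eq (h : I.Intact m) (v : Fin I.n) : m.nat 2 v = I.need v := by
  rw [h.nat 2 (by norm_num)]
  simp [Instance.input, Instance.need]

theorem Instance.Intact.price_eq (h : I.Intact m) (v : Fin I.n) {g : ℕ} (h1 : 1 ≤ g)
    (hg : g ≤ I.ℓ) : m.num 0 (v * I.ℓ + (g - 1)) = I.price g v := by
  rw [h.num]
  have h2 : (v * I.ℓ + (g - 1)) / I.ℓ = v := by
    rw [mul_comm, Nat.mul_add_div (by omega), Nat.div_eq_of_lt (by omega), add_zero]
  have h3 : (v * I.ℓ + (g - 1)) % I.ℓ = g - 1 := by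
    rw [mul_comm, Nat.mul_add_mod, Nat.mod_eq_of_lt (by omega)]
  simp only [Instance.input, if_true, h2, h3, Instance.price]
  rw [dif_pos v.2, if_neg (by omega), Nat.sub_add_cancel h1]

@[simp] theorem eval_var (env : ℕ → ℕ) (m : Mem K) (i : ℕ) :
    (var i).eval (scope env m) = env i := by
  simp [var, NatExp.eval]

theorem Instance.Intact.eval_entry (h : I.Intact m) (env : ℕ → ℕ) (e f : NatExp) :
    (entry e f).eval (scope env m) = e.eval (scope env m) * I.n + f.eval (scope env m) := by
  simp [entry, NatExp.eval, h.n_eq]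

/-! ## Initialization -/

/-- Store the reduced cost for the grade `var 1` and the vertex `var 0`. -/
def storeExtra : Stmt :=
  .ite (.natLe (var 1) (.cell 2 (var 0)))
    (.setNum 1 (entry (var 1) (var 0))
      (.sub (.cell 0 (.const 0)) (.cell 0 (.const 0))))
    (.ite (.natLe (.cell 2 (var 0)) (.const 0))
      (.setNum 1 (entry (var 1) (var 0))
        (.cell 0 (.add (.mul (var 0) (.cell 0 (.const 1))) (.sub (var 1) (.const 1)))))
      (.setNum 1 (entry (var 1) (var 0))
        (.sub (.cell 0 (.add (.mul (var 0) (.cell 0 (.const 1))) (.sub (var 1) (.const 1))))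
          (.cell 0 (.add (.mul (var 0) (.cell 0 (.const 1)))
            (.sub (.cell 2 (var 0)) (.const 1)))))))

theorem run_storeExtra (hI : I.Valid) (hm : I.Intact m) {env : ℕ → ℕ} {v : Fin I.n} {g : ℕ}
    (hg : g ≤ I.ℓ) (h0 : env 0 = v) (h1 : env 1 = g) :
    storeExtra.run env m = m.writeNum 1 (g * I.n + v) (I.extra g v) := by
  have hneed := hI.need_le v
  simp only [storeExtra, Stmt.run, Test.Holds, NatExp.eval, NumExp.eval, eval_var, hm.eval_entry, h0, h1,
    scope_num, ne_eq, Nat.reduceEqDiff, not_false_eq_true,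
    scope_nat_of_ne, hm.ℓ_eq, hm.need_eq]
  split_ifs with h2 h3
  -- Programs have no constant zero of `K`, so zero is written as the difference of a cell and
  -- itself. The grade `0` always falls under this case, so `g - 1` is not truncated in the others.
  · rw [sub_self, Instance.extra, max_eq_right h2, sub_self]
  · have h4 : I.need v = 0 := by omega
    rw [hm.price_eq v (by omega) hg, Instance.extra, max_eq_left (by omega), h4]
    simp [Instance.price]
  · rw [hm.price_eq v (by omega) hg, hm.price_eq v (by omega) hneed, Instance.extra,
      max_eq_left (by omega)]

/-- Initialization of the grades, of the active terminals, of the reduced costs, and of the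
distances of the terminals to themselves. -/
def initialize₀ : Stmt :=
  .for_ 0 true (.seq (.setNat 5 (var 0) (.cell 2 (var 0)))
    (.seq (.ite (.natLe (.const 1) (.cell 2 (var 0))) (.setNat 6 (var 0) (.const 1))
        (.setNat 6 (var 0) (.const 0)))
      (.for_ 1 false (.seq
        (.setNat 7 (entry (entry (var 1) (var 0)) (var 0)) (.const 1)) storeExtra))))

/-- The table of reduced costs has been filled. -/
def Instance.Tabulated (I : Instance K) (m : Mem K) : Prop :=
  ∀ g ≤ I.ℓ, ∀ v : Fin I.n, m.num 1 (g * I.n + v) = I.extra g v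

end Memory

section Initialization

variable {K : Type} [Field K] [LinearOrder K] [IsStrictOrderedRing K] {I : Instance K} {m : Mem K}

/-- Correct entries of the tables stay correct. -/
structure Instance.InitLe (I : Instance K) (m m' : Mem K) : Prop where
  grade : ∀ v : Fin I.n, m.nat 5 v = I.need v → m'.nat 5 v = I.need v
  active : ∀ v : Fin I.n, (1 ≤ m.nat 6 v ↔ v ∈ I.T) → (1 ≤ m'.nat 6 v ↔ v ∈ I.T)
  flag : ∀ j, 1 ≤ m.nat 7 j → 1 ≤ m'.nat 7 j
  extra : ∀ g ≤ I.ℓ, ∀ v : Fin I.n, m.num 1 (g * I.n + v) = I.extra g v →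
    m'.num 1 (g * I.n + v) = I.extra g v

theorem Instance.InitLe.refl (m : Mem K) : I.InitLe m m :=
  ⟨fun _ h => h, fun _ h => h, fun _ h => h, fun _ _ _ h => h⟩

theorem Instance.InitLe.trans {m₁ m₂ m₃ : Mem K} (h : I.InitLe m₁ m₂) (h' : I.InitLe m₂ m₃) :
    I.InitLe m₁ m₃ :=
  ⟨fun v hv => h'.grade v (h.grade v hv), fun v hv => h'.active v (h.active v hv),
    fun j hj => h'.flag j (h.flag j hj), fun g hg v hv => h'.extra g hg v (h.extra g hg v hv)⟩

/-- Only distances of vertices to themselves are known. -/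
def Instance.Diagonal (I : Instance K) (m : Mem K) : Prop :=
  ∀ g r v, 1 ≤ m.nat 7 (I.addr g r v) → r = v

theorem initialize₀_grades (hI : I.Valid) (hm : I.Intact m) (hd : I.Diagonal m) {env : ℕ → ℕ}
    {v : Fin I.n} (h0 : env 0 = v) :
    let m' := (Stmt.for_ 1 false (.seq
        (.setNat 7 (entry (entry (var 1) (var 0)) (var 0)) (.const 1)) storeExtra)).run env m
    (I.Intact m' ∧ I.Diagonal m') ∧ I.InitLe m m' ∧
      ∀ g < I.ℓ + 1, 1 ≤ m'.nat 7 (I.addr g v v) ∧ m'.num 1 (g * I.n + v) = I.extra g v := by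
  refine run_for hm.dim_false (fun m => I.Intact m ∧ I.Diagonal m) I.InitLe
    (fun g m' => g < I.ℓ + 1 → 1 ≤ m'.nat 7 (I.addr g v v) ∧ m'.num 1 (g * I.n + v) = I.extra g v)
    .refl (fun _ _ _ => .trans) (fun g m₁ m₂ h12 h hg => ⟨h12.flag _ (h hg).1,
      h12.extra g (by omega) v (h hg).2⟩) ⟨hm, hd⟩ ?_ |>.imp_right
      (And.imp_right fun h g hg => h g hg hg)
  rintro g hg m' ⟨h1, h2⟩
  have e0 : Function.update env 1 g 0 = v := by simpa using h0
  have e1 : Function.update env 1 g 1 = g := by simp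
  have hA : (Stmt.setNat 7 (entry (entry (var 1) (var 0)) (var 0)) (.const 1)).run
      (Function.update env 1 g) m' = m'.writeNat 7 (I.addr g v v) 1 := by
    simp only [Stmt.run, NatExp.eval, h1.eval_entry, eval_var, e0, e1, Instance.addr]
  have h3 := h1.run (s := .setNat 7 (entry (entry (var 1) (var 0)) (var 0)) (.const 1)) rfl
    (Function.update env 1 g)
  rw [Stmt.run, hA, run_storeExtra hI (hA ▸ h3) (by omega) e0 e1]
  rw [hA] at h3
  refine ⟨⟨⟨h3.nat, by simpa using h3.num⟩, ?_⟩, ⟨fun w hw => by simpa using hw,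
    fun w hw => by simpa using hw, fun j hj => ?_, fun g' hg' w hw => ?_⟩, fun _ => ⟨?_, ?_⟩⟩
  · intro g' r w
    simp only [writeNum_nat, writeNat_nat_self, Function.update_apply, I.addr_inj]
    split_ifs with h
    · exact fun _ => h.2.1.trans h.2.2.symm
    · exact h2 g' r w
  · simp only [writeNum_nat, writeNat_nat_self, Function.update_apply]
    split_ifs
    · exact le_rfl
    · exact hj
  · simp only [writeNum_num_self, Function.update_apply, writeNat_num, mul_add_inj w.2 v.2]
    split_ifs with h
    · rw [h.1, Fin.ext h.2]
    · exact hw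
  · simp
  · simp

/-- The state of the tables after the initialization. -/
theorem run_initialize₀ (hI : I.Valid) (hm : I.Intact m) (hd : I.Diagonal m) (env : ℕ → ℕ) :
    (I.Intact (initialize₀.run env m) ∧ I.Diagonal (initialize₀.run env m)) ∧
      ∀ v : Fin I.n, (initialize₀.run env m).nat 5 v = I.need v ∧
        (1 ≤ (initialize₀.run env m).nat 6 v ↔ v ∈ I.T) ∧
        ∀ g ≤ I.ℓ, 1 ≤ (initialize₀.run env m).nat 7 (I.addr g v v) ∧
          (initialize₀.run env m).num 1 (g * I.n + v) = I.extra g v := by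
  have key := run_for (d := 0) (p := (.seq (.setNat 5 (var 0) (.cell 2 (var 0)))
    (.seq (.ite (.natLe (.const 1) (.cell 2 (var 0))) (.setNat 6 (var 0) (.const 1))
        (.setNat 6 (var 0) (.const 0)))
      (.for_ 1 false (.seq
        (.setNat 7 (entry (entry (var 1) (var 0)) (var 0)) (.const 1)) storeExtra))))) (env := env)
    hm.dim_true (fun m => I.Intact m ∧ I.Diagonal m) I.InitLe
    (fun k m' => ∀ v : Fin I.n, k = v → m'.nat 5 v = I.need v ∧ (1 ≤ m'.nat 6 v ↔ v ∈ I.T) ∧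
      ∀ g < I.ℓ + 1, 1 ≤ m'.nat 7 (I.addr g v v) ∧ m'.num 1 (g * I.n + v) = I.extra g v)
    .refl (fun _ _ _ => .trans) (fun k m₁ m₂ h12 h v hv => ?_) ⟨hm, hd⟩ ?_
  · exact ⟨key.1, fun v => ⟨(key.2.2 v v.2 v rfl).1, (key.2.2 v v.2 v rfl).2.1,
      fun g hg => (key.2.2 v v.2 v rfl).2.2 g (by omega)⟩⟩
  · obtain ⟨h1, h2, h3⟩ := h v hv
    exact ⟨h12.grade v h1, h12.active v h2, fun g hg => ⟨h12.flag _ (h3 g hg).1,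
      h12.extra g (by omega) v (h3 g hg).2⟩⟩
  · rintro k hk m' ⟨h1, h2⟩
    obtain ⟨v, rfl⟩ : ∃ v : Fin I.n, k = v := ⟨⟨k, hk⟩, rfl⟩
    set env' := Function.update env 0 (v : ℕ) with henv
    have e0 : env' 0 = v := by simp [henv]
    set m₁ := (Stmt.setNat 5 (var 0) (.cell 2 (var 0))).run env' m' with hm₁
    set m₂ := (Stmt.ite (.natLe (.const 1) (.cell 2 (var 0))) (.setNat 6 (var 0) (.const 1))
        (.setNat 6 (var 0) (.const 0))).run env' m₁ with hm₂
    have i₁ : I.Intact m₁ := h1.run rfl _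
    have i₂ : I.Intact m₂ := i₁.run rfl _
    have v₁ : m₁ = m'.writeNat 5 v (I.need v) := by
      simp only [hm₁, Stmt.run, NatExp.eval, eval_var, e0, ne_eq, Nat.reduceEqDiff,
        not_false_eq_true, scope_nat_of_ne, h1.need_eq]
    have v₂ : m₂ = m₁.writeNat 6 v (if v ∈ I.T then 1 else 0) := by
      simp only [hm₂, Stmt.run, Test.Holds, NatExp.eval, eval_var, e0, ne_eq,
        Nat.reduceEqDiff, not_false_eq_true, scope_nat_of_ne, i₁.need_eq, hI.one_le_need_iff]
      split_ifs <;> rfl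
    have d₂ : I.Diagonal m₂ := fun g r w h => h2 g r w (by simpa [v₂, v₁] using h)
    have l₂ : I.InitLe m' m₂ := by
      refine ⟨fun w hw => ?_, fun w hw => ?_, fun j hj => ?_, fun g hg w hw => ?_⟩
      · simp only [v₂, v₁, ne_eq, Nat.reduceEqDiff, not_false_eq_true, writeNat_nat_of_ne,
          writeNat_nat_self, Function.update_apply, Fin.val_inj]
        split_ifs with h
        · rw [h]
        · exact hw
      · simp only [v₂, v₁, ne_eq, Nat.reduceEqDiff, not_false_eq_true, writeNat_nat_of_ne,
          writeNat_nat_self, Function.update_apply, Fin.val_inj]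
        split_ifs with h h'
        · simpa [h] using h'
        · simpa [h] using h'
        · exact hw
      · simpa [v₂, v₁] using hj
      · simpa [v₂, v₁] using hw
    obtain ⟨h3, h4, h5⟩ := initialize₀_grades hI i₂ d₂ e0
    refine ⟨h3, l₂.trans h4, fun w hw => ?_⟩
    obtain rfl := Fin.ext hw
    refine ⟨h4.grade _ ?_, h4.active _ ?_, h5⟩
    · simp [v₂, v₁]
    · simp only [v₂, writeNat_nat_self, Function.update_self]
      split_ifs with h <;> simp [h]

end Initialization

/-! ## Distances -/

/-- Copy row `b` of the table of marks to row `a`. -/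
def copyRow (a b : NatExp) : Stmt := .for_ 5 true (.setNat 8 (entry a (var 5)) (.cell 8 (entry b (var 5))))

/-- The address of the distance to `var 2` for the grade `var 1`. -/
def distAddr (v : NatExp) : NatExp := entry (entry (var 1) (var 2)) v

/-- The length of the path from `var 3` that starts with an edge to `var 4`. -/
def relaxed : NumExp := .add (.cell 2 (distAddr (var 4))) (.cell 1 (entry (var 1) (var 4)))

/-- If the edge from `var 3` to `var 4` yields a better path than the one known, store its length
and its set of vertices. -/
def relax : Stmt :=
  .ite (.conj (.natLe (.const 1) (.cell 1 (entry (var 3) (var 4))))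
      (.conj (.natLe (.const 1) (.cell 7 (distAddr (var 4))))
        (.neg (.conj (.natLe (.const 1) (.cell 7 (distAddr (var 3))))
          (.numLe (.cell 2 (distAddr (var 3))) relaxed)))))
    (.seq (.setNum 2 (distAddr (var 3)) relaxed)
      (.seq (.setNat 7 (distAddr (var 3)) (.const 1))
        (.seq (copyRow (distAddr (var 3)) (distAddr (var 4)))
          (.setNat 8 (entry (distAddr (var 3)) (var 4)) (.const 1)))))
    .skip

/-- Shortest paths to all vertices for all grades, by the algorithm of Bellman and Ford. -/
def shortestPaths : Stmt :=
  .for_ 0 true (.for_ 1 false (.for_ 2 true (.for_ 3 true (.for_ 4 true relax))))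

section Distances

variable {K : Type} [Field K] [LinearOrder K] [IsStrictOrderedRing K] {I : Instance K} {m : Mem K}

theorem run_copyRow (hm : I.Intact m) {env : ℕ → ℕ} {a b : ℕ} (hab : a ≠ b) {ea eb : NatExp}
    (ha : ∀ m' w, I.Intact m' → ea.eval (scope (Function.update env 5 w) m') = a)
    (hb : ∀ m' w, I.Intact m' → eb.eval (scope (Function.update env 5 w) m') = b) :
    (∀ w : Fin I.n, ((copyRow ea eb).run env m).nat 8 (a * I.n + w) = m.nat 8 (b * I.n + w)) ∧
      ∀ i ≠ a, ∀ w : Fin I.n, ((copyRow ea eb).run env m).nat 8 (i * I.n + w) =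
        m.nat 8 (i * I.n + w) := by
  have key := run_for_inv (d := 5)
    (p := .setNat 8 (entry ea (var 5)) (.cell 8 (entry eb (var 5)))) (env := env) hm.dim_true
    (fun k m' => I.Intact m' ∧
      (∀ w : Fin I.n, w < k → m'.nat 8 (a * I.n + w) = m.nat 8 (b * I.n + w)) ∧
      ∀ i ≠ a, ∀ w : Fin I.n, m'.nat 8 (i * I.n + w) = m.nat 8 (i * I.n + w))
    ⟨hm, fun w hw => absurd hw (by omega), fun _ _ _ => rfl⟩ ?_
  · exact ⟨fun w => key.2.1 w w.2, key.2.2⟩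
  · rintro k hk m' ⟨h1, h2, h3⟩
    obtain ⟨u, rfl⟩ : ∃ u : Fin I.n, k = u := ⟨⟨k, hk⟩, rfl⟩
    refine ⟨h1.run ?_ _, ?_⟩
    · rfl
    have hr : (Stmt.setNat 8 (entry ea (var 5)) (.cell 8 (entry eb (var 5)))).run
        (Function.update env 5 u) m' =
        m'.writeNat 8 (a * I.n + u) (m.nat 8 (b * I.n + u)) := by
      simp only [Stmt.run, NatExp.eval, h1.eval_entry, eval_var, ne_eq, Nat.reduceEqDiff,
        not_false_eq_true, scope_nat_of_ne, ha m' u h1, hb m' u h1,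
        Function.update_self, h3 b hab.symm]
    rw [hr]
    refine ⟨fun w hw => ?_, fun i hi w => ?_⟩
    · simp only [writeNat_nat_self, Function.update_apply, mul_add_inj w.2 u.2, Fin.val_inj]
      split_ifs with h
      · rw [h.2]
      · refine h2 w ?_
        have : (w : ℕ) ≠ u := fun h' => h ⟨trivial, Fin.ext h'⟩
        omega
    · simp only [writeNat_nat_self, Function.update_apply, mul_add_inj w.2 u.2]
      rw [if_neg (fun h => hi h.1)]
      exact h3 i hi w

/-- The known distances are the lengths of paths through the marked vertices. -/
def Instance.Sound (I : Instance K) (m : Mem K) : Prop :=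
  ∀ g ≤ I.ℓ, ∀ r v, 1 ≤ m.nat 7 (I.addr g r v) →
    (∃ p : I.G.Walk v r, ∀ w ∈ p.support, w ≠ v → 1 ≤ m.nat 8 (I.addr g r v * I.n + w)) ∧
    ∑ w : Fin I.n, (if 1 ≤ m.nat 8 (I.addr g r v * I.n + w) then I.extra g w else 0) ≤
      m.num 2 (I.addr g r v)

/-- Known distances stay known and do not increase. -/
def Instance.DistLe (I : Instance K) (m m' : Mem K) : Prop :=
  ∀ g r v, 1 ≤ m.nat 7 (I.addr g r v) →
    1 ≤ m'.nat 7 (I.addr g r v) ∧ m'.num 2 (I.addr g r v) ≤ m.num 2 (I.addr g r v)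

theorem Instance.DistLe.refl (m : Mem K) : I.DistLe m m := fun _ _ _ h => ⟨h, le_rfl⟩

theorem Instance.DistLe.trans {m₁ m₂ m₃ : Mem K} (h : I.DistLe m₁ m₂) (h' : I.DistLe m₂ m₃) :
    I.DistLe m₁ m₃ := fun g r v hv =>
  ⟨(h' g r v (h g r v hv).1).1, (h' g r v (h g r v hv).1).2.trans (h g r v hv).2⟩

/-- The distance from `v` is known, and at most `x`. -/
def Instance.Within (I : Instance K) (m : Mem K) (g : ℕ) (r v : Fin I.n) (x : K) : Prop :=
  1 ≤ m.nat 7 (I.addr g r v) ∧ m.num 2 (I.addr g r v) ≤ x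

theorem Instance.Within.mono {m m' : Mem K} {g : ℕ} {r v : Fin I.n} {x : K}
    (h : I.Within m g r v x) (hle : I.DistLe m m') : I.Within m' g r v x :=
  ⟨(hle g r v h.1).1, (hle g r v h.1).2.trans h.2⟩

/-- A relaxation of Bellman and Ford. The marks of `v` become those of `u` together with `u`; only
the set of vertices is kept, since later grades are raised on this set in any order. If `u` is
already marked it is counted once in the set but added to the length, hence the inequality in
`Sound`. -/
theorem run_relax (hI : I.Valid) (hm : I.Intact m) (ht : I.Tabulated m) (hs : I.Sound m) {env : ℕ → ℕ} {g : ℕ}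
    {r v u : Fin I.n} (hg : g ≤ I.ℓ) (h1 : env 1 = g) (h2 : env 2 = r) (h3 : env 3 = v)
    (h4 : env 4 = u) :
    I.Sound (relax.run env m) ∧ I.DistLe m (relax.run env m) ∧
      (I.G.Adj v u → ∀ x, I.Within m g r u x → I.Within (relax.run env m) g r v
        (x + I.extra g u)) := by
  have haddr : ∀ {m' : Mem K} {env' : ℕ → ℕ} {i : ℕ} {w : Fin I.n}, I.Intact m' → env' 1 = g →
      env' 2 = r → env' i = w → (distAddr (var i)).eval (scope env' m') = I.addr g r w := by
    intro m' env' i w hm' e1 e2 e3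
    simp only [distAddr, hm'.eval_entry, eval_var, e1, e2, e3, Instance.addr]
  have hrel : relaxed.eval (scope env m) = m.num 2 (I.addr g r u) + I.extra g u := by
    simp only [relaxed, NumExp.eval, haddr hm h1 h2 h4, scope_num, hm.eval_entry,
      eval_var, h1, h4, ht g hg]
  rw [relax, Stmt.run]
  have hcond : (Test.Holds (scope env m) (.conj (.natLe (.const 1) (.cell 1 (entry (var 3) (var 4))))
      (.conj (.natLe (.const 1) (.cell 7 (distAddr (var 4))))
        (.neg (.conj (.natLe (.const 1) (.cell 7 (distAddr (var 3))))
          (.numLe (.cell 2 (distAddr (var 3))) relaxed)))))) ↔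
      I.G.Adj v u ∧ 1 ≤ m.nat 7 (I.addr g r u) ∧
        ¬ I.Within m g r v (m.num 2 (I.addr g r u) + I.extra g u) := by
    rw [← hm.adj_iff]
    simp only [Test.Holds, NatExp.eval, haddr hm h1 h2 h4, haddr hm h1 h2 h3, NumExp.eval, hrel,
      hm.eval_entry, eval_var, h3, h4, ne_eq, Nat.reduceEqDiff, not_false_eq_true,
      scope_nat_of_ne, scope_num, Instance.Within]
  split_ifs with hc
  · rw [hcond] at hc
    obtain ⟨hadj, hu, hv⟩ := hc
    have hvu : I.addr g r v ≠ I.addr g r u := fun h => hadj.ne (I.addr_inj.1 h).2.2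
    set D := m.num 2 (I.addr g r u) + I.extra g u with hD
    set m₁ := (Stmt.setNum 2 (distAddr (var 3)) relaxed).run env m with hm₁
    set m₂ := (Stmt.setNat 7 (distAddr (var 3)) (.const 1)).run env m₁ with hm₂
    set m₃ := (copyRow (distAddr (var 3)) (distAddr (var 4))).run env m₂ with hm₃
    set m₄ := (Stmt.setNat 8 (entry (distAddr (var 3)) (var 4)) (.const 1)).run env m₃ with hm₄
    have hrun : (Stmt.seq (.setNum 2 (distAddr (var 3)) relaxed)
      (.seq (.setNat 7 (distAddr (var 3)) (.const 1))
        (.seq (copyRow (distAddr (var 3)) (distAddr (var 4)))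
          (.setNat 8 (entry (distAddr (var 3)) (var 4)) (.const 1))))).run env m = m₄ := rfl
    rw [hrun]
    have i₁ : I.Intact m₁ := hm.run rfl _
    have i₂ : I.Intact m₂ := i₁.run rfl _
    have i₃ : I.Intact m₃ := i₂.run rfl _
    have v₁ : m₁ = m.writeNum 2 (I.addr g r v) D := by
      simp only [hm₁, Stmt.run, haddr hm h1 h2 h3, hrel]
    have v₂ : m₂ = m₁.writeNat 7 (I.addr g r v) 1 := by
      simp only [hm₂, Stmt.run, haddr i₁ h1 h2 h3, NatExp.eval]
    have v₄ : m₄ = m₃.writeNat 8 (I.addr g r v * I.n + u) 1 := by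
      simp only [hm₄, Stmt.run, NatExp.eval, i₃.eval_entry, haddr i₃ h1 h2 h3, eval_var, h4]
    have n₃ : m₃.num = m₂.num := funext fun a => Stmt.run_num rfl _ _
    have f₃ : m₃.nat 7 = m₂.nat 7 := Stmt.run_nat rfl _ _
    obtain ⟨c₁, c₂⟩ := run_copyRow (env := env) i₂ hvu (ea := distAddr (var 3))
      (eb := distAddr (var 4))
      (fun m' w hm' => haddr hm' (by simpa using h1) (by simpa using h2) (by simpa using h3))
      (fun m' w hm' => haddr hm' (by simpa using h1) (by simpa using h2) (by simpa using h4))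
    rw [← hm₃] at c₁ c₂
    have hflag : ∀ j, m₄.nat 7 j = if j = I.addr g r v then 1 else m.nat 7 j := by
      intro j
      simp only [v₄, ne_eq, Nat.reduceEqDiff, not_false_eq_true, writeNat_nat_of_ne, f₃, v₂,
        writeNat_nat_self, Function.update_apply, v₁, writeNum_nat]
    have hdist : ∀ j, m₄.num 2 j = if j = I.addr g r v then D else m.num 2 j := by
      intro j
      simp only [v₄, writeNat_num, n₃, v₂, v₁, writeNum_num_self, Function.update_apply]
    have hold : ∀ i, m₂.nat 8 i = m.nat 8 i := by simp [v₂, v₁]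
    have hmark : ∀ w : Fin I.n, m₄.nat 8 (I.addr g r v * I.n + w) =
        if w = u then 1 else m.nat 8 (I.addr g r u * I.n + w) := by
      intro w
      simp only [v₄, writeNat_nat_self, Function.update_apply, mul_add_inj w.2 u.2, true_and,
        Fin.val_inj, c₁, hold]
    have hmark' : ∀ i ≠ I.addr g r v, ∀ w : Fin I.n,
        m₄.nat 8 (i * I.n + w) = m.nat 8 (i * I.n + w) := by
      intro i hi w
      simp only [v₄, writeNat_nat_self, Function.update_apply, mul_add_inj w.2 u.2, hi, false_and,
        if_false, c₂ i hi, hold]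
    -- By the test, a known distance is overwritten only if it is larger than `D`, so distances
    -- never increase.
    have hvD : 1 ≤ m.nat 7 (I.addr g r v) → D ≤ m.num 2 (I.addr g r v) := fun h =>
      (not_le.1 fun h' => hv ⟨h, h'⟩).le
    refine ⟨?_, ?_, fun _ x hx => ⟨?_, ?_⟩⟩
    · intro g' hg' r' v' hfl
      by_cases heq : I.addr g' r' v' = I.addr g r v
      · obtain ⟨rfl, rfl, rfl⟩ := I.addr_inj.1 heq
        obtain ⟨⟨p, hp⟩, hsum⟩ := hs g' hg' r' u hu
        refine ⟨⟨.cons hadj p, fun w hw hne => ?_⟩, ?_⟩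
        · rw [hmark]
          split_ifs with hwu
          · exact le_rfl
          · rw [SimpleGraph.Walk.support_cons, List.mem_cons] at hw
            exact hp w (hw.resolve_left hne) hwu
        · rw [hdist, if_pos rfl, hD]
          simp only [hmark]
          have hextra : ∀ w, 0 ≤ I.extra g' w := fun w => hI.extra_nonneg w hg'
          calc _ ≤ ∑ w : Fin I.n, ((if 1 ≤ m.nat 8 (I.addr g' r' u * I.n + w)
                then I.extra g' w else 0) + if w = u then I.extra g' u else 0) := by
                refine Finset.sum_le_sum fun w _ => ?_
                by_cases hwu : w = u
                · subst hwu
                  have := hextra w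
                  simp only [if_true, le_refl]
                  split_ifs <;> linarith
                · simp [hwu]
            _ ≤ _ := by
                rw [Finset.sum_add_distrib, Finset.sum_ite_eq' Finset.univ u]
                simpa using hsum
      · rw [hflag, if_neg heq] at hfl
        rw [hdist, if_neg heq]
        simp only [hmark' _ heq]
        exact hs g' hg' r' v' hfl
    · intro g' r' v' hfl
      rw [hflag, hdist]
      split_ifs with heq
      · rw [heq] at hfl ⊢
        exact ⟨le_rfl, hvD hfl⟩
      · exact ⟨hfl, le_rfl⟩
    · rw [hflag, if_pos rfl]
    · rw [hdist, if_pos rfl, hD]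
      have := hx.2
      linarith
  · rw [hcond] at hc
    refine ⟨hs, .refl m, fun hadj x hx => ?_⟩
    have h5 : I.Within m g r v (m.num 2 (I.addr g r u) + I.extra g u) := by
      by_contra h
      exact hc ⟨hadj, hx.1, h⟩
    exact ⟨h5.1, h5.2.trans (by have := hx.2; linarith)⟩

end Distances

/-! ### Correctness of the shortest-path computation. -/

section ShortestPaths

variable {K : Type} [Field K] [LinearOrder K] [IsStrictOrderedRing K] {I : Instance K} {m : Mem K}

theorem run_vertices (hm : I.Intact m) {d : ℕ} {p : Stmt} {env : ℕ → ℕ} (J : Mem K → Prop)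
    (le : Mem K → Mem K → Prop) (Ψ : Fin I.n → Mem K → Prop)
    (hrefl : ∀ m, le m m) (htrans : ∀ m₁ m₂ m₃, le m₁ m₂ → le m₂ m₃ → le m₁ m₃)
    (hΨ : ∀ k m₁ m₂, le m₁ m₂ → Ψ k m₁ → Ψ k m₂) (h0 : J m)
    (hs : ∀ (k : Fin I.n) (m' : Mem K), J m' → J (p.run (Function.update env d k) m') ∧
      le m' (p.run (Function.update env d k) m') ∧ Ψ k (p.run (Function.update env d k) m')) :
    J ((Stmt.for_ d true p).run env m) ∧ le m ((Stmt.for_ d true p).run env m) ∧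
      ∀ k, Ψ k ((Stmt.for_ d true p).run env m) := by
  obtain ⟨h1, h2, h3⟩ := run_for (d := d) (p := p) (env := env) hm.dim_true J le
    (fun k m' => ∀ h : k < I.n, Ψ ⟨k, h⟩ m') hrefl htrans
    (fun k m₁ m₂ h12 h hk => hΨ _ _ _ h12 (h hk)) h0 fun k hk m' hJ => by
      obtain ⟨h4, h5, h6⟩ := hs ⟨k, hk⟩ m' hJ
      exact ⟨h4, h5, fun _ => h6⟩
  exact ⟨h1, h2, fun k => h3 k k.2 k.2⟩

/-- The reduced cost of the vertices of a walk, without its start. -/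
def Instance.walkCost (I : Instance K) (g : ℕ) {v r : Fin I.n} (p : I.G.Walk v r) : K :=
  (p.support.tail.map (I.extra g)).sum

/-- The distances are at most the costs of the walks with at most `k` edges. -/
def Instance.Complete (I : Instance K) (k : ℕ) (m : Mem K) : Prop :=
  ∀ g ≤ I.ℓ, ∀ r v, ∀ p : I.G.Walk v r, p.length ≤ k → I.Within m g r v (I.walkCost g p)

theorem Instance.Complete.mono {k : ℕ} {m m' : Mem K} (h : I.Complete k m) (hle : I.DistLe m m') :
    I.Complete k m' := fun g hg r v p hp => (h g hg r v p hp).mono hle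

/-- What holds during the computation of the distances. -/
structure Instance.Paths (I : Instance K) (k : ℕ) (m : Mem K) : Prop where
  intact : I.Intact m
  tabulated : I.Tabulated m
  sound : I.Sound m
  complete : I.Complete k m

/-- A walk with at most `k + 1` edges is trivial or an edge from `v` to `u` followed by a walk with
at most `k` edges. The bound for the latter holds throughout the round, so it is available when the
pair `v`, `u` is relaxed. -/
theorem run_round (hI : I.Valid) {k : ℕ} (hm : I.Paths k m) (env : ℕ → ℕ) :
    I.Paths (k + 1)
      ((Stmt.for_ 1 false (.for_ 2 true (.for_ 3 true (.for_ 4 true relax)))).run env m) := by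
  have key := run_for (d := 1) (p := .for_ 2 true (.for_ 3 true (.for_ 4 true relax))) (env := env)
    hm.intact.dim_false (I.Paths k) I.DistLe
    (fun g m' => g < I.ℓ + 1 → ∀ r v u, I.G.Adj v u → ∀ p : I.G.Walk u r, p.length ≤ k →
      I.Within m' g r v (I.walkCost g p + I.extra g u))
    .refl (fun _ _ _ => .trans)
    (fun g m₁ m₂ h12 h hg r v u ha p hp => (h hg r v u ha p hp).mono h12) hm ?_
  · obtain ⟨h1, -, h3⟩ := key
    refine ⟨h1.intact, h1.tabulated, h1.sound, fun g hg r v p hp => ?_⟩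
    cases p with
    | nil => exact h1.complete g hg _ _ .nil (Nat.zero_le _)
    | @cons _ u _ ha q =>
      rw [SimpleGraph.Walk.length_cons] at hp
      have h4 := h3 g (by omega) (by omega) r v u ha q (by omega)
      have h5 : I.walkCost g (SimpleGraph.Walk.cons ha q) = I.walkCost g q + I.extra g u := by
        rw [Instance.walkCost, SimpleGraph.Walk.support_cons, List.tail_cons,
          ← SimpleGraph.Walk.cons_tail_support q, List.map_cons, List.sum_cons, add_comm]
        rfl
      rwa [h5]
  · intro g hg m₁ hm₁
    have hg' : g ≤ I.ℓ := by omega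
    refine (run_vertices hm₁.intact (I.Paths k) I.DistLe
      (fun r m' => ∀ v u, I.G.Adj v u → ∀ p : I.G.Walk u r, p.length ≤ k →
        I.Within m' g r v (I.walkCost g p + I.extra g u)) .refl (fun _ _ _ => .trans)
      (fun r m₁ m₂ h12 h v u ha p hp => (h v u ha p hp).mono h12) hm₁
      fun r m₂ hm₂ => ?_).imp_right (And.imp_right fun h _ => h)
    refine run_vertices hm₂.intact (I.Paths k) I.DistLe
      (fun v m' => ∀ u, I.G.Adj v u → ∀ p : I.G.Walk u r, p.length ≤ k →
        I.Within m' g r v (I.walkCost g p + I.extra g u)) .refl (fun _ _ _ => .trans)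
      (fun v m₁ m₂ h12 h u ha p hp => (h u ha p hp).mono h12) hm₂ fun v m₃ hm₃ => ?_
    refine run_vertices hm₃.intact (I.Paths k) I.DistLe
      (fun u m' => I.G.Adj v u → ∀ p : I.G.Walk u r, p.length ≤ k →
        I.Within m' g r v (I.walkCost g p + I.extra g u)) .refl (fun _ _ _ => .trans)
      (fun u m₁ m₂ h12 h ha p hp => (h ha p hp).mono h12) hm₃ fun u m₄ hm₄ => ?_
    obtain ⟨h1, h2, h3⟩ := run_relax hI hm₄.intact hm₄.tabulated hm₄.sound
      (env := Function.update (Function.update (Function.update (Function.update env 1 g) 2 r) 3 v)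
        4 u) (g := g) (r := r) (v := v) (u := u) hg' (by simp) (by simp) (by simp) (by simp)
    refine ⟨⟨hm₄.intact.run rfl _, fun g' hg' w => ?_, h1, hm₄.complete.mono h2⟩, h2,
      fun ha p hp => h3 ha _ (hm₄.complete g hg' r u p hp)⟩
    rw [Stmt.run_num rfl]
    exact hm₄.tabulated g' hg' w

/-- The costs of the shortest paths, and the vertices on them. -/
structure Instance.Solved (I : Instance K) (d : ℕ → Fin I.n → Fin I.n → K)
    (S : ℕ → Fin I.n → Fin I.n → Finset (Fin I.n)) : Prop where
  isDist : I.IsDist d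
  walk : ∀ g ≤ I.ℓ, ∀ r v, ∃ p : I.G.Walk v r, ∀ w ∈ p.support, w ≠ v → w ∈ S g r v
  sum_le : ∀ g ≤ I.ℓ, ∀ r v, ∑ w ∈ S g r v, I.extra g w ≤ d g r v

/-- `n` rounds suffice because a walk can be shortened to a path, which has fewer than `n` edges.
The vertices of a path are distinct, so its cost is a sum over a subset of `U`; connectedness makes
all distances known. -/
theorem run_shortestPaths (hI : I.Valid) (hm : I.Paths 0 m) (env : ℕ → ℕ) :
    I.Intact (shortestPaths.run env m) ∧ I.Tabulated (shortestPaths.run env m) ∧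
    I.Solved (fun g r v => (shortestPaths.run env m).num 2 (I.addr g r v))
      (fun g r v => Finset.univ.filter fun w =>
        1 ≤ (shortestPaths.run env m).nat 8 (I.addr g r v * I.n + w)) := by
  have key := run_for_inv (d := 0) (env := env) hm.intact.dim_true I.Paths hm
    (fun k _ m' hm' => run_round hI hm' (Function.update env 0 k))
  have hknown : ∀ g ≤ I.ℓ, ∀ r v, 1 ≤ (shortestPaths.run env m).nat 7 (I.addr g r v) := by
    intro g hg r v
    obtain ⟨p, hp⟩ := (hI.connected.preconnected v r).exists_isPath
    refine (key.complete g hg r v p ?_).1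
    have := hp.length_lt
    rw [Fintype.card_fin] at this
    omega
  refine ⟨key.intact, key.tabulated, ⟨fun g hg r v => ?_, fun g hg r v p U hU => ?_⟩,
    fun g hg r v => ?_, fun g hg r v => ?_⟩
  · refine le_trans (Finset.sum_nonneg fun w _ => ?_) (key.sound g hg r v (hknown g hg r v)).2
    split_ifs
    · exact hI.extra_nonneg w hg
    · exact le_rfl
  · classical
    have hb := p.bypass_isPath
    have hlen := hb.length_lt
    rw [Fintype.card_fin] at hlen
    have h1 := (key.complete g hg r v p.bypass (by omega)).2
    refine h1.trans ?_
    have hnd := hb.support_nodup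
    rw [← SimpleGraph.Walk.cons_tail_support, List.nodup_cons] at hnd
    rw [Instance.walkCost, ← List.sum_toFinset _ hnd.2]
    refine Finset.sum_le_sum_of_subset_of_nonneg (fun w hw => ?_) fun w _ _ => hI.extra_nonneg w hg
    rw [List.mem_toFinset] at hw
    refine hU w (p.support_bypass_subset_support (List.mem_of_mem_tail hw)) ?_
    rintro rfl
    exact hnd.1 hw
  · obtain ⟨p, hp⟩ := (key.sound g hg r v (hknown g hg r v)).1
    exact ⟨p, fun w hw hne => Finset.mem_filter.2 ⟨Finset.mem_univ _, hp w hw hne⟩⟩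
  · rw [Finset.sum_filter]
    exact (key.sound g hg r v (hknown g hg r v)).2

end ShortestPaths

/-! ## The search for the best spider -/

/-- The vertex `r` is one of the terminals of the spider. -/
def legTest (v r₁ g r₃ r : NatExp) : Test :=
  .conj (.natLe (.const 1) (.cell 6 r)) (.conj (.neg (eqTest r r₁))
    (.conj (.natLe (.cell 2 r) g)
      (.numLe (.cell 2 (entry (entry (.cell 2 r) r) v))
        (.cell 2 (entry (entry (.cell 2 r₃) r₃) v)))))

/-- Compute the cost of the spider given by the loop variables, and its number of legs. -/
def evalSpider : Stmt :=
  .seq (.setNum 3 (.const 0) (.add (.cell 2 (entry (entry (var 3) (var 2)) (var 1)))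
      (.cell 1 (entry (var 3) (var 1)))))
    (.seq (.setNat 11 (.const 0) (.const 0))
      (.for_ 5 true (.ite (legTest (var 1) (var 2) (var 3) (var 4) (var 5))
        (.seq (.setNum 3 (.const 0) (.add (.cell 3 (.const 0))
            (.cell 2 (entry (entry (.cell 2 (var 5)) (var 5)) (var 1)))))
          (.setNat 11 (.const 0) (.add (.cell 11 (.const 0)) (.const 1))))
        .skip)))

/-- The loop variables describe a spider. -/
def spiderTest : Test :=
  .conj (.natLe (.const 1) (.cell 6 (var 2))) (.conj (.natLe (.const 1) (.cell 6 (var 4)))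
    (.conj (.neg (eqTest (var 4) (var 2))) (.conj (.natLe (.cell 2 (var 4)) (var 3))
      (.natLe (var 3) (.cell 2 (var 2))))))

/-- Store the spider given by the loop variables as the best one. -/
def storeSpider : Stmt :=
  .seq (.setNat 10 (.const 0) (.const 1)) (.seq (.setNat 10 (.const 1) (var 1))
    (.seq (.setNat 10 (.const 2) (var 2)) (.seq (.setNat 10 (.const 3) (var 3))
      (.seq (.setNat 10 (.const 4) (var 4)) (.seq (.setNat 10 (.const 5) (.cell 11 (.const 0)))
        (.setNum 3 (.const 1) (.cell 3 (.const 0))))))))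

/-- Compare the spider given by the loop variables with the best one. -/
def trySpider : Stmt :=
  .seq evalSpider (.ite (.conj spiderTest (.neg (.conj (.natLe (.const 1) (.cell 10 (.const 0)))
      (.numLe (.smul (.cell 11 (.const 0)) (.cell 3 (.const 1)))
        (.smul (.cell 10 (.const 5)) (.cell 3 (.const 0)))))))
    storeSpider .skip)

/-- Find a spider of minimum cost per leg. -/
def search : Stmt :=
  .seq (.setNat 10 (.const 0) (.const 0))
    (.for_ 1 true (.for_ 2 true (.for_ 3 false (.for_ 4 true trySpider))))

section Search

variable {K : Type} [Field K] [LinearOrder K] [IsStrictOrderedRing K] {I : Instance K}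
  {A : Finset (Fin I.n)} {d : ℕ → Fin I.n → Fin I.n → K}
  {S : ℕ → Fin I.n → Fin I.n → Finset (Fin I.n)} {m : Mem K}

/-- The contents of the memory: the input, the reduced costs, the active terminals `A`, the
distances `d` and the marked vertices `S`. -/
structure Instance.View (I : Instance K) (A : Finset (Fin I.n)) (d : ℕ → Fin I.n → Fin I.n → K)
    (S : ℕ → Fin I.n → Fin I.n → Finset (Fin I.n)) (m : Mem K) : Prop where
  intact : I.Intact m
  tabulated : I.Tabulated m
  active : ∀ v : Fin I.n, 1 ≤ m.nat 6 v ↔ v ∈ A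
  dist : ∀ g r v, m.num 2 (I.addr g r v) = d g r v
  mark : ∀ g r v (w : Fin I.n), 1 ≤ m.nat 8 (I.addr g r v * I.n + w) ↔ w ∈ S g r v

theorem Instance.View.run (h : I.View A d S m) {s : Stmt}
    (hs : ((s.keepsNat 0 && s.keepsNat 1 && s.keepsNat 2 && s.keepsNum 0) &&
      (s.keepsNum 1 && s.keepsNat 6 && s.keepsNum 2 && s.keepsNat 8)) = true) (env : ℕ → ℕ) :
    I.View A d S (s.run env m) := by
  rw [Bool.and_eq_true] at hs
  obtain ⟨h1, h2⟩ := hs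
  simp only [Bool.and_eq_true] at h2
  refine ⟨h.intact.run h1 env, ?_, ?_, ?_, ?_⟩
  · rw [Instance.Tabulated, Stmt.run_num h2.1.1.1]; exact h.tabulated
  · rw [Stmt.run_nat h2.1.1.2]; exact h.active
  · rw [Stmt.run_num h2.1.2]; exact h.dist
  · rw [Stmt.run_nat h2.2]; exact h.mark

theorem Instance.View.dist_entry (h : I.View A d S m) {env : ℕ → ℕ} {eg er ev : NatExp} {g : ℕ}
    {r v : Fin I.n} (hg : eg.eval (scope env m) = g) (hr : er.eval (scope env m) = r)
    (hv : ev.eval (scope env m) = v) :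
    m.num 2 ((entry (entry eg er) ev).eval (scope env m)) = d g r v := by
  rw [h.intact.eval_entry, h.intact.eval_entry, hg, hr, hv]
  exact h.dist g r v

theorem Instance.View.need_cell (h : I.View A d S m) {env : ℕ → ℕ} {ev : NatExp} {v : Fin I.n}
    (hv : ev.eval (scope env m) = v) : (NatExp.cell 2 ev).eval (scope env m) = I.need v := by
  rw [NatExp.eval, hv, scope_nat_of_ne (by norm_num), h.intact.need_eq]

theorem Instance.View.active_cell (h : I.View A d S m) {env : ℕ → ℕ} {ev : NatExp} {v : Fin I.n}
    (hv : ev.eval (scope env m) = v) :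
    (NatExp.const 1).eval (scope env m) ≤ (NatExp.cell 6 ev).eval (scope env m) ↔ v ∈ A := by
  rw [NatExp.eval, NatExp.eval, hv, scope_nat_of_ne (by norm_num), h.active]

theorem holds_eqTest {env : ℕ → ℕ} {e f : NatExp} {u v : Fin I.n}
    (he : e.eval (scope env m) = u) (hf : f.eval (scope env m) = v) :
    (eqTest e f).Holds (scope env m) ↔ u = v := by
  simp only [eqTest, Test.Holds, he, hf, ← le_antisymm_iff, Fin.val_inj]

theorem Instance.View.holds_legTest (h : I.View A d S m) {env : ℕ → ℕ} {ev er₁ eg er₃ er : NatExp}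
    {g : ℕ} {v r₁ r₃ r : Fin I.n} (hv : ev.eval (scope env m) = v)
    (hr₁ : er₁.eval (scope env m) = r₁) (hg : eg.eval (scope env m) = g)
    (hr₃ : er₃.eval (scope env m) = r₃) (hr : er.eval (scope env m) = r) :
    (legTest ev er₁ eg er₃ er).Holds (scope env m) ↔ r ∈ I.legs A d v r₁ g r₃ := by
  simp only [legTest, Test.Holds, holds_eqTest hr hr₁, Instance.legs, Finset.mem_filter,
    h.active_cell hr, h.need_cell hr, hg, NumExp.eval, scope_num,
    h.dist_entry (h.need_cell hr) hr hv, h.dist_entry (h.need_cell hr₃) hr₃ hv, ne_eq]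

theorem run_evalSpider (h : I.View A d S m) {env : ℕ → ℕ} {v r₁ r₃ : Fin I.n} {g : ℕ}
    (hg : g ≤ I.ℓ) (h1 : env 1 = v) (h2 : env 2 = r₁) (h3 : env 3 = g) (h4 : env 4 = r₃) :
    (evalSpider.run env m).num 3 0 = I.spiderCost A d v r₁ g r₃ ∧
      (evalSpider.run env m).num 3 1 = m.num 3 1 ∧
      (evalSpider.run env m).nat 11 0 = (I.legs A d v r₁ g r₃).card := by
  classical
  set m₁ := (Stmt.setNum 3 (.const 0) (.add (.cell 2 (entry (entry (var 3) (var 2)) (var 1)))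
      (.cell 1 (entry (var 3) (var 1))))).run env m with hm₁
  set m₂ := (Stmt.setNat 11 (.const 0) (.const 0)).run env m₁ with hm₂
  have v₁ : m₁ = m.writeNum 3 0 (d g r₁ v + I.extra g v) := by
    have hd := h.dist g r₁ v
    rw [Instance.addr] at hd
    simp only [hm₁, Stmt.run, NumExp.eval, NatExp.eval, scope_num, h.intact.eval_entry, eval_var,
      h3, h2, h1, hd, h.tabulated g hg v]
  have i₂ : I.View A d S m₂ := (h.run rfl _).run rfl _
  have v₂ : m₂ = m₁.writeNat 11 0 0 := by simp only [hm₂, Stmt.run, NatExp.eval]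
  have key := run_for_inv (d := 5) (env := env)
    (p := .ite (legTest (var 1) (var 2) (var 3) (var 4) (var 5))
        (.seq (.setNum 3 (.const 0) (.add (.cell 3 (.const 0))
            (.cell 2 (entry (entry (.cell 2 (var 5)) (var 5)) (var 1)))))
          (.setNat 11 (.const 0) (.add (.cell 11 (.const 0)) (.const 1))))
        .skip) i₂.intact.dim_true
    (fun k m' => I.View A d S m' ∧ m'.num 3 0 = d g r₁ v + I.extra g v +
        ∑ r ∈ (I.legs A d v r₁ g r₃).filter (fun r : Fin I.n => (r : ℕ) < k), d (I.need r) r v ∧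
      m'.num 3 1 = m.num 3 1 ∧
      m'.nat 11 0 = ((I.legs A d v r₁ g r₃).filter (fun r : Fin I.n => (r : ℕ) < k)).card)
    ⟨i₂, by simp [v₂, v₁], by simp [v₂, v₁], by simp [v₂]⟩ ?_
  · obtain ⟨-, k1, k2, k3⟩ := key
    rw [Finset.filter_true_of_mem (fun r _ => r.2)] at k1 k3
    exact ⟨k1, k2, k3⟩
  · rintro k hk m' ⟨c1, c2, c3, c4⟩
    obtain ⟨r, rfl⟩ : ∃ r : Fin I.n, k = r := ⟨⟨k, hk⟩, rfl⟩
    set env' := Function.update env 5 (r : ℕ) with henv'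
    have e1 : (var 1).eval (scope env' m') = v := by simpa [henv'] using h1
    have e2 : (var 2).eval (scope env' m') = r₁ := by simpa [henv'] using h2
    have e3 : (var 3).eval (scope env' m') = g := by simpa [henv'] using h3
    have e4 : (var 4).eval (scope env' m') = r₃ := by simpa [henv'] using h4
    have e5 : (var 5).eval (scope env' m') = r := by simp [henv']
    refine ⟨c1.run rfl _, ?_⟩
    simp only [Stmt.run, c1.holds_legTest e1 e2 e3 e4 e5, NumExp.eval, scope_num,
      c1.dist_entry (c1.need_cell e5) e5 e1, NatExp.eval, ne_eq, Nat.reduceEqDiff,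
      not_false_eq_true, scope_nat_of_ne, writeNum_nat, c2, c4]
    have hsplit : r ∉ (I.legs A d v r₁ g r₃).filter (fun r' : Fin I.n => (r' : ℕ) < r) := by simp
    split_ifs with hr
    · have hins : (I.legs A d v r₁ g r₃).filter (fun r' : Fin I.n => (r' : ℕ) < r + 1) =
          insert r ((I.legs A d v r₁ g r₃).filter (fun r' : Fin I.n => (r' : ℕ) < r)) := by
        ext r'
        simp only [Finset.mem_filter, Finset.mem_insert, Nat.lt_succ_iff_lt_or_eq, Fin.val_inj]
        constructor
        · rintro ⟨h5, h6 | h6⟩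
          · exact Or.inr ⟨h5, h6⟩
          · exact Or.inl h6
        · rintro (rfl | h5)
          · exact ⟨hr, Or.inr rfl⟩
          · exact ⟨h5.1, Or.inl h5.2⟩
      rw [hins, Finset.sum_insert hsplit, Finset.card_insert_of_notMem hsplit]
      refine ⟨?_, ?_, ?_⟩
      · simp only [writeNat_num, writeNum_num_self, Function.update_self]; ring
      · simpa using c3
      · simp
    · have hins : (I.legs A d v r₁ g r₃).filter (fun r' : Fin I.n => (r' : ℕ) < r + 1) =
          (I.legs A d v r₁ g r₃).filter (fun r' : Fin I.n => (r' : ℕ) < r) := by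
        refine Finset.filter_congr fun r' hr' => ?_
        have : (r' : ℕ) ≠ r := fun h5 => hr (Fin.ext h5 ▸ hr')
        omega
      rw [hins]
      exact ⟨c2, c3, c4⟩

/-- A stored spider. -/
structure Instance.Best (I : Instance K) (A : Finset (Fin I.n)) (d : ℕ → Fin I.n → Fin I.n → K)
    (m : Mem K) (v r₁ : Fin I.n) (g : ℕ) (r₃ : Fin I.n) : Prop where
  isSpider : I.IsSpider A r₁ g r₃
  center : m.nat 10 1 = v
  top : m.nat 10 2 = r₁
  grade : m.nat 10 3 = g
  last : m.nat 10 4 = r₃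
  card : m.nat 10 5 = (I.legs A d v r₁ g r₃).card
  cost : m.num 3 1 = I.spiderCost A d v r₁ g r₃

/-- The memory during the search. -/
structure Instance.Searching (I : Instance K) (A : Finset (Fin I.n))
    (d : ℕ → Fin I.n → Fin I.n → K) (S : ℕ → Fin I.n → Fin I.n → Finset (Fin I.n)) (m : Mem K) :
    Prop where
  view : I.View A d S m
  best : 1 ≤ m.nat 10 0 → ∃ v r₁ g r₃, I.Best A d m v r₁ g r₃

/-- The stored spider is at least as good as the given one. -/
def Instance.Beats (I : Instance K) (A : Finset (Fin I.n)) (d : ℕ → Fin I.n → Fin I.n → K)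
    (v r₁ : Fin I.n) (g : ℕ) (r₃ : Fin I.n) (m : Mem K) : Prop :=
  I.IsSpider A r₁ g r₃ → 1 ≤ m.nat 10 0 ∧
    m.num 3 1 * (I.legs A d v r₁ g r₃).card ≤ I.spiderCost A d v r₁ g r₃ * m.nat 10 5

/-- The stored spider has improved. -/
def Instance.BestLe (I : Instance K) (A : Finset (Fin I.n)) (d : ℕ → Fin I.n → Fin I.n → K)
    (m m' : Mem K) : Prop :=
  ∀ v r₁ g r₃, I.Beats A d v r₁ g r₃ m → I.Beats A d v r₁ g r₃ m'

/-- Costs per leg are compared after cross-multiplication, which multiplies elements of `K` by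
natural numbers only. When the stored spider is replaced, transitivity of the comparison uses that
the old one had at least one leg. -/
theorem run_trySpider (h : I.Searching A d S m) {env : ℕ → ℕ} {v r₁ r₃ : Fin I.n} {g : ℕ}
    (hg : g ≤ I.ℓ) (h1 : env 1 = v) (h2 : env 2 = r₁) (h3 : env 3 = g) (h4 : env 4 = r₃) :
    I.Searching A d S (trySpider.run env m) ∧ I.BestLe A d m (trySpider.run env m) ∧
      I.Beats A d v r₁ g r₃ (trySpider.run env m) := by
  obtain ⟨c1, c2, c3⟩ := run_evalSpider h.view hg h1 h2 h3 h4
  set m₁ := evalSpider.run env m with hm₁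
  have i₁ : I.View A d S m₁ := h.view.run rfl _
  have f10 : m₁.nat 10 = m.nat 10 := Stmt.run_nat rfl _ _
  have e1 : (var 1).eval (scope env m₁) = v := by simpa using h1
  have e2 : (var 2).eval (scope env m₁) = r₁ := by simpa using h2
  have e3 : (var 3).eval (scope env m₁) = g := by simpa using h3
  have e4 : (var 4).eval (scope env m₁) = r₃ := by simpa using h4
  have hB : ∀ v r₁ g r₃, I.Beats A d v r₁ g r₃ m₁ ↔ I.Beats A d v r₁ g r₃ m := by
    intro v r₁ g r₃
    rw [Instance.Beats, Instance.Beats, c2, f10]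
  have hsp : (spiderTest).Holds (scope env m₁) ↔ I.IsSpider A r₁ g r₃ := by
    simp only [spiderTest, Test.Holds, holds_eqTest e4 e2, i₁.active_cell e2, i₁.active_cell e4,
      i₁.need_cell e2, i₁.need_cell e4, e3, Instance.IsSpider, ne_eq]
  have hbt : (Test.conj (.natLe (.const 1) (.cell 10 (.const 0)))
      (.numLe (.smul (.cell 11 (.const 0)) (.cell 3 (.const 1)))
        (.smul (.cell 10 (.const 5)) (.cell 3 (.const 0))))).Holds (scope env m₁) ↔
      1 ≤ m.nat 10 0 ∧ m.num 3 1 * (I.legs A d v r₁ g r₃).card ≤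
        I.spiderCost A d v r₁ g r₃ * m.nat 10 5 := by
    simp only [Test.Holds, NatExp.eval, NumExp.eval, ne_eq, Nat.reduceEqDiff, not_false_eq_true,
      scope_nat_of_ne, scope_num, c1, c2, c3, f10, nsmul_eq_mul, mul_comm]
  have hrun : trySpider.run env m = (Stmt.ite (.conj spiderTest (.neg (.conj
      (.natLe (.const 1) (.cell 10 (.const 0)))
      (.numLe (.smul (.cell 11 (.const 0)) (.cell 3 (.const 1)))
        (.smul (.cell 10 (.const 5)) (.cell 3 (.const 0))))))) storeSpider .skip).run env m₁ := rfl
  rw [hrun, Stmt.run]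
  have hcond : (Test.conj spiderTest (.neg (.conj (.natLe (.const 1) (.cell 10 (.const 0)))
      (.numLe (.smul (.cell 11 (.const 0)) (.cell 3 (.const 1)))
        (.smul (.cell 10 (.const 5)) (.cell 3 (.const 0))))))).Holds (scope env m₁) ↔
      I.IsSpider A r₁ g r₃ ∧ ¬ I.Beats A d v r₁ g r₃ m := by
    rw [Test.Holds, Test.Holds, hsp, hbt, Instance.Beats]
    tauto
  split_ifs with hc
  · rw [hcond] at hc
    obtain ⟨hs, hb⟩ := hc
    set m₂ := storeSpider.run env m₁ with hm₂
    have i₂ : I.View A d S m₂ := i₁.run rfl _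
    have g0 : m₂.nat 10 0 = 1 := by simp [hm₂, storeSpider, Stmt.run, NatExp.eval]
    have g1 : m₂.nat 10 1 = v := by simp [hm₂, storeSpider, Stmt.run, NatExp.eval, h1]
    have g2 : m₂.nat 10 2 = r₁ := by simp [hm₂, storeSpider, Stmt.run, NatExp.eval, h2]
    have g3 : m₂.nat 10 3 = g := by simp [hm₂, storeSpider, Stmt.run, NatExp.eval, h3]
    have g4 : m₂.nat 10 4 = r₃ := by simp [hm₂, storeSpider, Stmt.run, NatExp.eval, h4]
    have g5 : m₂.nat 10 5 = (I.legs A d v r₁ g r₃).card := by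
      simp [hm₂, storeSpider, Stmt.run, NatExp.eval, c3]
    have g6 : m₂.num 3 1 = I.spiderCost A d v r₁ g r₃ := by
      simp [hm₂, storeSpider, Stmt.run, NatExp.eval, NumExp.eval, c1]
    refine ⟨⟨i₂, fun _ => ⟨v, r₁, g, r₃, hs, g1, g2, g3, g4, g5, g6⟩⟩, ?_, fun _ => ?_⟩
    · intro v' r₁' g' r₃' hle hs'
      obtain ⟨hf, hle⟩ := hle hs'
      refine ⟨by omega, ?_⟩
      obtain ⟨v₀, s₁, g₀, s₃, hbest⟩ := h.best hf
      have hlt : I.spiderCost A d v r₁ g r₃ * m.nat 10 5 <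
          m.num 3 1 * (I.legs A d v r₁ g r₃).card := by
        by_contra hcon
        exact hb fun _ => ⟨hf, not_lt.1 hcon⟩
      have hp : (0 : K) < m.nat 10 5 := by
        rw [hbest.card]
        exact_mod_cast Finset.card_pos.2 ⟨s₃, hbest.isSpider.mem_legs⟩
      rw [g5, g6]
      set x := I.spiderCost A d v r₁ g r₃
      set c := ((I.legs A d v r₁ g r₃).card : K)
      set x' := I.spiderCost A d v' r₁' g' r₃'
      set c' := ((I.legs A d v' r₁' g' r₃').card : K)
      have hc0 : (0 : K) ≤ c := Nat.cast_nonneg _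
      have hc0' : (0 : K) ≤ c' := Nat.cast_nonneg _
      refine le_of_mul_le_mul_right ?_ hp
      calc x * c' * m.nat 10 5 = (x * m.nat 10 5) * c' := by ring
        _ ≤ (m.num 3 1 * c) * c' := mul_le_mul_of_nonneg_right hlt.le hc0'
        _ = (m.num 3 1 * c') * c := by ring
        _ ≤ (x' * m.nat 10 5) * c := mul_le_mul_of_nonneg_right hle hc0
        _ = x' * c * m.nat 10 5 := by ring
    · rw [g5, g6, g0]
      exact ⟨le_rfl, le_rfl⟩
  · rw [hcond] at hc
    rw [Stmt.run]
    refine ⟨⟨i₁, fun hf => ?_⟩, fun v r₁ g r₃ => (hB v r₁ g r₃).2, fun hs => ?_⟩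
    · rw [f10] at hf
      obtain ⟨v₀, s₁, g₀, s₃, hbest⟩ := h.best hf
      exact ⟨v₀, s₁, g₀, s₃, hbest.isSpider, by rw [f10, hbest.center], by rw [f10, hbest.top],
        by rw [f10, hbest.grade], by rw [f10, hbest.last], by rw [f10, hbest.card],
        by rw [c2, hbest.cost]⟩
    · refine (hB _ _ _ _).2 ?_ hs
      by_contra hcon
      exact hc ⟨hs, hcon⟩

/-- Once beaten, a spider stays beaten, so the claim passes through the four loops. The loop over
`g` misses nothing, because a spider has `g ≤ need r₁ ≤ ℓ`. -/
theorem run_search (hI : I.Valid) (h : I.View A d S m) (env : ℕ → ℕ) :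
    I.Searching A d S (search.run env m) ∧
      ∀ v r₁ g r₃, I.Beats A d v r₁ g r₃ (search.run env m) := by
  set m₀ := (Stmt.setNat 10 (.const 0) (.const 0)).run env m with hm₀
  have i₀ : I.Searching A d S m₀ :=
    ⟨h.run rfl _, fun hf => absurd hf (by simp [hm₀, Stmt.run, NatExp.eval])⟩
  have hrefl : ∀ m, I.BestLe A d m m := fun _ _ _ _ _ h => h
  have htrans : ∀ m₁ m₂ m₃, I.BestLe A d m₁ m₂ → I.BestLe A d m₂ m₃ → I.BestLe A d m₁ m₃ :=
    fun _ _ _ h12 h23 v r₁ g r₃ h => h23 _ _ _ _ (h12 _ _ _ _ h)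
  obtain ⟨k1, -, k3⟩ := run_vertices (d := 1) (env := env)
    (p := .for_ 2 true (.for_ 3 false (.for_ 4 true trySpider)))
    i₀.view.intact (I.Searching A d S) (I.BestLe A d)
    (fun v m' => ∀ r₁, ∀ g < I.ℓ + 1, ∀ r₃, I.Beats A d v r₁ g r₃ m') hrefl htrans
    (fun v m₁ m₂ h12 h r₁ g hg r₃ => h12 _ _ _ _ (h r₁ g hg r₃)) i₀ fun v m₁ hm₁ => by
      refine run_vertices hm₁.view.intact (I.Searching A d S) (I.BestLe A d)
        (fun r₁ m' => ∀ g < I.ℓ + 1, ∀ r₃, I.Beats A d v r₁ g r₃ m') hrefl htrans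
        (fun r₁ m₁ m₂ h12 h g hg r₃ => h12 _ _ _ _ (h g hg r₃)) hm₁ fun r₁ m₂ hm₂ => ?_
      refine (run_for hm₂.view.intact.dim_false (I.Searching A d S) (I.BestLe A d)
        (fun g m' => g < I.ℓ + 1 → ∀ r₃, I.Beats A d v r₁ g r₃ m') hrefl htrans
        (fun g m₁ m₂ h12 h hg r₃ => h12 _ _ _ _ (h hg r₃)) hm₂ fun g hg m₃ hm₃ => ?_).imp_right
        (And.imp_right fun h g hg => h g hg hg)
      refine (run_vertices hm₃.view.intact (I.Searching A d S) (I.BestLe A d)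
        (fun r₃ m' => I.Beats A d v r₁ g r₃ m') hrefl htrans
        (fun r₃ m₁ m₂ h12 h => h12 _ _ _ _ h) hm₃ fun r₃ m₄ hm₄ => ?_).imp_right
        (And.imp_right fun h _ => h)
      exact run_trySpider hm₄ (by omega) (by simp) (by simp) (by simp) (by simp)
  refine ⟨k1, fun v r₁ g r₃ hs => ?_⟩
  have hg : g < I.ℓ + 1 := by
    have h1 := hs.2.2.2.2
    have h2 := hI.need_le r₁
    omega
  exact k3 v r₁ g hg r₃ hs

end Search

/-! ## Connecting the terminals of a spider -/

/-- Raise the grades of the vertices that are marked in a row to at least `g`. -/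
def raiseRow (l : ℕ) (row g : NatExp) : Stmt :=
  .for_ l true (.ite (.conj (.natLe (.const 1) (.cell 8 (entry row (var l))))
    (.neg (.natLe g (.cell 5 (var l))))) (.setNat 5 (var l) g) .skip)

/-- Component `i` of the stored spider. -/
def stored (i : ℕ) : NatExp := .cell 10 (.const i)

/-- Raise the grades along the legs of the stored spider and deactivate its terminals, except for
the one of highest grade. -/
def connectSpider : Stmt :=
  .seq (raiseRow 1 (entry (entry (stored 3) (stored 2)) (stored 1)) (stored 3))
    (.seq (.ite (.neg (.natLe (stored 3) (.cell 5 (stored 1)))) (.setNat 5 (stored 1) (stored 3))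
        .skip)
      (.for_ 1 true (.ite (legTest (stored 1) (stored 2) (stored 3) (stored 4) (var 1))
        (.seq (raiseRow 2 (entry (entry (.cell 2 (var 1)) (var 1)) (stored 1)) (.cell 2 (var 1)))
          (.setNat 6 (var 1) (.const 0)))
        .skip)))

section Connect

variable {K : Type} [Field K] [LinearOrder K] [IsStrictOrderedRing K] {I : Instance K}
  {A : Finset (Fin I.n)} {d : ℕ → Fin I.n → Fin I.n → K}
  {S : ℕ → Fin I.n → Fin I.n → Finset (Fin I.n)} {m : Mem K}

/-- The total price of the facilities of grades `y`. -/
def Instance.total (I : Instance K) (y : Fin I.n → ℕ) : K := ∑ v, I.price (y v) v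

/-- Surcharges are computed from the required grades once and for all; starting from grades that
have been raised before, the increase can only be smaller. -/
theorem Instance.Valid.total_le (hI : I.Valid) {y y' : Fin I.n → ℕ} (hy : ∀ w, I.need w ≤ y w)
    {g : ℕ} (hg : g ≤ I.ℓ) {U : Finset (Fin I.n)}
    (hy' : ∀ w, y' w = if w ∈ U then max (y w) g else y w) :
    I.total y' ≤ I.total y + ∑ w ∈ U, I.extra g w := by
  classical
  have h1 : ∑ w ∈ U, I.extra g w = ∑ w, if w ∈ U then I.extra g w else 0 := by
    rw [← Finset.sum_filter, Finset.filter_mem_eq_inter, Finset.univ_inter]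
  rw [Instance.total, Instance.total, h1, ← Finset.sum_add_distrib]
  refine Finset.sum_le_sum fun w _ => ?_
  rw [hy']
  split_ifs
  · exact hI.price_raise w (hy w) hg
  · rw [add_zero]

/-- The grades that are stored in the memory. -/
def Instance.grades (I : Instance K) (m : Mem K) (v : Fin I.n) : ℕ := m.nat 5 v

/-- `row` and `eg` are evaluated anew in each pass, so their values are prescribed in every memory
with the same view and the same stored spider; the loop changes neither. -/
theorem run_raiseRow (h : I.View A d S m) {env : ℕ → ℕ} {l : ℕ} {row eg : NatExp} {g : ℕ}
    {r v : Fin I.n}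
    (hrow : ∀ m' w, I.View A d S m' → m'.nat 10 = m.nat 10 →
      row.eval (scope (Function.update env l w) m') = I.addr g r v)
    (hg : ∀ m' w, I.View A d S m' → m'.nat 10 = m.nat 10 →
      eg.eval (scope (Function.update env l w) m') = g) :
    I.View A d S ((raiseRow l row eg).run env m) ∧
    ((raiseRow l row eg).run env m).nat 10 = m.nat 10 ∧
    ∀ w, I.grades ((raiseRow l row eg).run env m) w =
      if w ∈ S g r v then max (I.grades m w) g else I.grades m w := by
  have key := run_for_inv (d := l) (env := env) (p := .ite (.conj (.natLe (.const 1)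
      (.cell 8 (entry row (var l)))) (.neg (.natLe eg (.cell 5 (var l))))) (.setNat 5 (var l) eg)
      .skip) h.intact.dim_true
    (fun k m' => I.View A d S m' ∧ m'.nat 10 = m.nat 10 ∧ ∀ w, I.grades m' w =
      if (w : ℕ) < k ∧ w ∈ S g r v then max (I.grades m w) g else I.grades m w)
    ⟨h, rfl, fun w => by simp⟩ ?_
  · obtain ⟨k1, k2, k3⟩ := key
    refine ⟨k1, k2, fun w => ?_⟩
    have h1 := k3 w
    simp only [w.2, true_and] at h1
    exact h1
  · rintro k hk m' ⟨h1, h2, h3⟩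
    obtain ⟨u, rfl⟩ : ∃ u : Fin I.n, k = u := ⟨⟨k, hk⟩, rfl⟩
    refine ⟨h1.run rfl _, (Stmt.run_nat rfl _ _).trans h2, fun w => ?_⟩
    have hcond : (Test.conj (.natLe (.const 1) (.cell 8 (entry row (var l))))
        (.neg (.natLe eg (.cell 5 (var l))))).Holds (scope (Function.update env l (u : ℕ)) m') ↔
        u ∈ S g r v ∧ I.grades m u < g := by
      have hu : I.grades m' u = I.grades m u := by rw [h3]; simp
      simp only [Test.Holds, NatExp.eval, h1.intact.eval_entry, hrow m' u h1 h2, hg m' u h1 h2,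
        eval_var, Function.update_self, ne_eq, Nat.reduceEqDiff, not_false_eq_true,
        scope_nat_of_ne, h1.mark, not_le]
      rw [← hu, Instance.grades]
    have hle : ∀ a b : ℕ, a ≤ b → max b a = b := fun a b => max_eq_left
    rw [Stmt.run]
    split_ifs with hc hw hw
    · rw [hcond] at hc
      simp only [Stmt.run, Instance.grades, hg m' u h1 h2, eval_var, Function.update_self,
        writeNat_nat_self, Function.update_apply, Fin.val_inj]
      split_ifs with hwu
      · subst hwu
        exact (max_eq_right hc.2.le).symm
      · have h4 : (w : ℕ) ≠ u := fun h5 => hwu (Fin.ext h5)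
        have h5 := h3 w
        rwa [if_pos ⟨by omega, hw.2⟩] at h5
    · rw [hcond] at hc
      simp only [Stmt.run, Instance.grades, hg m' u h1 h2, eval_var, Function.update_self,
        writeNat_nat_self, Function.update_apply, Fin.val_inj]
      split_ifs with hwu
      · subst hwu
        exact absurd ⟨by omega, hc.1⟩ hw
      · have h5 := h3 w
        rwa [if_neg (fun h6 => hw ⟨by omega, h6.2⟩)] at h5
    · rw [hcond] at hc
      rw [Stmt.run, h3]
      split_ifs with h4
      · rfl
      · have h5 : w = u := Fin.ext (by
          have : ¬ (w : ℕ) < u := fun h6 => h4 ⟨h6, hw.2⟩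
          omega)
        subst h5
        exact (max_eq_left (not_lt.1 fun h6 => hc ⟨hw.2, h6⟩)).symm
    · rw [Stmt.run, h3, if_neg (fun h4 => hw ⟨by omega, h4.2⟩)]

/-- The memory after the grades on some legs of a spider with the first leg and the center have
been raised. -/
structure Instance.Connected (I : Instance K) (d : ℕ → Fin I.n → Fin I.n → K)
    (S : ℕ → Fin I.n → Fin I.n → Finset (Fin I.n)) (m : Mem K) (v r₁ : Fin I.n) (g : ℕ)
    (L : Finset (Fin I.n)) (m' : Mem K) : Prop where
  le : ∀ w, I.grades m w ≤ I.grades m' w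
  le_ℓ : ∀ w, I.grades m' w ≤ I.ℓ
  center : g ≤ I.grades m' v
  first : ∀ w ∈ S g r₁ v, g ≤ I.grades m' w
  leg : ∀ r ∈ L, ∀ w ∈ S (I.need r) r v, I.need r ≤ I.grades m' w
  total : I.total (I.grades m') ≤
    I.total (I.grades m) + (d g r₁ v + I.extra g v + ∑ r ∈ L, d (I.need r) r v)

-- The legs are paid for one at a time. Each costs at most the surcharges of its marked vertices,
-- hence at most its distance, and vertices shared by legs only make the total smaller.
open Classical in
theorem run_connectSpider (hI : I.Valid) (hS : I.Solved d S) (h : I.View A d S m)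
    {v r₁ r₃ : Fin I.n} {g : ℕ} (hb : I.Best A d m v r₁ g r₃)
    (hneed : ∀ w, I.need w ≤ I.grades m w) (hℓ : ∀ w, I.grades m w ≤ I.ℓ) (env : ℕ → ℕ) :
    I.View (A \ I.legs A d v r₁ g r₃) d S (connectSpider.run env m) ∧
      I.Connected d S m v r₁ g (I.legs A d v r₁ g r₃) (connectSpider.run env m) := by
  have hgℓ : g ≤ I.ℓ := hb.isSpider.2.2.2.2.trans (hI.need_le r₁)
  have hst : ∀ {m' : Mem K} {env' : ℕ → ℕ} {i : ℕ}, m'.nat 10 = m.nat 10 →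
      (stored i).eval (scope env' m') = m.nat 10 i := by
    intro m' env' i hm'
    simp [stored, NatExp.eval, hm']
  have haddr : ∀ {m' : Mem K} {env' : ℕ → ℕ}, I.Intact m' → m'.nat 10 = m.nat 10 →
      (entry (entry (stored 3) (stored 2)) (stored 1)).eval (scope env' m') = I.addr g r₁ v := by
    intro m' env' hi hm'
    rw [hi.eval_entry, hi.eval_entry, hst hm', hst hm', hst hm', hb.grade, hb.top, hb.center]
    rfl
  set m₁ := (raiseRow 1 (entry (entry (stored 3) (stored 2)) (stored 1)) (stored 3)).run env m
    with hm₁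
  obtain ⟨i₁, t₁, y₁⟩ := run_raiseRow (env := env) (l := 1) (eg := stored 3) (g := g) (r := r₁)
    (v := v) h (row := entry (entry (stored 3) (stored 2)) (stored 1))
    (fun m' w hv hm' => haddr hv.intact hm') (fun m' w hv hm' => by rw [hst hm', hb.grade])
  rw [← hm₁] at i₁ t₁ y₁
  set m₂ := (Stmt.ite (.neg (.natLe (stored 3) (.cell 5 (stored 1))))
    (.setNat 5 (stored 1) (stored 3)) .skip).run env m₁ with hm₂
  have i₂ : I.View A d S m₂ := i₁.run rfl _
  have t₂ : m₂.nat 10 = m.nat 10 := (Stmt.run_nat rfl _ _).trans t₁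
  have y₂ : ∀ w, I.grades m₂ w =
      if w ∈ ({v} : Finset (Fin I.n)) then max (I.grades m₁ w) g else I.grades m₁ w := by
    intro w
    simp only [hm₂, Stmt.run, Test.Holds, NatExp.eval, hst t₁, hb.grade, hb.center, ne_eq,
      Nat.reduceEqDiff, not_false_eq_true, scope_nat_of_ne, Finset.mem_singleton, not_le]
    split_ifs with hc hw hw
    · subst hw
      simpa [Instance.grades] using hc.le
    · simp [Instance.grades, Fin.val_inj, hw]
    · subst hw
      exact (max_eq_left (not_lt.1 hc)).symm
    · rfl
  have n₁ : ∀ w, I.grades m w ≤ I.grades m₁ w := by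
    intro w; rw [y₁]; split_ifs
    · exact le_max_left _ _
    · exact le_rfl
  have n₂ : ∀ w, I.grades m₁ w ≤ I.grades m₂ w := by
    intro w; rw [y₂]; split_ifs
    · exact le_max_left _ _
    · exact le_rfl
  have c₂ : I.Connected d S m v r₁ g ∅ m₂ := by
    refine ⟨fun w => (n₁ w).trans (n₂ w), fun w => ?_, ?_, fun w hw => ?_, fun r hr => ?_, ?_⟩
    · rw [y₂, y₁]
      split_ifs <;> simp [hℓ, hgℓ]
    · rw [y₂, if_pos (Finset.mem_singleton_self v)]; exact le_max_right _ _
    · refine le_trans ?_ (n₂ w)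
      rw [y₁, if_pos hw]; exact le_max_right _ _
    · simp at hr
    · have h1 := hI.total_le hneed hgℓ y₁
      have h2 := hI.total_le (fun w => (hneed w).trans (n₁ w)) hgℓ y₂
      have h3 := hS.sum_le g hgℓ r₁ v
      rw [Finset.sum_singleton] at h2
      rw [Finset.sum_empty]
      linarith
  have key := run_for_inv (d := 1) (env := env)
    (p := .ite (legTest (stored 1) (stored 2) (stored 3) (stored 4) (var 1))
        (.seq (raiseRow 2 (entry (entry (.cell 2 (var 1)) (var 1)) (stored 1)) (.cell 2 (var 1)))
          (.setNat 6 (var 1) (.const 0)))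
        .skip) i₂.intact.dim_true
    (fun k m' => I.View (A \ (I.legs A d v r₁ g r₃).filter (fun r : Fin I.n => (r : ℕ) < k)) d S m' ∧
      m'.nat 10 = m.nat 10 ∧
      I.Connected d S m v r₁ g ((I.legs A d v r₁ g r₃).filter (fun r : Fin I.n => (r : ℕ) < k)) m')
    ⟨by simpa using i₂, t₂, by simpa using c₂⟩ ?_
  · rw [Finset.filter_true_of_mem (fun r _ => r.2)] at key
    exact ⟨key.1, key.2.2⟩
  · rintro k hk m' ⟨k1, k2, k3⟩
    obtain ⟨r, rfl⟩ : ∃ r : Fin I.n, k = r := ⟨⟨k, hk⟩, rfl⟩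
    set L := I.legs A d v r₁ g r₃ with hL
    set Lk := L.filter (fun r' : Fin I.n => (r' : ℕ) < r) with hLk
    have hrk : r ∉ Lk := by simp [hLk]
    set env' := Function.update env 1 (r : ℕ) with henv'
    have e1 : (var 1).eval (scope env' m') = r := by simp [henv']
    -- The feet in `Lk` are already inactive, so the test refers to `A \ Lk`. This does not matter:
    -- `r` is not in `Lk`, and for `r₃` only the distance is consulted, not whether it is active.
    have hleg : (legTest (stored 1) (stored 2) (stored 3) (stored 4) (var 1)).Holds
        (scope env' m') ↔ r ∈ L := by
      rw [k1.holds_legTest ((hst k2).trans hb.center) ((hst k2).trans hb.top)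
        ((hst k2).trans hb.grade) ((hst k2).trans hb.last) e1]
      simp only [hL, Instance.legs, Finset.mem_filter, Finset.mem_sdiff]
      have : r ∈ A \ Lk ↔ r ∈ A := by simp [hrk]
      rw [← Finset.mem_sdiff, this]
    rw [Stmt.run]
    split_ifs with hc
    · rw [hleg] at hc
      have hins : L.filter (fun r' : Fin I.n => (r' : ℕ) < r + 1) = insert r Lk := by
        ext r'
        simp only [hLk, Finset.mem_filter, Finset.mem_insert, Nat.lt_succ_iff_lt_or_eq, Fin.val_inj]
        constructor
        · rintro ⟨h5, h6 | h6⟩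
          · exact Or.inr ⟨h5, h6⟩
          · exact Or.inl h6
        · rintro (rfl | h5)
          · exact ⟨hc, Or.inr rfl⟩
          · exact ⟨h5.1, Or.inl h5.2⟩
      obtain ⟨i₃, t₃, y₃⟩ := run_raiseRow (env := env') (l := 2) (eg := .cell 2 (var 1))
        (g := I.need r) (r := r) (v := v) k1
        (row := entry (entry (.cell 2 (var 1)) (var 1)) (stored 1))
        (fun m'' w hv hm'' => by
          have e2 : (var 1).eval (scope (Function.update env' 2 w) m'') = r := by simp [henv']
          rw [hv.intact.eval_entry, hv.intact.eval_entry, hv.need_cell e2, e2,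
            hst (hm''.trans k2), hb.center]
          rfl)
        (fun m'' w hv hm'' => hv.need_cell (by simp [henv']))
      set m₃ := (raiseRow 2 (entry (entry (.cell 2 (var 1)) (var 1)) (stored 1))
        (.cell 2 (var 1))).run env' m' with hm₃
      have v₄ : (Stmt.seq (raiseRow 2 (entry (entry (.cell 2 (var 1)) (var 1)) (stored 1))
          (.cell 2 (var 1))) (.setNat 6 (var 1) (.const 0))).run env' m' =
          m₃.writeNat 6 r 0 := by
        have e2 : (var 1).eval (scope env' m₃) = r := by simp [henv']
        change m₃.writeNat 6 ((var 1).eval (scope env' m₃)) 0 = _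
        rw [e2]
      rw [v₄, hins]
      have n₃ : ∀ w, I.grades m' w ≤ I.grades m₃ w := by
        intro w; rw [y₃]; split_ifs
        · exact le_max_left _ _
        · exact le_rfl
      have y₄ : I.grades (m₃.writeNat 6 r 0) = I.grades m₃ := by
        funext w; simp [Instance.grades]
      refine ⟨⟨⟨fun a ha => ?_, i₃.intact.num⟩, i₃.tabulated, fun w => ?_, i₃.dist, fun g r v w => ?_⟩,
        ?_, ⟨fun w => ?_, fun w => ?_, ?_, fun w hw => ?_, fun r' hr' w hw => ?_, ?_⟩⟩
      · rw [writeNat_nat_of_ne (by omega)]; exact i₃.intact.nat a ha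
      · rw [writeNat_nat_self, Function.update_apply]
        split_ifs with hw
        · rw [Fin.val_inj] at hw
          simp [hw]
        · rw [i₃.active w, Finset.mem_sdiff, Finset.mem_sdiff, Finset.mem_insert]
          have : w ≠ r := fun h5 => hw (congrArg _ h5)
          tauto
      · rw [writeNat_nat_of_ne (by norm_num)]; exact i₃.mark g r v w
      · rw [writeNat_nat_of_ne (by norm_num), t₃, k2]
      · rw [y₄]; exact (k3.le w).trans (n₃ w)
      · rw [y₄, y₃]
        split_ifs
        · exact max_le (k3.le_ℓ w) (hI.need_le r)
        · exact k3.le_ℓ w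
      · rw [y₄]; exact k3.center.trans (n₃ v)
      · rw [y₄]; exact (k3.first w hw).trans (n₃ w)
      · rw [y₄]
        rcases Finset.mem_insert.1 hr' with rfl | hr'
        · rw [y₃, if_pos hw]; exact le_max_right _ _
        · exact (k3.leg r' hr' w hw).trans (n₃ w)
      · rw [y₄, Finset.sum_insert hrk]
        have h1 := hI.total_le (fun w => (hneed w).trans (k3.le w)) (hI.need_le r) y₃
        have h2 := hS.sum_le _ (hI.need_le r) r v
        have h3 := k3.total
        linarith
    · rw [hleg] at hc
      have hins : L.filter (fun r' : Fin I.n => (r' : ℕ) < r + 1) = Lk := by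
        refine Finset.filter_congr fun r' hr' => ?_
        have : (r' : ℕ) ≠ r := fun h5 => hc (Fin.ext h5 ▸ hr')
        omega
      rw [hins, Stmt.run]
      exact ⟨k1, k2, k3⟩

end Connect

/-! ## The main loop -/

/-- Find the best spider and connect its terminals. -/
def mergeStep : Stmt := .seq search (.ite (.natLe (.const 1) (.cell 10 (.const 0))) connectSpider .skip)

/-- Connect all terminals. -/
def mergeAll : Stmt := .for_ 0 true mergeStep

section Merge

variable {K : Type} [Field K] [LinearOrder K] [IsStrictOrderedRing K] {I : Instance K}
  {A : Finset (Fin I.n)} {d : ℕ → Fin I.n → Fin I.n → K}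
  {S : ℕ → Fin I.n → Fin I.n → Finset (Fin I.n)} {m : Mem K}

/-- The graph on the vertices of grade at least `g`. -/
def Instance.level (I : Instance K) (y : Fin I.n → ℕ) (g : ℕ) : SimpleGraph (Fin I.n) where
  Adj u v := I.G.Adj u v ∧ g ≤ y u ∧ g ≤ y v
  symm := ⟨fun _ _ h => ⟨h.1.symm, h.2.2, h.2.1⟩⟩
  loopless := ⟨fun _ h => h.1.ne rfl⟩

theorem Instance.level_mono {y y' : Fin I.n → ℕ} {g g' : ℕ} (hy : ∀ w, y w ≤ y' w) (hg : g' ≤ g) :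
    I.level y g ≤ I.level y' g' :=
  fun u v h => ⟨h.1, hg.trans (h.2.1.trans (hy u)), hg.trans (h.2.2.trans (hy v))⟩

theorem Instance.level_reachable {y : Fin I.n → ℕ} {g : ℕ} {u v : Fin I.n} (p : I.G.Walk u v)
    (hp : ∀ w ∈ p.support, g ≤ y w) : (I.level y g).Reachable u v := by
  induction p with
  | nil => rfl
  | @cons u w _ h p ih =>
    have h1 := ih fun x hx => hp x (by simp [hx])
    have h2 : (I.level y g).Adj u w := ⟨h, hp u (by simp), hp w (by simp)⟩
    exact h2.reachable.trans h1

/-- The state after some iterations: every terminal is connected to an active terminal of at least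
its grade, and the total price is bounded. -/
structure Instance.Merged (I : Instance K) (d : ℕ → Fin I.n → Fin I.n → K)
    (S : ℕ → Fin I.n → Fin I.n → Finset (Fin I.n)) (val : K →+* ℝ) (m : Mem K)
    (A : Finset (Fin I.n)) : Prop where
  view : I.View A d S m
  subset : A ⊆ I.T
  nonempty : A.Nonempty
  need_le : ∀ w, I.need w ≤ I.grades m w
  le_ℓ : ∀ w, I.grades m w ≤ I.ℓ
  reachable : ∀ t ∈ I.T, ∃ r ∈ A, I.need t ≤ I.need r ∧
    (I.level (I.grades m) (I.need t)).Reachable t r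
  total : ∀ H y, I.Feasible H y → val (I.total (I.grades m)) ≤ val (I.total I.need) +
    2 * (Real.log I.T.card - Real.log A.card) * val (∑ v, I.extra (y v) v)

open Classical in
/-- The spider that was found is as good as the one that the analysis provides. -/
theorem Instance.Best.cost_le (hI : I.Valid) (hA : A ⊆ I.T) (hd : I.IsDist d) {v r₁ r₃ : Fin I.n}
    {g : ℕ} (hb : I.Best A d m v r₁ g r₃) (hbeats : ∀ v r₁ g r₃, I.Beats A d v r₁ g r₃ m)
    {H : I.G.Subgraph} {y : Fin I.n → ℕ} (hF : I.Feasible H y) :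
    (A.card : K) * I.spiderCost A d v r₁ g r₃ ≤
      2 * (I.legs A d v r₁ g r₃).card * ∑ v, I.extra (y v) v := by
  have hA2 : 2 ≤ A.card :=
    Finset.one_lt_card.2 ⟨r₃, hb.isSpider.2.1, r₁, hb.isSpider.1, hb.isSpider.2.2.1⟩
  obtain ⟨v', r₁', g', r₃', hs, hle⟩ := hF.exists_isSpider hI hA hA2 hd
  have h1 := (hbeats v' r₁' g' r₃' hs).2
  rw [hb.cost, hb.card] at h1
  have hc' : (0 : K) < (I.legs A d v' r₁' g' r₃').card := by
    exact_mod_cast Finset.card_pos.2 ⟨r₃', hs.mem_legs⟩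
  set x := I.spiderCost A d v r₁ g r₃
  set c := ((I.legs A d v r₁ g r₃).card : K)
  set x' := I.spiderCost A d v' r₁' g' r₃'
  set c' := ((I.legs A d v' r₁' g' r₃').card : K)
  set W := ∑ v, I.extra (y v) v
  have hc : (0 : K) ≤ c := Nat.cast_nonneg _
  have ha : (0 : K) ≤ A.card := Nat.cast_nonneg _
  refine le_of_mul_le_mul_right ?_ hc'
  calc (A.card : K) * x * c' = A.card * (x * c') := by ring
    _ ≤ A.card * (x' * c) := mul_le_mul_of_nonneg_left h1 ha
    _ = (A.card * x') * c := by ring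
    _ ≤ (2 * c' * W) * c := mul_le_mul_of_nonneg_right hle hc
    _ = 2 * c * W * c' := by ring

-- A spider with `s` legs lowers |A| by `s` and costs at most 2 s / |A| times the reduced cost of
-- any solution. By `div_le_log_sub_log` this is paid for by the change of the logarithm in
-- `Merged.total`. If the search finds nothing, then |A| ≤ 1, since a terminal of highest grade and
-- any other one form a spider.
open Classical in
theorem run_mergeStep (hI : I.Valid) (hS : I.Solved d S) {val : K →+* ℝ} (hval : Monotone val)
    (h : I.Merged d S val m A) (env : ℕ → ℕ) :
    ∃ A', I.Merged d S val (mergeStep.run env m) A' ∧ (A'.card ≤ 1 ∨ A'.card + 1 ≤ A.card) := by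
  obtain ⟨hsr, hbeats⟩ := run_search hI h.view env
  set m₁ := search.run env m with hm₁
  have hy₁ : I.grades m₁ = I.grades m := by
    funext w; exact congrFun (Stmt.run_nat (a := 5) rfl _ _) _
  have hrun : mergeStep.run env m = (Stmt.ite (.natLe (.const 1) (.cell 10 (.const 0)))
      connectSpider .skip).run env m₁ := rfl
  rw [hrun, Stmt.run]
  have hcond : (Test.natLe (.const 1) (.cell 10 (.const 0))).Holds (scope env m₁) ↔
      1 ≤ m₁.nat 10 0 := by
    simp [Test.Holds, NatExp.eval]
  split_ifs with hc
  · rw [hcond] at hc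
    obtain ⟨v, r₁, g, r₃, hb⟩ := hsr.best hc
    obtain ⟨hv, hcon⟩ := run_connectSpider hI hS hsr.view hb (by rw [hy₁]; exact h.need_le)
      (by rw [hy₁]; exact h.le_ℓ) env
    set m₂ := connectSpider.run env m₁ with hm₂
    set L := I.legs A d v r₁ g r₃ with hL
    have hLA : L ⊆ A := Finset.filter_subset _ _
    have hr₁ : r₁ ∈ A \ L := Finset.mem_sdiff.2 ⟨hb.isSpider.1, fun h5 =>
      (Finset.mem_filter.1 h5).2.1 rfl⟩
    have hLpos : 1 ≤ L.card := Finset.card_pos.2 ⟨r₃, hb.isSpider.mem_legs⟩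
    have hcard : (A \ L).card = A.card - L.card := Finset.card_sdiff_of_subset hLA
    have hlt : L.card < A.card := by
      have := Finset.card_pos.2 ⟨r₁, hr₁⟩
      omega
    have hle : ∀ w, I.grades m w ≤ I.grades m₂ w := by rw [← hy₁]; exact hcon.le
    refine ⟨A \ L, ⟨hv, Finset.sdiff_subset.trans h.subset, ⟨r₁, hr₁⟩,
      fun w => (h.need_le w).trans (hle w), hcon.le_ℓ, fun t ht => ?_, fun H y hF => ?_⟩,
      Or.inr (by omega)⟩
    · obtain ⟨r, hr, htr, hreach⟩ := h.reachable t ht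
      have hreach' := hreach.mono (I.level_mono hle le_rfl)
      by_cases hrL : r ∈ L
      · have hrg : I.need r ≤ g := (Finset.mem_filter.1 hrL).2.2.1
        have hg : g ≤ I.need r₁ := hb.isSpider.2.2.2.2
        have hgℓ : g ≤ I.ℓ := hg.trans (hI.need_le r₁)
        refine ⟨r₁, hr₁, htr.trans (hrg.trans hg), hreach'.trans ?_⟩
        -- The new connection from `r` to `r₁` runs along the leg of `r` to the center, at grade
        -- `need r`, and on along the first leg, at grade `g ≥ need r`; both are at least `need t`.
        obtain ⟨p, hp⟩ := hS.walk _ (hI.need_le r) r v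
        obtain ⟨q, hq⟩ := hS.walk g hgℓ r₁ v
        have h1 : (I.level (I.grades m₂) (I.need r)).Reachable v r :=
          I.level_reachable p fun w hw => by
            by_cases hwv : w = v
            · subst hwv; exact hrg.trans hcon.center
            · exact hcon.leg r hrL w (hp w hw hwv)
        have h2 : (I.level (I.grades m₂) g).Reachable v r₁ :=
          I.level_reachable q fun w hw => by
            by_cases hwv : w = v
            · subst hwv; exact hcon.center
            · exact hcon.first w (hq w hw hwv)
        exact (h1.symm.mono (I.level_mono (fun _ => le_rfl) htr)).trans
          (h2.mono (I.level_mono (fun _ => le_rfl) (htr.trans hrg)))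
      · exact ⟨r, Finset.mem_sdiff.2 ⟨hr, hrL⟩, htr, hreach'⟩
    · have h1 := hval (hb.cost_le hI h.subset hS.isDist hbeats hF)
      have h2 := hval hcon.total
      have h3 := h.total H y hF
      have h4 := div_le_log_sub_log hlt
      rw [hy₁] at h2
      rw [← hcard] at h4
      have hW : 0 ≤ val (∑ v, I.extra (y v) v) := by
        rw [← map_zero val]
        exact hval (Finset.sum_nonneg fun w _ => hI.extra_nonneg w (hF.le_grade w))
      have hx : I.total (I.grades m) + (d g r₁ v + I.extra g v + ∑ r ∈ L, d (I.need r) r v) =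
          I.total (I.grades m) + I.spiderCost A d v r₁ g r₃ := rfl
      rw [hx, map_add] at h2
      rw [map_mul, map_mul, map_mul, map_natCast, map_natCast, map_ofNat] at h1
      set W := val (∑ v, I.extra (y v) v)
      set x := val (I.spiderCost A d v r₁ g r₃)
      have ha : (0 : ℝ) < A.card := by exact_mod_cast (by omega : 0 < A.card)
      have h5 : x ≤ 2 * (L.card / A.card) * W := by
        have : 2 * ((L.card : ℝ) / A.card) * W = (2 * L.card * W) / A.card := by ring
        rw [this, le_div_iff₀ ha, mul_comm]
        exact h1
      have h6 : 2 * ((L.card : ℝ) / A.card) * W ≤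
          2 * (Real.log A.card - Real.log (A \ L).card) * W :=
        mul_le_mul_of_nonneg_right (by linarith) hW
      have h7 : 2 * (Real.log I.T.card - Real.log (A \ L).card) * W =
          2 * (Real.log I.T.card - Real.log A.card) * W +
          2 * (Real.log A.card - Real.log (A \ L).card) * W := by ring
      rw [h7]
      linarith
  · rw [hcond] at hc
    rw [Stmt.run]
    refine ⟨A, ⟨hsr.view, h.subset, h.nonempty, ?_, ?_, ?_, ?_⟩, Or.inl ?_⟩
    · rw [hy₁]; exact h.need_le
    · rw [hy₁]; exact h.le_ℓ
    · rw [hy₁]; exact h.reachable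
    · rw [hy₁]; exact h.total
    · by_contra hcard
      obtain ⟨r₁, hr₁, hmax⟩ := Finset.exists_max_image A I.need h.nonempty
      obtain ⟨r₃, hr₃, hne⟩ := Finset.exists_mem_ne (s := A) (by omega) r₁
      exact hc (hbeats r₁ r₁ (I.need r₃) r₃ ⟨hr₁, hr₃, hne, le_rfl, hmax r₃ hr₃⟩).1

/-- Every pass deactivates a terminal until one is left, and |A| ≤ n, so `n` passes suffice. -/
theorem run_mergeAll (hI : I.Valid) (hS : I.Solved d S) {val : K →+* ℝ} (hval : Monotone val)
    (h : I.Merged d S val m A) (env : ℕ → ℕ) :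
    ∃ root, I.Merged d S val (mergeAll.run env m) {root} := by
  have key := run_for_inv (d := 0) (env := env) (p := mergeStep) h.view.intact.dim_true
    (fun k m' => ∃ A', I.Merged d S val m' A' ∧ (A'.card ≤ 1 ∨ A'.card + k ≤ A.card))
    ⟨A, h, Or.inr (by omega)⟩ (fun k hk m' => by
      rintro ⟨A', h1, h2⟩
      obtain ⟨A'', h3, h4⟩ := run_mergeStep hI hS hval h1 (Function.update env 0 k)
      refine ⟨A'', h3, ?_⟩
      rcases h4 with h4 | h4
      · exact Or.inl h4
      · have := Finset.card_pos.2 h3.nonempty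
        omega)
  obtain ⟨A', h1, h2⟩ := key
  have h3 := Finset.card_pos.2 h1.nonempty
  have h4 : A.card ≤ I.n := by simpa using Finset.card_le_univ A
  have h5 : A'.card = 1 := by rcases h2 with h2 | h2 <;> omega
  obtain ⟨root, hroot⟩ := Finset.card_eq_one.1 h5
  exact ⟨root, hroot ▸ h1⟩

end Merge

/-! ## The solution tree -/

/-- The grade that is treated in the iteration `var 0`: the grades are treated in descending
order. -/
def growGrade : NatExp := .sub (.cell 0 (.const 1)) (var 0)

/-- Attach the vertex `var 3` to the tree, by an edge to `var 2`, if this is possible with the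
current grade. -/
def growEdge : Stmt :=
  .ite (.conj (.natLe (.const 1) (.cell 1 (entry (var 2) (var 3))))
      (.conj (.natLe (.cell 3 (var 3)) (.const 0)) (.conj (.natLe (.const 1) growGrade)
        (.conj (.natLe growGrade (.cell 3 (var 2))) (.natLe growGrade (.cell 5 (var 3)))))))
    (.seq (.setNat 3 (var 3) growGrade)
      (.seq (.setNat 4 (entry (var 2) (var 3)) (.const 1))
        (.setNat 4 (entry (var 3) (var 2)) (.const 1))))
    .skip

/-- Attach all vertices that can be reached with the current grade. -/
def growLevel : Stmt := .for_ 1 true (.for_ 2 true (.for_ 3 true growEdge))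

/-- Find the remaining active terminal. -/
def findRoot : Stmt :=
  .for_ 0 true (.ite (.natLe (.const 1) (.cell 6 (var 0))) (.setNat 12 (.const 0) (var 0)) .skip)

/-- Build the solution. -/
def growTree : Stmt :=
  .seq findRoot (.seq (.setNat 3 (.cell 12 (.const 0)) (.cell 5 (.cell 12 (.const 0))))
    (.for_ 0 false growLevel))

section Grow

variable {K : Type} [Field K] [LinearOrder K] [IsStrictOrderedRing K] {I : Instance K}
  {b : Fin I.n → ℕ} {root : Fin I.n} {g : ℕ} {T : SimpleGraph (Fin I.n)} {m : Mem K}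

/-- The grades of the solution that are stored in the memory. -/
def Instance.assigned (I : Instance K) (m : Mem K) (v : Fin I.n) : ℕ := m.nat 3 v

open Classical in
/-- The memory holds a tree `T` with assigned grades, of which only that of the root may be less
than `g`, such that the grades do not increase on paths from the root. -/
structure Instance.Growing (I : Instance K) (b : Fin I.n → ℕ) (root : Fin I.n) (g : ℕ)
    (T : SimpleGraph (Fin I.n)) (m : Mem K) : Prop where
  intact : I.Intact m
  grades : I.grades m = b
  edges : ∀ u v : Fin I.n, m.nat 4 (u * I.n + v) = if T.Adj u v then 1 else 0
  le_G : T ≤ I.G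
  acyclic : T.IsAcyclic
  pos : ∀ u v, T.Adj u v → 1 ≤ I.assigned m u
  walk : ∀ v, 1 ≤ I.assigned m v → ∃ p : T.Walk v root, ∀ w ∈ p.support,
    I.assigned m v ≤ I.assigned m w
  le : ∀ v, I.assigned m v ≤ b v
  root_eq : I.assigned m root = b root
  level : ∀ v, 1 ≤ I.assigned m v → v = root ∨ g ≤ I.assigned m v

theorem Instance.Growing.of_le (h : I.Growing b root g T m) {g' : ℕ} (hg : g' ≤ g) :
    I.Growing b root g' T m :=
  { h with level := fun v hv => (h.level v hv).imp_right hg.trans }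

/-- Grades that have been assigned do not change. -/
def Instance.AssignLe (I : Instance K) (m m' : Mem K) : Prop :=
  ∀ v, 1 ≤ I.assigned m v → I.assigned m' v = I.assigned m v

theorem Instance.AssignLe.refl (m : Mem K) : I.AssignLe m m := fun _ _ => rfl

theorem Instance.AssignLe.trans {m₁ m₂ m₃ : Mem K} (h : I.AssignLe m₁ m₂)
    (h' : I.AssignLe m₂ m₃) : I.AssignLe m₁ m₃ := fun v hv =>
  (h' v (by rw [h v hv]; exact hv)).trans (h v hv)

theorem Instance.AssignLe.pos {m₁ m₂ : Mem K} (h : I.AssignLe m₁ m₂) {v : Fin I.n}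
    (hv : 1 ≤ I.assigned m₁ v) : 1 ≤ I.assigned m₂ v := by rwa [h v hv]

-- Edges of `T` join vertices that have a grade, so the ungraded `w` is isolated and the new edge
-- closes no cycle. The path from `w` to the root starts with `u`, and its vertices have at least
-- the grade of `u`, which is at least `g`.
open Classical in
theorem Instance.Growing.attach (h : I.Growing b root g T m) {u w : Fin I.n} (ha : I.G.Adj u w)
    (hw : I.assigned m w = 0) (h1 : 1 ≤ g) (hu : g ≤ I.assigned m u) (hb : g ≤ b w) {m' : Mem K}
    (hi : I.Intact m') (hgr : I.grades m' = b)
    (hy : ∀ v, I.assigned m' v = if v = w then g else I.assigned m v)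
    (he : ∀ x y : Fin I.n, m'.nat 4 (x * I.n + y) =
      if x = w ∧ y = u then 1 else if x = u ∧ y = w then 1 else m.nat 4 (x * I.n + y)) :
    I.Growing b root g (T ⊔ SimpleGraph.edge u w) m' := by
  have hle : ∀ v, I.assigned m v ≤ I.assigned m' v := by
    intro v
    rw [hy]
    split_ifs with hv
    · rw [hv, hw]; exact Nat.zero_le _
    · exact le_rfl
  have hrw : root ≠ w := by
    rintro rfl
    have := h.root_eq
    omega
  have hsup : ∀ x y, (T ⊔ SimpleGraph.edge u w).Adj x y ↔
      T.Adj x y ∨ (x = u ∧ y = w ∨ x = w ∧ y = u) := by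
    intro x y
    rw [SimpleGraph.sup_adj, SimpleGraph.edge_adj]
    refine or_congr_right ⟨fun h => h.1, fun h => ⟨h, ?_⟩⟩
    rintro rfl
    rcases h with ⟨rfl, rfl⟩ | ⟨rfl, rfl⟩ <;> exact ha.ne rfl
  have hnot : ¬ T.Reachable u w := by
    intro hr
    obtain ⟨p⟩ := hr.symm
    cases p with
    | nil => exact ha.ne rfl
    | cons h2 _ =>
      have := h.pos _ _ h2
      omega
  refine ⟨hi, hgr, fun x y => ?_, ?_, ?_, fun x y hxy => ?_, fun v hv => ?_, fun v => ?_, ?_,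
    fun v hv => ?_⟩
  · rw [he, h.edges, hsup]
    by_cases h2 : x = w ∧ y = u
    · simp [h2]
    · by_cases h3 : x = u ∧ y = w
      · simp [h3]
      · simp [h2, h3]
  · intro x y hxy
    rcases (hsup x y).1 hxy with h2 | ⟨rfl, rfl⟩ | ⟨rfl, rfl⟩
    · exact h.le_G h2
    · exact ha
    · exact ha.symm
  · exact (SimpleGraph.isAcyclic_add_edge_iff_of_not_reachable u w hnot).2 h.acyclic
  · rcases (hsup x y).1 hxy with h2 | ⟨rfl, rfl⟩ | ⟨rfl, rfl⟩
    · exact (h.pos x y h2).trans (hle x)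
    · exact (h1.trans hu).trans (hle x)
    · rw [hy, if_pos rfl]; exact h1
  · by_cases hvw : v = w
    · subst hvw
      obtain ⟨p, hp⟩ := h.walk u (h1.trans hu)
      refine ⟨.cons ((hsup v u).2 (Or.inr (Or.inr ⟨rfl, rfl⟩))) (p.mapLe le_sup_left),
        fun x hx => ?_⟩
      rw [SimpleGraph.Walk.support_cons, List.mem_cons, SimpleGraph.Walk.support_mapLe_eq_support]
        at hx
      rcases hx with rfl | hx
      · exact le_rfl
      · rw [hy, if_pos rfl]
        exact (hu.trans (hp x hx)).trans (hle x)
    · rw [hy, if_neg hvw] at hv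
      obtain ⟨p, hp⟩ := h.walk v hv
      refine ⟨p.mapLe le_sup_left, fun x hx => ?_⟩
      rw [SimpleGraph.Walk.support_mapLe_eq_support] at hx
      rw [hy v, if_neg hvw]
      exact (hp x hx).trans (hle x)
  · rw [hy]
    split_ifs with hv
    · rw [hv]; exact hb
    · exact h.le v
  · rw [hy, if_neg hrw]; exact h.root_eq
  · rw [hy] at hv ⊢
    split_ifs at hv ⊢ with hvw
    · exact Or.inr le_rfl
    · exact h.level v hv

/-- The last claim requires that `u` carries grade at least `g`. By `Growing.level` this could fail
only for the root, whose grade is `b root`, and this is at least `g` if the root has an edge in the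
level graph. -/
theorem run_growEdge (h : I.Growing b root g T m) {env : ℕ → ℕ} {u w : Fin I.n}
    (h0 : I.ℓ - env 0 = g) (h2 : env 2 = u) (h3 : env 3 = w) :
    (∃ T', I.Growing b root g T' (growEdge.run env m)) ∧ I.AssignLe m (growEdge.run env m) ∧
      (1 ≤ g → (I.level b g).Adj u w → 1 ≤ I.assigned m u →
        1 ≤ I.assigned (growEdge.run env m) w) := by
  have hgg : ∀ {m' : Mem K}, I.Intact m' → growGrade.eval (scope env m') = g := by
    intro m' hm'
    simp [growGrade, NatExp.eval, hm'.ℓ_eq, h0]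
  have hb : m.nat 5 w = b w := congrFun h.grades w
  have hcond : (Test.conj (.natLe (.const 1) (.cell 1 (entry (var 2) (var 3))))
      (.conj (.natLe (.cell 3 (var 3)) (.const 0)) (.conj (.natLe (.const 1) growGrade)
        (.conj (.natLe growGrade (.cell 3 (var 2)))
          (.natLe growGrade (.cell 5 (var 3))))))).Holds (scope env m) ↔
      I.G.Adj u w ∧ I.assigned m w = 0 ∧ 1 ≤ g ∧ g ≤ I.assigned m u ∧ g ≤ b w := by
    simp only [Test.Holds, NatExp.eval, h.intact.eval_entry, eval_var, h2, h3, hgg h.intact,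
      ne_eq, Nat.reduceEqDiff, not_false_eq_true, scope_nat_of_ne, h.intact.adj_iff, hb,
      Nat.le_zero, OfNat.one_ne_ofNat, Instance.assigned]
  rw [growEdge, Stmt.run]
  split_ifs with hc
  · rw [hcond] at hc
    obtain ⟨c1, c2, c3, c4, c5⟩ := hc
    set s : Stmt := .seq (.setNat 3 (var 3) growGrade)
      (.seq (.setNat 4 (entry (var 2) (var 3)) (.const 1))
        (.setNat 4 (entry (var 3) (var 2)) (.const 1))) with hs
    set m₁ := (Stmt.setNat 3 (var 3) growGrade).run env m with hm₁
    set m₂ := (Stmt.setNat 4 (entry (var 2) (var 3)) (.const 1)).run env m₁ with hm₂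
    have i₁ : I.Intact m₁ := h.intact.run rfl _
    have i₂ : I.Intact m₂ := i₁.run rfl _
    have e₁ : m₁ = m.writeNat 3 w g := by
      simp only [hm₁, Stmt.run, eval_var, h3, hgg h.intact]
    have e₂ : m₂ = m₁.writeNat 4 (u * I.n + w) 1 := by
      simp only [hm₂, Stmt.run, i₁.eval_entry, eval_var, h2, h3, NatExp.eval]
    have e₃ : s.run env m = m₂.writeNat 4 (w * I.n + u) 1 := by
      change (Stmt.setNat 4 (entry (var 3) (var 2)) (.const 1)).run env m₂ = _
      simp only [Stmt.run, i₂.eval_entry, eval_var, h2, h3, NatExp.eval]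
    have hy : ∀ v, I.assigned (s.run env m) v = if v = w then g else I.assigned m v := by
      intro v
      simp [Instance.assigned, e₃, e₂, e₁, Function.update_apply, Fin.val_inj]
    refine ⟨⟨_, h.attach c1 c2 c3 c4 c5 (h.intact.run rfl _) ?_ hy fun x y => ?_⟩,
      fun v hv => ?_, fun _ _ _ => ?_⟩
    · rw [← h.grades]
      funext v
      exact congrFun (Stmt.run_nat (a := 5) (s := s) rfl env m) _
    · simp [e₃, e₂, e₁, Function.update_apply, mul_add_inj y.2 u.2, mul_add_inj y.2 w.2,
        Fin.val_inj]
    · rw [hy, if_neg]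
      rintro rfl
      omega
    · rw [hy, if_pos rfl]; exact c3
  · rw [hcond] at hc
    rw [Stmt.run]
    refine ⟨⟨T, h⟩, .refl m, fun h4 h5 h6 => ?_⟩
    by_contra h7
    refine hc ⟨h5.1, by omega, h4, ?_, h5.2.2⟩
    rcases h.level u h6 with rfl | h8
    · rw [h.root_eq]; exact h5.2.1
    · exact h8

/-- The vertices that the root reaches by at most `k` edges between vertices of grade at least `g`
are in the tree. -/
def Instance.Covered (I : Instance K) (b : Fin I.n → ℕ) (root : Fin I.n) (g k : ℕ) (m : Mem K) :
    Prop :=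
  ∀ w, ∀ p : (I.level b g).Walk w root, p.length ≤ k → 1 ≤ I.assigned m w

/-- One round of breadth-first search from the root: coverage extends by at least one edge. -/
theorem run_growRound {k : ℕ} (h1 : 1 ≤ g) (h : ∃ T, I.Growing b root g T m)
    (hk : I.Covered b root g k m) {env : ℕ → ℕ} (h0 : I.ℓ - env 0 = g) :
    (∃ T, I.Growing b root g T ((Stmt.for_ 2 true (.for_ 3 true growEdge)).run env m)) ∧
      I.AssignLe m ((Stmt.for_ 2 true (.for_ 3 true growEdge)).run env m) ∧
      I.Covered b root g (k + 1) ((Stmt.for_ 2 true (.for_ 3 true growEdge)).run env m) := by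
  set J : Mem K → Prop := fun m => (∃ T, I.Growing b root g T m) ∧ I.Covered b root g k m
  set Ψ : Fin I.n → Fin I.n → Mem K → Prop := fun u w m' => (I.level b g).Adj u w →
    ∀ p : (I.level b g).Walk u root, p.length ≤ k → 1 ≤ I.assigned m' w
  have hJ : ∀ {m : Mem K}, J m → I.Intact m := fun h => h.1.choose_spec.intact
  obtain ⟨k1, k2, k3⟩ := run_vertices (hJ ⟨h, hk⟩) (d := 2) (env := env) (p := .for_ 3 true growEdge)
    J I.AssignLe (fun u m' => ∀ w, Ψ u w m')
    .refl (fun _ _ _ => .trans) (fun u m₁ m₂ h12 h w ha p hp => h12.pos (h w ha p hp)) ⟨h, hk⟩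
    fun u m₁ hm₁ => by
      refine run_vertices (hJ hm₁) J I.AssignLe (Ψ u) .refl (fun _ _ _ => .trans)
        (fun u m₁ m₂ h12 h ha p hp => h12.pos (h ha p hp)) hm₁ fun w m₂ hm₂ => ?_
      obtain ⟨T', hT'⟩ := hm₂.1
      obtain ⟨h2, h3, h4⟩ := run_growEdge hT' (u := u) (w := w)
        (env := Function.update (Function.update env 2 u) 3 w)
        (by simpa using h0) (by simp) (by simp)
      exact ⟨⟨h2, fun x p hp => h3.pos (hm₂.2 x p hp)⟩, h3,
        fun ha p hp => h4 h1 ha (hm₂.2 u p hp)⟩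
  refine ⟨k1.1, k2, fun w p hp => ?_⟩
  cases p with
  | nil => exact k1.2 _ .nil (Nat.zero_le _)
  | cons ha q =>
    rw [SimpleGraph.Walk.length_cons] at hp
    exact k3 _ w ha.symm q (by omega)

theorem run_growLevel (h1 : 1 ≤ g) (hb : 1 ≤ b root) (h : ∃ T, I.Growing b root g T m)
    {env : ℕ → ℕ} (h0 : I.ℓ - env 0 = g) :
    (∃ T, I.Growing b root g T (growLevel.run env m)) ∧ I.AssignLe m (growLevel.run env m) ∧
      ∀ w, (I.level b g).Reachable w root → 1 ≤ I.assigned (growLevel.run env m) w := by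
  obtain ⟨k1, k2, k3⟩ := run_for_inv (d := 1) (env := env)
    (p := .for_ 2 true (.for_ 3 true growEdge)) h.choose_spec.intact.dim_true
    (fun k m' => (∃ T, I.Growing b root g T m') ∧ I.AssignLe m m' ∧ I.Covered b root g k m')
    ⟨h, .refl m, fun w p hp => by
      obtain rfl := SimpleGraph.Walk.eq_of_length_eq_zero (Nat.le_zero.1 hp)
      rw [h.choose_spec.root_eq]; exact hb⟩ fun k hk m' hm' => by
        obtain ⟨h2, h3, h4⟩ := run_growRound h1 hm'.1 hm'.2.2
          (env := Function.update env 1 k) (by simpa using h0)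
        exact ⟨h2, hm'.2.1.trans h3, h4⟩
  refine ⟨k1, k2, fun w hw => ?_⟩
  obtain ⟨p, hp⟩ := hw.exists_isPath
  have := hp.length_lt
  rw [Fintype.card_fin] at this
  exact k3 w p (by omega)

/-- The loop over the grades has `ℓ + 1` passes, the last of which treats grade `0`; only
preservation is needed there. -/
theorem run_growLevel_zero (h : ∃ T, I.Growing b root 0 T m) {env : ℕ → ℕ}
    (h0 : I.ℓ - env 0 = 0) :
    (∃ T, I.Growing b root 0 T (growLevel.run env m)) ∧ I.AssignLe m (growLevel.run env m) := by
  have hJ : ∀ {m : Mem K}, (∃ T, I.Growing b root 0 T m) → I.Intact m :=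
    fun h => h.choose_spec.intact
  set Ψ : Fin I.n → Mem K → Prop := fun _ _ => True
  have key := run_vertices (hJ h) (d := 1) (env := env) (p := .for_ 2 true (.for_ 3 true growEdge))
    (fun m => ∃ T, I.Growing b root 0 T m) I.AssignLe Ψ .refl (fun _ _ _ => .trans)
    (fun _ _ _ _ _ => trivial) h fun k m₁ hm₁ => by
    refine run_vertices (hJ hm₁) (fun m => ∃ T, I.Growing b root 0 T m) I.AssignLe Ψ .refl
      (fun _ _ _ => .trans) (fun _ _ _ _ _ => trivial) hm₁ (fun u m₂ hm₂ => ?_)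
      |>.imp_right (And.imp_right fun _ => trivial)
    refine run_vertices (hJ hm₂) (fun m => ∃ T, I.Growing b root 0 T m) I.AssignLe Ψ .refl
      (fun _ _ _ => .trans) (fun _ _ _ _ _ => trivial) hm₂ (fun w m₃ hm₃ => ?_)
      |>.imp_right (And.imp_right fun _ => trivial)
    obtain ⟨T', hT'⟩ := hm₃
    obtain ⟨h2, h3, -⟩ := run_growEdge hT' (u := u) (w := w)
      (env := Function.update (Function.update (Function.update env 1 k) 2 u) 3 w)
      (by simpa using h0) (by simp) (by simp)
    exact ⟨h2, h3, trivial⟩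
  exact ⟨key.1, key.2.1⟩

/-- Because grades are treated in descending order, a vertex is attached no later than at grade `g`
if it reaches the root in level `g`, and so receives at least `g`. The condition `g ≤ b w` matters
for `w = root` only, which reaches itself in every level. -/
theorem run_growLevels (hb : 1 ≤ b root) (h : ∃ T, I.Growing b root (I.ℓ + 1) T m)
    (env : ℕ → ℕ) :
    (∃ T, I.Growing b root 0 T ((Stmt.for_ 0 false growLevel).run env m)) ∧
      ∀ g ≤ I.ℓ, 1 ≤ g → ∀ w, g ≤ b w → (I.level b g).Reachable w root →
        g ≤ I.assigned ((Stmt.for_ 0 false growLevel).run env m) w := by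
  have key := run_for_inv (d := 0) (env := env) (p := growLevel)
    h.choose_spec.intact.dim_false
    (fun k m' => (∃ T, I.Growing b root (I.ℓ + 1 - k) T m') ∧
      ∀ g ≤ I.ℓ, 1 ≤ g → I.ℓ + 1 - k ≤ g → ∀ w, g ≤ b w → (I.level b g).Reachable w root →
        g ≤ I.assigned m' w) ⟨h, fun g hg _ h2 => by omega⟩ ?_
  · obtain ⟨k1, k2⟩ := key
    rw [Nat.sub_self] at k1
    exact ⟨k1, fun g hg h1 w hgw hw => k2 g hg h1 (by omega) w hgw hw⟩
  · rintro k hk m' ⟨⟨T, hT⟩, h2⟩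
    have hgk : I.ℓ + 1 - (k + 1) = I.ℓ - k := by omega
    have hT' : ∃ T, I.Growing b root (I.ℓ - k) T m' := ⟨T, hT.of_le (by omega)⟩
    rw [hgk]
    rcases Nat.eq_zero_or_pos (I.ℓ - k) with hz | hp
    · rw [hz] at hT' ⊢
      obtain ⟨h3, h4⟩ := run_growLevel_zero hT' (env := Function.update env 0 k) (by simpa using hz)
      refine ⟨h3, fun g hg h1 _ w hgw hw => ?_⟩
      have h5 := h2 g hg h1 (by omega) w hgw hw
      rwa [h4 w (h1.trans h5)]
    · obtain ⟨⟨T'', h3⟩, h4, h5⟩ := run_growLevel hp hb hT' (env := Function.update env 0 k)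
        (by simp)
      refine ⟨⟨T'', h3⟩, fun g hg h1 hle w hgw hw => ?_⟩
      rcases hle.eq_or_lt with rfl | hlt
      · rcases h3.level w (h5 w hw) with rfl | h6
        · rw [h3.root_eq]
          exact hgw
        · exact h6
      · have h6 := h2 g hg h1 (by omega) w hgw hw
        rwa [h4 w (h1.trans h6)]

/-- A tree with assigned grades that are sufficient is a solution. -/
theorem Instance.Growing.exists_feasible (h : I.Growing b root g T m) (hb : ∀ v, b v ≤ I.ℓ)
    (hroot : 1 ≤ b root) (hI : I.Valid) (hneed : ∀ t ∈ I.T, I.need t ≤ I.assigned m t) :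
    ∃ H : I.G.Subgraph, I.Output m H (I.assigned m) ∧ I.Feasible H (I.assigned m) := by
  let H : I.G.Subgraph :=
    { verts := {v | 1 ≤ I.assigned m v}
      Adj := T.Adj
      adj_sub := fun hab => h.le_G hab
      edge_vert := fun hab => h.pos _ _ hab
      symm := T.symm }
  have hH : H.spanningCoe = T := rfl
  have hconn : ∀ {u v : Fin I.n} (p : T.Walk u v) (hu : u ∈ H.verts) (hv : v ∈ H.verts),
      H.coe.Reachable ⟨u, hu⟩ ⟨v, hv⟩ := by
    intro u v p
    induction p with
    | nil => exact fun _ _ => .rfl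
    | @cons u w v ha p ih =>
      intro hu hv
      have hw : w ∈ H.verts := h.pos _ _ ha.symm
      have h1 : H.coe.Adj ⟨u, hu⟩ ⟨w, hw⟩ := ha
      exact h1.reachable.trans (ih hw hv)
  have hr : root ∈ H.verts := by
    change 1 ≤ I.assigned m root
    rw [h.root_eq]; exact hroot
  have hmem : ∀ t ∈ I.T, t ∈ H.verts := fun t ht =>
    (hI.one_le_need_iff.2 ht).trans (hneed t ht)
  refine ⟨H, ⟨fun v => rfl, fun u v => ?_⟩, ⟨?_, hmem, fun v hv => ⟨hv, (h.le v).trans (hb v)⟩,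
    fun v hv => ?_, fun t ht => ?_, fun u hu v hv p hp w hw => ?_⟩⟩
  · rw [h.edges]
  · have : Nonempty H.verts := ⟨⟨root, hr⟩⟩
    refine ⟨⟨fun u v => ?_⟩, h.acyclic.comap ⟨Subtype.val, fun hab => hab⟩ Subtype.val_injective⟩
    obtain ⟨p, -⟩ := h.walk u u.2
    obtain ⟨q, -⟩ := h.walk v v.2
    exact (hconn p u.2 hr).trans (hconn q v.2 hr).symm
  · exact Nat.lt_one_iff.1 (not_le.1 hv)
  · rw [← I.need_of_mem ht]; exact hneed t ht
  · obtain ⟨q, hq⟩ := h.walk u (hmem u hu)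
    obtain ⟨r, hr⟩ := h.walk v (hmem v hv)
    -- Paths in a forest are unique, so `p` is a shortcut of the walk from `u` via the root to `v`.
    -- The first half has at least the grade of `u`, the second at least that of `v`.
    have h1 := (h.acyclic.subsingleton_path u v).elim ⟨p, hp⟩
      ⟨(q.append r.reverse).bypass, SimpleGraph.Walk.bypass_isPath _⟩
    have h2 : p = (q.append r.reverse).bypass := congrArg Subtype.val h1
    have hw' : w ∈ (q.append r.reverse).bypass.support := h2 ▸ hw
    have h3 := (q.append r.reverse).support_bypass_subset_support hw'
    rw [SimpleGraph.Walk.mem_support_append_iff, SimpleGraph.Walk.support_reverse,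
      List.mem_reverse] at h3
    have hu' := hneed u hu
    have hv' := hneed v hv
    rw [I.need_of_mem hu] at hu'
    rw [I.need_of_mem hv] at hv'
    rcases h3 with h3 | h3
    · exact (min_le_left _ _).trans (hu'.trans (hq w h3))
    · exact (min_le_right _ _).trans (hv'.trans (hr w h3))

theorem run_findRoot (hm : I.Intact m) (hroot : ∀ v : Fin I.n, 1 ≤ m.nat 6 v ↔ v = root)
    (env : ℕ → ℕ) : (findRoot.run env m).nat 12 0 = root := by
  have key := run_for_inv (d := 0) (env := env)
    (p := .ite (.natLe (.const 1) (.cell 6 (var 0))) (.setNat 12 (.const 0) (var 0)) .skip)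
    hm.dim_true (fun k m' => m'.nat 6 = m.nat 6 ∧ ((root : ℕ) < k → m'.nat 12 0 = root))
    ⟨rfl, fun h => absurd h (Nat.not_lt_zero _)⟩ ?_
  · exact key.2 root.2
  · rintro k hk m' ⟨h1, h2⟩
    obtain ⟨v, rfl⟩ : ∃ v : Fin I.n, k = v := ⟨⟨k, hk⟩, rfl⟩
    refine ⟨(Stmt.run_nat rfl _ _).trans h1, fun hlt => ?_⟩
    have hcond : (Test.natLe (.const 1) (.cell 6 (var 0))).Holds
        (scope (Function.update env 0 (v : ℕ)) m') ↔ v = root := by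
      simp [Test.Holds, NatExp.eval, h1, hroot]
    rw [Stmt.run]
    split_ifs with hc
    · rw [hcond] at hc
      simp [Stmt.run, NatExp.eval, hc]
    · rw [hcond] at hc
      have : (root : ℕ) ≠ v := fun h3 => hc (Fin.ext h3.symm)
      exact h2 (by omega)

/-- The tree may use less than the grades that were bought, but never more, so growing it does not
increase the cost. -/
theorem run_growTree (hI : I.Valid) (hm : I.Intact m) (h3 : ∀ j, m.nat 3 j = 0)
    (h4 : ∀ j, m.nat 4 j = 0) (hactive : ∀ v : Fin I.n, 1 ≤ m.nat 6 v ↔ v = root)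
    (hℓ : ∀ v, I.grades m v ≤ I.ℓ) (hneed : ∀ v, I.need v ≤ I.grades m v) (hroot : root ∈ I.T)
    (hreach : ∀ t ∈ I.T, I.need t ≤ I.need root ∧
      (I.level (I.grades m) (I.need t)).Reachable t root) (env : ℕ → ℕ) :
    ∃ (H : I.G.Subgraph) (y : Fin I.n → ℕ), I.Output (growTree.run env m) H y ∧ I.Feasible H y ∧
      ∀ v, y v ≤ I.grades m v := by
  have hb : 1 ≤ I.grades m root := (hI.one_le_need_iff.2 hroot).trans (hneed root)
  set m₁ := findRoot.run env m with hm₁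
  set m₂ := (Stmt.setNat 3 (.cell 12 (.const 0)) (.cell 5 (.cell 12 (.const 0)))).run env m₁
    with hm₂
  have i₁ : I.Intact m₁ := hm.run rfl _
  have i₂ : I.Intact m₂ := i₁.run rfl _
  have r₁ : m₁.nat 12 0 = root := run_findRoot hm hactive env
  have g₁ : m₁.nat 5 = m.nat 5 := Stmt.run_nat rfl _ _
  have a₁ : m₁.nat 3 = m.nat 3 := Stmt.run_nat rfl _ _
  have t₁ : m₁.nat 4 = m.nat 4 := Stmt.run_nat rfl _ _
  have e₂ : m₂ = m₁.writeNat 3 root (I.grades m root) := by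
    simp [hm₂, Stmt.run, NatExp.eval, r₁, g₁, Instance.grades]
  have hy : ∀ v, I.assigned m₂ v = if v = root then I.grades m root else 0 := by
    intro v
    simp [Instance.assigned, e₂, Function.update_apply, Fin.val_inj, a₁, h3]
  -- The start is the root alone; no other vertex has a grade, so the level may be taken as `ℓ + 1`.
  have hG : I.Growing (I.grades m) root (I.ℓ + 1) ⊥ m₂ := by
    refine ⟨i₂, ?_, fun u v => ?_, bot_le, SimpleGraph.isAcyclic_bot, fun u v h => h.elim,
      fun v hv => ?_, fun v => ?_, ?_, fun v hv => ?_⟩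
    · funext v; simp [Instance.grades, e₂, g₁]
    · simp [e₂, t₁, h4]
    · rw [hy] at hv
      split_ifs at hv with h5
      · subst h5
        exact ⟨.nil, fun w hw => by simp at hw; rw [hw]⟩
      · omega
    · rw [hy]
      split_ifs with h5
      · rw [h5]
      · exact Nat.zero_le _
    · rw [hy, if_pos rfl]
    · rw [hy] at hv
      split_ifs at hv with h5
      · exact Or.inl h5
      · omega
  obtain ⟨⟨T, hT⟩, hcov⟩ := run_growLevels hb ⟨⊥, hG⟩ env
  obtain ⟨H, hO, hF⟩ := hT.exists_feasible hℓ hb hI fun t ht =>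
    hcov (I.need t) (hI.need_le t) (hI.one_le_need_iff.2 ht) t (hneed t) (hreach t ht).2
  exact ⟨H, _, hO, hF, hT.le⟩

end Grow

/-! ## The algorithm -/

/-- The approximation algorithm. -/
def approximation : Stmt := .seq initialize₀ (.seq shortestPaths (.seq mergeAll growTree))

section Approximation

variable {K : Type} [Field K] [LinearOrder K] [IsStrictOrderedRing K] {I : Instance K}

theorem run_initialize₀_paths (hI : I.Valid) (env : ℕ → ℕ) :
    I.Paths 0 (initialize₀.run env I.input) := by
  have h7 : I.Diagonal I.input := fun g r v h => by simp [Instance.input] at h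
  obtain ⟨⟨h1, h2⟩, h3⟩ := run_initialize₀ hI ⟨fun _ _ => rfl, rfl⟩ h7 env
  have h8 : ∀ j, (initialize₀.run env I.input).nat 8 j = 0 := fun j => by
    rw [Stmt.run_nat rfl]; simp [Instance.input]
  have hd : ∀ j, (initialize₀.run env I.input).num 2 j = 0 := fun j => by
    rw [Stmt.run_num rfl]; simp [Instance.input]
  refine ⟨h1, fun g hg v => ((h3 v).2.2 g hg).2, fun g hg r v hv => ?_, fun g hg r v p hp => ?_⟩
  · obtain rfl := h2 g r v hv
    refine ⟨⟨.nil, fun w hw hne => absurd (by simpa using hw) hne⟩, ?_⟩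
    simp [h8, hd]
  · cases p with
    | nil =>
      refine ⟨((h3 _).2.2 g hg).1, ?_⟩
      rw [hd]
      simp [Instance.walkCost]
    | cons _ _ => simp at hp

/-- When one active terminal is left, its logarithm term is ln 1 = 0, and the telescoped bound is 2
ln |T| times the reduced cost of an arbitrary solution. -/
theorem run_approximation (hI : I.Valid) {val : K →+* ℝ} (hval : Monotone val) (env : ℕ → ℕ) :
    ∃ (H : I.G.Subgraph) (y : Fin I.n → ℕ), I.Output (approximation.run env I.input) H y ∧
      I.Feasible H y ∧ ∀ H' y', I.Feasible H' y' → val (I.cost H y) ≤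
        val (I.total I.need) + 2 * Real.log I.T.card * val (∑ v, I.extra (y' v) v) := by
  set m₁ := initialize₀.run env I.input with hm₁
  set m₂ := shortestPaths.run env m₁ with hm₂
  set m₃ := mergeAll.run env m₂ with hm₃
  have hinit : ∀ v : Fin I.n, m₁.nat 5 v = I.need v ∧ (1 ≤ m₁.nat 6 v ↔ v ∈ I.T) := fun v =>
    ((run_initialize₀ hI ⟨fun _ _ => rfl, rfl⟩
      (fun g r v h => by simp [Instance.input] at h) env).2 v).imp_right And.left
  obtain ⟨i₂, t₂, hS⟩ := run_shortestPaths hI (run_initialize₀_paths hI env) env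
  have g₂ : I.grades m₂ = I.need := by
    funext v
    rw [Instance.grades, hm₂, Stmt.run_nat rfl]
    exact (hinit v).1
  have hM : I.Merged (fun g r v => m₂.num 2 (I.addr g r v)) (fun g r v => Finset.univ.filter fun w =>
        1 ≤ m₂.nat 8 (I.addr g r v * I.n + w)) val m₂ I.T := by
    refine ⟨⟨i₂, t₂, fun v => ?_, fun _ _ _ => rfl, fun g r v w => by simp⟩, Finset.Subset.refl _,
      hI.nonempty, ?_, ?_, ?_, fun H y _ => ?_⟩
    · rw [hm₂, Stmt.run_nat rfl]
      exact (hinit v).2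
    · rw [g₂]; exact fun _ => le_rfl
    · rw [g₂]; exact hI.need_le
    · exact fun t ht => ⟨t, ht, le_rfl, .rfl⟩
    · rw [g₂]; simp
  obtain ⟨root, hroot⟩ := run_mergeAll hI hS hval hM env
  have k₃ : ∀ j, m₃.nat 3 j = 0 := fun j => by
    rw [hm₃, Stmt.run_nat rfl, hm₂, Stmt.run_nat rfl, hm₁, Stmt.run_nat rfl]
    simp [Instance.input]
  have k₄ : ∀ j, m₃.nat 4 j = 0 := fun j => by
    rw [hm₃, Stmt.run_nat rfl, hm₂, Stmt.run_nat rfl, hm₁, Stmt.run_nat rfl]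
    simp [Instance.input]
  obtain ⟨H, y, hO, hF, hy⟩ := run_growTree hI hroot.view.intact k₃ k₄
    (fun v => by rw [hroot.view.active, Finset.mem_singleton]) hroot.le_ℓ hroot.need_le
    (hroot.subset (Finset.mem_singleton_self root)) (fun t ht => by
      obtain ⟨r, hr, h1, h2⟩ := hroot.reachable t ht
      rw [Finset.mem_singleton.1 hr] at h1 h2
      exact ⟨h1, h2⟩) env
  refine ⟨H, y, hO, hF, fun H' y' hF' => ?_⟩
  have h1 : I.cost H y ≤ I.total (I.grades m₃) := by
    rw [hF.cost_eq]
    exact Finset.sum_le_sum fun v _ => hI.price_mono v (hy v) (hroot.le_ℓ v)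
  have h2 := hroot.total H' y' hF'
  rw [Finset.card_singleton, Nat.cast_one, Real.log_one, sub_zero] at h2
  exact (hval h1).trans h2

theorem approximation_ratio (hI : I.Valid) {val : K →+* ℝ} (hval : Monotone val) (env : ℕ → ℕ) :
    ∃ (H : I.G.Subgraph) (y : Fin I.n → ℕ) (opt : K),
      I.Output (approximation.run env I.input) H y ∧ I.Feasible H y ∧ I.IsOpt opt ∧
      ((2 ≤ I.T.card ∨ ∀ v ∈ I.T, I.c (I.R v) v = 0) →
        val (I.cost H y) ≤ 2 * Real.log I.T.card * val opt) := by
  obtain ⟨H, y, hO, hF, hle⟩ := run_approximation hI hval env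
  obtain ⟨opt, hopt⟩ := hF.exists_isOpt
  refine ⟨H, y, opt, hO, hF, hopt, fun hcase => ?_⟩
  obtain ⟨H', y', hF', rfl⟩ := hopt.1
  refine (hle H' y' hF').trans ?_
  have h0 : (0 : K) ≤ I.total I.need :=
    Finset.sum_nonneg fun v _ => hI.price_nonneg v (hI.need_le v)
  have h0' := hval h0
  rw [map_zero] at h0'
  rw [hF'.cost_eq_add, map_add, mul_add]
  refine add_le_add_left ?_ _
  change val (I.total I.need) ≤ _ * val (I.total I.need)
  -- The prepaid amount enters with factor 1 and has to be bounded by 2 ln |T| times itself. This is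
  -- where |T| ≥ 2 is used, through 2 ln 2 > 1; otherwise the amount is zero.
  rcases hcase with h2 | hfree
  · have h3 : Real.log 2 ≤ Real.log I.T.card :=
      Real.log_le_log (by norm_num) (by exact_mod_cast h2)
    have h4 := Real.log_two_gt_d9
    exact le_mul_of_one_le_left h0' (by linarith)
  · have h3 : I.total I.need = 0 := Finset.sum_eq_zero fun v _ => by
      by_cases hv : v ∈ I.T
      · rw [Instance.price, I.need_of_mem hv, hfree v hv, ite_self]
      · rw [Instance.price, I.need_of_notMem hv, if_pos rfl]
    rw [h3, map_zero, mul_zero]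

end Approximation

end VGSST

end

/-- One program approximates the vertex-weighted grade-of-service Steiner tree problem within
`2 * log |T|` in polynomial time: for rational costs, in bit complexity, and for arbitrary real
costs, with unit-cost additions, subtractions and comparisons of reals. -/
theorem theorem1 :
    ∃ (p : VGSST.Prog) (q : Polynomial ℕ),
      VGSST.ApproximatesInTime p q VGSST.bitSize (fun x : ℚ => (x : ℝ)) ∧
      VGSST.ApproximatesInTime p q (fun _ : ℝ => 1) (fun x : ℝ => x) := by
  -- `rfl` evaluates the syntactic check `Stmt.ok`. The analysis over an ordered field serves both
  -- cases, with the cast of rationals and the identity as monotone ring homomorphisms to the reals.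
  refine ⟨VGSST.approximation.compile, VGSST.approximation.timeBound,
    VGSST.approximates_of_run _ rfl _ _ VGSST.exists_ratGauge fun I hI =>
      VGSST.approximation_ratio hI (val := Rat.castHom ℝ) Rat.cast_mono _,
    VGSST.approximates_of_run _ rfl _ _ (fun I hI => ?_) fun I hI =>
      VGSST.approximation_ratio hI (val := RingHom.id ℝ) monotone_id _⟩
  have h1 : 1 ≤ 2 * I.length fun _ => 1 := by
    have := hI.n_pos
    have := I.n_le_length fun _ => 1
    omega
  exact ⟨VGSST.unitGauge ℝ _ h1, trivial, fun _ _ _ => trivial⟩
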